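/- Let $p$ be a prime and let $\mathcal A_p$ be the mod $p$ Steenrod algebra, with operations $P^i$ ($=Sq^i$ if $p=2$) and $\beta$ ($=Sq^1$ if $p=2$). Let $A$ be a connected ($A^0=\mathbb F_p$) unstable algebra over $\mathcal A_p$ that is finitely generated as an $\mathcal A_p$-algebra, i.e. a finite subset of $A$ lies in no proper subalgebra stable under the Steenrod operations. Suppose that $A$ is a Hopf algebra, i.e. carries a map of graded algebras $\Delta\colon A\to A\otimes A$ (with the usual Koszul sign in the multiplication of $A\otimes A$) such that $\Delta x = x\otimes 1+1\otimes x+\sum x'\otimes x''$ with $|x'|,|x''|>0$ for $|x|>0$; coassociativity is not required. For a connected graded commutative algebra $B$ with augmentation ideal $\bar B$ let $QB=\bar B/\bar B^2$, and let $S(B)$ be the free graded commutative algebra on $\bar B$, on which Steenrod operations given on $B$ act through the Cartan formulas. Let $[x]\in S(B)$ denote the generator given by $x\in\bar B$, and let $\eta\colon S(B)\to B$, $[x]\mapsto x$, be the counit. The André–Quillen homology $H_n^Q(A)$ is the $n$-th homology group of the complex with terms $Q(S^{n+1}(A))$, $n\ge 0$, and differential $\sum_i(-1)^iQ(d_i)$,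 where $d_i=S^i(\eta)\colon S^{n+1}(A)\to S^{n}(A)$ for $0\le i\le n$ are the face maps; it inherits a grading and Steenrod operations. Then: 1. The counit $S(A)\to A$ induces an isomorphism $H_0^Q(A)\cong QA$ compatible with the gradings and the Steenrod operations, and $QA$ is a finitely generated unstable module over $\mathcal A_p$. 2. $H_1^Q(A)$ is a finitely generated unstable module over $\mathcal A_p$. 3. Let $(g_i)_{i\in I}$ be any family of homogeneous elements of positive degree that exhibits $A$, as an algebra, as a tensor product of monogenic algebras of the form $\mathbb F_p[g_i]/(g_i^{p^k})$ with $k\ge 1$ or $\mathbb F_p[g_i]$ (with $|g_i|$ even if $p$ is odd) or, for $p$ odd, exterior algebras $\Lambda(g_i)$ with $|g_i|$ odd. Call the $g_i$ of the first kind the truncated generators, of height $p^k$. Then there is a finite set $J$ of truncated generators such that, for each $k\ge 1$, the elements of height $p^k$ in $J$ generate the same submodule of $QA$ over the subalgebra of $\mathcal A_p$ generated by the $P^i$ as all truncated generators of height $p^k$, and such that the classes of the tensor powers $x^{\otimes p^k}=[x]^{p^k}\in S(A)$, for $x\in J$ of height $p^k$, generate $H_1^Q(A)$ over $\mathcal A_p$.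 Here a homogeneous $s\in S(A)$ of positive degree is regarded as the $1$-chain $[s]\in Q(S^2(A))$. -/

import Mathlib

open scoped TensorProduct

universe u

/-- Degree by which the operation `P i` raises degrees: `P i` is `Sq^i` (degree `i`) when `p = 2`,
and the reduced power of degree `2 i (p - 1)` when `p` is odd. -/
def degP (p i : ℕ) : ℕ := if p = 2 then i else 2 * i * (p - 1)

/-- A family of subspaces `deg n` of an `𝔽_p`-vector space, together with operations `P i`
(`i ≥ 0`; these are the Steenrod squares `Sq^i` if `p = 2`) and `β` (the Bockstein; `Sq^1` if
`p = 2`).  No law is imposed here, see `SteenrodData.IsUnstable`. -/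
structure SteenrodData (p : ℕ) (V : Type u) [AddCommGroup V] [Module (ZMod p) V] where
  deg : ℕ → Submodule (ZMod p) V
  P : ℕ → V →ₗ[ZMod p] V
  β : V →ₗ[ZMod p] V

namespace SteenrodData

variable {p : ℕ} {V : Type u} [AddCommGroup V] [Module (ZMod p) V]

/-- Unstable modules over the mod `p` Steenrod algebra: `ℕ`-graded vector spaces with operations
of the right degrees that satisfy the defining relations of the Steenrod algebra
(`P 0 = 1`, Adem relations, `β ∘ β = 0`) and the instability condition. -/
structure IsUnstable (D : SteenrodData p V) : Prop where
  isInternal : DirectSum.IsInternal D.deg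
  P_mem : ∀ i n x, x ∈ D.deg n → D.P i x ∈ D.deg (n + degP p i)
  β_mem : ∀ n x, x ∈ D.deg n → D.β x ∈ D.deg (n + 1)
  P_zero : ∀ x, D.P 0 x = x
  β_two : p = 2 → ∀ x, D.β x = D.P 1 x
  β_β : ∀ x, D.β (D.β x) = 0
  adem : ∀ a b, a < p * b → ∀ x, D.P a (D.P b x) =
    ∑ j ∈ Finset.range (a / p + 1),
      ((-1 : ZMod p) ^ (a + j) * (((p - 1) * (b - j) - 1).choose (a - p * j) : ℕ)) •
        D.P (a + b - j) (D.P j x)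
  adem_β : p ≠ 2 → ∀ a b, 0 < a → a ≤ p * b → ∀ x, D.P a (D.β (D.P b x)) =
    (∑ j ∈ Finset.range (a / p + 1),
      ((-1 : ZMod p) ^ (a + j) * (((p - 1) * (b - j)).choose (a - p * j) : ℕ)) •
        D.β (D.P (a + b - j) (D.P j x))) +
    ∑ j ∈ Finset.range ((a - 1) / p + 1),
      ((-1 : ZMod p) ^ (a + j - 1) * (((p - 1) * (b - j) - 1).choose (a - p * j - 1) : ℕ)) •
        D.P (a + b - j) (D.β (D.P j x))
  unstable_two : p = 2 → ∀ n i x, x ∈ D.deg n → n < i → D.P i x = 0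
  unstable_odd : p ≠ 2 → ∀ n i x, x ∈ D.deg n → n < 2 * i → D.P i x = 0
  unstable_odd_β : p ≠ 2 → ∀ n i x, x ∈ D.deg n → n < 2 * i + 1 → D.β (D.P i x) = 0

/-- Subspaces stable under all Steenrod operations. -/
def IsStable (D : SteenrodData p V) (W : Submodule (ZMod p) V) : Prop :=
  (∀ i, ∀ x ∈ W, D.P i x ∈ W) ∧ ∀ x ∈ W, D.β x ∈ W

/-- The submodule over the Steenrod algebra generated by a set. -/
def span (D : SteenrodData p V) (s : Set V) : Submodule (ZMod p) V :=
  sInf {W | D.IsStable W ∧ s ⊆ W}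

/-- The submodule over the subalgebra generated by the `P i` (which is the whole Steenrod
algebra if `p = 2`) generated by a set. -/
def spanP (D : SteenrodData p V) (s : Set V) : Submodule (ZMod p) V :=
  sInf {W | (∀ i, ∀ x ∈ W, D.P i x ∈ W) ∧ s ⊆ W}

/-- Finite generation over the Steenrod algebra. -/
def FG (D : SteenrodData p V) : Prop := ∃ s : Set V, s.Finite ∧ D.span s = ⊤

/-- Restriction of degrees and operations to a stable subspace. -/
def sub (D : SteenrodData p V) (W : Submodule (ZMod p) V) (h : D.IsStable W) :
    SteenrodData p W where
  deg n := (D.deg n).comap W.subtype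
  P i := (D.P i).restrict (h.1 i)
  β := D.β.restrict h.2

/-- Degrees and operations induced on the quotient by a stable subspace. -/
def quot (D : SteenrodData p V) (W : Submodule (ZMod p) V) (h : D.IsStable W) :
    SteenrodData p (V ⧸ W) where
  deg n := (D.deg n).map W.mkQ
  P i := W.mapQ W (D.P i) (h.1 i)
  β := W.mapQ W D.β h.2

end SteenrodData

/-- Connected, graded commutative `𝔽_p`-algebras with operations `P i` and `β` of the degrees of
the Steenrod operations that satisfy the Cartan formulas.  (Neither the Adem relations nor
instability are required here, see `SteenrodCAlg.IsUnstable`.) -/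
structure SteenrodCAlg (p : ℕ) where
  carrier : Type u
  [ring : Ring carrier]
  [algebra : Algebra (ZMod p) carrier]
  ops : SteenrodData p carrier
  isInternal : DirectSum.IsInternal ops.deg
  mul_mem_deg : ∀ {m n x y}, x ∈ ops.deg m → y ∈ ops.deg n → x * y ∈ ops.deg (m + n)
  nontrivial_one : (1 : carrier) ≠ 0
  connected : ops.deg 0 = Submodule.span (ZMod p) {1}
  graded_comm : ∀ {m n x y}, x ∈ ops.deg m → y ∈ ops.deg n →
    x * y = (-1 : ZMod p) ^ (m * n) • (y * x)
  P_mem : ∀ i {n x}, x ∈ ops.deg n → ops.P i x ∈ ops.deg (n + degP p i)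
  β_mem : ∀ {n x}, x ∈ ops.deg n → ops.β x ∈ ops.deg (n + 1)
  P_zero : ∀ x, ops.P 0 x = x
  P_mul : ∀ n x y, ops.P n (x * y) =
    ∑ ij ∈ Finset.HasAntidiagonal.antidiagonal n, ops.P ij.1 x * ops.P ij.2 y
  β_mul : ∀ {m x} (y), x ∈ ops.deg m →
    ops.β (x * y) = ops.β x * y + (-1 : ZMod p) ^ m • (x * ops.β y)

attribute [instance] SteenrodCAlg.ring SteenrodCAlg.algebra

namespace SteenrodCAlg

variable {p : ℕ}

/-- The homogeneous elements of positive degree `d`, remembered with their degree. -/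
@[ext]
structure Gen (B : SteenrodCAlg.{u} p) where
  d : ℕ
  val : B.carrier
  pos : 0 < d
  mem : val ∈ B.ops.deg d

/-- Morphisms: algebra maps that preserve degrees and commute with the operations. -/
structure Hom (B C : SteenrodCAlg.{u} p) where
  toAlgHom : B.carrier →ₐ[ZMod p] C.carrier
  map_deg : ∀ {n x}, x ∈ B.ops.deg n → toAlgHom x ∈ C.ops.deg n
  map_P : ∀ i x, toAlgHom (B.ops.P i x) = C.ops.P i (toAlgHom x)
  map_β : ∀ x, toAlgHom (B.ops.β x) = C.ops.β (toAlgHom x)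

section laws

variable (B : SteenrodCAlg.{u} p)

theorem one_mem_deg : (1 : B.carrier) ∈ B.ops.deg 0 := by
  rw [B.connected]; exact Submodule.mem_span_singleton_self 1

theorem pow_mem_deg {n : ℕ} {x : B.carrier} (hx : x ∈ B.ops.deg n) (k : ℕ) :
    x ^ k ∈ B.ops.deg (k * n) := by
  induction k with
  | zero => simpa using B.one_mem_deg
  | succ k ih => rw [pow_succ, Nat.succ_mul]; exact B.mul_mem_deg ih hx

theorem P_one (n : ℕ) (hn : 0 < n) : B.ops.P n (1 : B.carrier) = 0 := by
  induction n using Nat.strong_induction_on with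
  | _ n ih =>
    have h := B.P_mul n 1 1
    rw [mul_one, ← Finset.sum_subset (s₁ := {(0, n), (n, 0)})] at h
    · rw [Finset.sum_pair (by simp; omega)] at h
      simp only [B.P_zero, one_mul, mul_one] at h
      exact left_eq_add.mp h
    · intro x hx
      simp only [Finset.mem_insert, Finset.mem_singleton] at hx
      rcases hx with rfl | rfl <;> simp
    · rintro ⟨i, j⟩ hx hx'
      simp only [Finset.mem_insert, Finset.mem_singleton, Prod.mk.injEq, not_or,
        Finset.HasAntidiagonal.mem_antidiagonal] at hx hx'
      rw [ih i (by omega) (by omega), zero_mul]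

theorem β_one : B.ops.β (1 : B.carrier) = 0 := by
  have h := B.β_mul 1 B.one_mem_deg
  simpa using h

end laws

/-! ### The free graded commutative algebra on the augmentation ideal -/

section Sym

variable (B : SteenrodCAlg.{u} p)

/-- Relations of the free graded commutative algebra on the graded vector space of elements of
positive degree of `B`: linearity in each degree, and graded commutativity. -/
inductive SymRel : FreeAlgebra (ZMod p) B.Gen → FreeAlgebra (ZMod p) B.Gen → Prop
  | add (n : ℕ) (hn : 0 < n) (x y : B.carrier) (hx : x ∈ B.ops.deg n) (hy : y ∈ B.ops.deg n) :
      SymRel (FreeAlgebra.ι _ ⟨n, x + y, hn, add_mem hx hy⟩)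
        (FreeAlgebra.ι _ ⟨n, x, hn, hx⟩ + FreeAlgebra.ι _ ⟨n, y, hn, hy⟩)
  | smul (n : ℕ) (hn : 0 < n) (c : ZMod p) (x : B.carrier) (hx : x ∈ B.ops.deg n) :
      SymRel (FreeAlgebra.ι _ ⟨n, c • x, hn, Submodule.smul_mem _ c hx⟩)
        (c • FreeAlgebra.ι _ ⟨n, x, hn, hx⟩)
  | comm (x y : B.Gen) :
      SymRel (FreeAlgebra.ι _ x * FreeAlgebra.ι _ y)
        ((-1 : ZMod p) ^ (x.d * y.d) • (FreeAlgebra.ι _ y * FreeAlgebra.ι _ x))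

/-- The underlying algebra of the free graded commutative algebra `S(B)` on the augmentation
ideal (that is, the positive degree part) of `B`. -/
abbrev SymCarrier : Type u := RingQuot B.SymRel

/-- The generator `[x]` of `S(B)` for `x` homogeneous of positive degree in `B`. -/
noncomputable def symι (x : B.Gen) : B.SymCarrier :=
  RingQuot.mkAlgHom (ZMod p) B.SymRel (FreeAlgebra.ι _ x)

theorem symι_add (n : ℕ) (hn : 0 < n) (x y : B.carrier) (hx : x ∈ B.ops.deg n)
    (hy : y ∈ B.ops.deg n) :
    B.symι ⟨n, x + y, hn, add_mem hx hy⟩ = B.symι ⟨n, x, hn, hx⟩ + B.symι ⟨n, y, hn, hy⟩ := by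
  simpa [symι] using RingQuot.mkAlgHom_rel (ZMod p) (SymRel.add (B := B) n hn x y hx hy)

theorem symι_smul (n : ℕ) (hn : 0 < n) (c : ZMod p) (x : B.carrier) (hx : x ∈ B.ops.deg n) :
    B.symι ⟨n, c • x, hn, Submodule.smul_mem _ c hx⟩ = c • B.symι ⟨n, x, hn, hx⟩ := by
  simpa [symι] using RingQuot.mkAlgHom_rel (ZMod p) (SymRel.smul (B := B) n hn c x hx)

theorem symι_comm (x y : B.Gen) :
    B.symι x * B.symι y = (-1 : ZMod p) ^ (x.d * y.d) • (B.symι y * B.symι x) := by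
  simpa [symι] using RingQuot.mkAlgHom_rel (ZMod p) (SymRel.comm (B := B) x y)

theorem symι_eq_zero (x : B.Gen) (hx : x.val = 0) : B.symι x = 0 := by
  obtain ⟨n, v, hn, hv⟩ := x
  subst hx
  simpa using B.symι_smul n hn 0 0 hv

/-- The universal property of `S(B)`. -/
noncomputable def symLift {T : Type u} [Ring T] [Algebra (ZMod p) T] (f : B.Gen → T)
    (hadd : ∀ n hn x y hx hy,
      f ⟨n, x + y, hn, add_mem hx hy⟩ = f ⟨n, x, hn, hx⟩ + f ⟨n, y, hn, hy⟩)
    (hsmul : ∀ n hn (c : ZMod p) x hx,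
      f ⟨n, c • x, hn, Submodule.smul_mem _ c hx⟩ = c • f ⟨n, x, hn, hx⟩)
    (hcomm : ∀ x y, f x * f y = (-1 : ZMod p) ^ (x.d * y.d) • (f y * f x)) :
    B.SymCarrier →ₐ[ZMod p] T :=
  RingQuot.liftAlgHom (ZMod p) ⟨FreeAlgebra.lift (ZMod p) f, by
    rintro a b (⟨n, hn, x, y, hx, hy⟩ | ⟨n, hn, c, x, hx⟩ | ⟨x, y⟩)
    · simpa using hadd n hn x y hx hy
    · simpa using hsmul n hn c x hx
    · simpa using hcomm x y⟩

@[simp]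
theorem symLift_ι {T : Type u} [Ring T] [Algebra (ZMod p) T] (f : B.Gen → T) (h1 h2 h3)
    (x : B.Gen) : B.symLift f h1 h2 h3 (B.symι x) = f x := by
  simp [symLift, symι]

/-- The product of a word in the generators of `S(B)`. -/
noncomputable def symWord (l : List B.Gen) : B.SymCarrier := (l.map B.symι).prod

/-- The degree of a word in the generators. -/
def wordDeg (l : List B.Gen) : ℕ := (l.map Gen.d).sum

/-- The degree `n` part of `S(B)`. -/
noncomputable def symDeg (n : ℕ) : Submodule (ZMod p) B.SymCarrier :=
  Submodule.span (ZMod p) {s | ∃ l : List B.Gen, B.wordDeg l = n ∧ B.symWord l = s}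

@[simp] theorem symWord_nil : B.symWord [] = 1 := rfl
@[simp] theorem symWord_cons (x : B.Gen) (l : List B.Gen) :
    B.symWord (x :: l) = B.symι x * B.symWord l := by simp [symWord]
theorem symWord_append (l m : List B.Gen) :
    B.symWord (l ++ m) = B.symWord l * B.symWord m := by simp [symWord]
@[simp] theorem wordDeg_nil : B.wordDeg [] = 0 := rfl
@[simp] theorem wordDeg_cons (x : B.Gen) (l : List B.Gen) :
    B.wordDeg (x :: l) = x.d + B.wordDeg l := by simp [wordDeg]
theorem wordDeg_append (l m : List B.Gen) :
    B.wordDeg (l ++ m) = B.wordDeg l + B.wordDeg m := by simp [wordDeg]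

theorem symWord_mem (l : List B.Gen) : B.symWord l ∈ B.symDeg (B.wordDeg l) :=
  Submodule.subset_span ⟨l, rfl, rfl⟩

theorem symι_mem (x : B.Gen) : B.symι x ∈ B.symDeg x.d := by
  simpa using B.symWord_mem [x]

theorem sym_span : Submodule.span (ZMod p) (Set.range B.symWord) = ⊤ := by
  rw [eq_top_iff]
  rintro s -
  obtain ⟨a, rfl⟩ := RingQuot.mkAlgHom_surjective (ZMod p) B.SymRel s
  have hmul : ∀ a b : B.SymCarrier, a ∈ Submodule.span (ZMod p) (Set.range B.symWord) →
      b ∈ Submodule.span (ZMod p) (Set.range B.symWord) →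
      a * b ∈ Submodule.span (ZMod p) (Set.range B.symWord) := by
    intro a b ha hb
    induction ha using Submodule.span_induction with
    | mem a ha =>
      obtain ⟨l, rfl⟩ := ha
      induction hb using Submodule.span_induction with
      | mem b hb =>
        obtain ⟨m, rfl⟩ := hb
        exact Submodule.subset_span ⟨l ++ m, B.symWord_append l m⟩
      | zero => simp
      | add x y _ _ h1 h2 => rw [mul_add]; exact add_mem h1 h2
      | smul c x _ h => rw [mul_smul_comm]; exact Submodule.smul_mem _ c h
    | zero => simp
    | add x y _ _ h1 h2 => rw [add_mul]; exact add_mem h1 h2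
    | smul c x _ h => rw [smul_mul_assoc]; exact Submodule.smul_mem _ c h
  have hone : (1 : B.SymCarrier) ∈ Submodule.span (ZMod p) (Set.range B.symWord) :=
    Submodule.subset_span ⟨[], rfl⟩
  induction a using FreeAlgebra.induction with
  | grade0 r =>
    rw [AlgHom.commutes, Algebra.algebraMap_eq_smul_one]
    exact Submodule.smul_mem _ r hone
  | grade1 x => exact Submodule.subset_span ⟨[x], by rw [symWord_cons, symWord_nil, mul_one, symι]⟩
  | mul a b ha hb => rw [map_mul]; exact hmul _ _ ha hb
  | add a b ha hb => rw [map_add]; exact add_mem ha hb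

/-- To compare linear maps on `S(B)` it suffices to do so on words. -/
theorem sym_ext {T : Type*} [AddCommGroup T] [Module (ZMod p) T]
    {f g : B.SymCarrier →ₗ[ZMod p] T} (h : ∀ l, f (B.symWord l) = g (B.symWord l)) : f = g :=
  LinearMap.ext_on B.sym_span (by rintro _ ⟨l, rfl⟩; exact h l)

theorem sym_mul_mem {m n : ℕ} {x y : B.SymCarrier} (hx : x ∈ B.symDeg m) (hy : y ∈ B.symDeg n) :
    x * y ∈ B.symDeg (m + n) := by
  induction hx using Submodule.span_induction with
  | mem a ha =>
    obtain ⟨l, rfl, rfl⟩ := ha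
    induction hy using Submodule.span_induction with
    | mem b hb =>
      obtain ⟨m, rfl, rfl⟩ := hb
      rw [← B.symWord_append, ← B.wordDeg_append]
      exact B.symWord_mem _
    | zero => simp
    | add x y _ _ h1 h2 => rw [mul_add]; exact add_mem h1 h2
    | smul c x _ h => rw [mul_smul_comm]; exact Submodule.smul_mem _ c h
  | zero => simp
  | add x y _ _ h1 h2 => rw [add_mul]; exact add_mem h1 h2
  | smul c x _ h => rw [smul_mul_assoc]; exact Submodule.smul_mem _ c h

theorem sym_one_mem : (1 : B.SymCarrier) ∈ B.symDeg 0 := B.symWord_mem []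

/-- `S(B) → S(B)[T]`, multiplication by `T ^ n` in degree `n`. -/
noncomputable def symGrade : B.SymCarrier →ₐ[ZMod p] Polynomial B.SymCarrier :=
  B.symLift (fun x => Polynomial.monomial x.d (B.symι x))
    (by intro n hn x y hx hy; simp only [B.symι_add n hn x y hx hy, map_add])
    (by intro n hn c x hx; simp only [B.symι_smul n hn c x hx, Polynomial.smul_monomial])
    (by
      intro x y
      simp only [Polynomial.monomial_mul_monomial, Polynomial.smul_monomial]
      rw [B.symι_comm x y, add_comm])

theorem symGrade_apply {n : ℕ} {x : B.SymCarrier} (hx : x ∈ B.symDeg n) :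
    B.symGrade x = Polynomial.monomial n x := by
  induction hx using Submodule.span_induction with
  | mem a ha =>
    obtain ⟨l, rfl, rfl⟩ := ha
    induction l with
    | nil => simp
    | cons x l ih =>
      rw [symWord_cons, map_mul, ih, symGrade, symLift_ι, Polynomial.monomial_mul_monomial,
        wordDeg_cons]
  | zero => simp
  | add x y _ _ h1 h2 => rw [map_add, map_add, h1, h2]
  | smul c x _ h => rw [map_smul, h, Polynomial.smul_monomial]

theorem sym_isInternal : DirectSum.IsInternal B.symDeg := by
  classical
  rw [DirectSum.isInternal_submodule_iff_iSupIndep_and_iSup_eq_top]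
  constructor
  · rw [iSupIndep_iff_forall_dfinsupp]
    intro i x v h
    have hx := B.symGrade_apply x.2
    have : ∀ v : Π₀ j, B.symDeg j,
        (B.symGrade (DFinsupp.lsum ℕ (fun j => (B.symDeg j).subtype) (v.erase i))).coeff i = 0 := by
      intro v
      rw [DFinsupp.lsum_apply_apply, DFinsupp.sumAddHom_apply, DFinsupp.sum, map_sum,
        Polynomial.finsetSum_coeff]
      refine Finset.sum_eq_zero fun j hj => ?_
      have hji : j ≠ i := by rintro rfl; simp at hj
      have := B.symGrade_apply ((v.erase i) j).2
      simp only [LinearMap.toAddMonoidHom_coe, Submodule.subtype_apply]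
      rw [this, Polynomial.coeff_monomial, if_neg hji]
    have h2 := this v
    rw [show DFinsupp.lsum ℕ (fun j => (B.symDeg j).subtype) (v.erase i) = (x : B.SymCarrier) from h,
      hx, Polynomial.coeff_monomial, if_pos rfl] at h2
    exact Subtype.ext h2
  · rw [eq_top_iff, ← B.sym_span, Submodule.span_le]
    rintro _ ⟨l, rfl⟩
    exact Submodule.mem_iSup_of_mem _ (B.symWord_mem l)

theorem sym_nontrivial_one : (1 : B.SymCarrier) ≠ 0 := by
  intro h
  have hp : (1 : ZMod p) ≠ 0 := by
    intro h1
    apply B.nontrivial_one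
    rw [← one_smul (ZMod p) (1 : B.carrier), h1, zero_smul]
  let e : B.SymCarrier →ₐ[ZMod p] ULift.{u} (ZMod p) :=
    B.symLift (fun _ => 0) (by simp) (by simp) (by simp)
  have := congrArg (fun z => (e z).down) h
  simp at this
  exact hp this

theorem sym_connected : B.symDeg 0 = Submodule.span (ZMod p) {1} := by
  unfold symDeg
  congr 1
  ext s
  simp only [Set.mem_ofPred_eq, Set.mem_singleton_iff]
  constructor
  · rintro ⟨l, hl, rfl⟩
    cases l with
    | nil => rfl
    | cons x l => have := x.pos; simp at hl; omega
  · rintro rfl; exact ⟨[], rfl, rfl⟩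

theorem symι_mul_comm_word (x : B.Gen) (l : List B.Gen) :
    B.symι x * B.symWord l = (-1 : ZMod p) ^ (x.d * B.wordDeg l) • (B.symWord l * B.symι x) := by
  induction l with
  | nil => simp
  | cons y l ih =>
    rw [symWord_cons, ← mul_assoc, B.symι_comm x y, smul_mul_assoc, mul_assoc, ih, mul_smul_comm,
      smul_smul, ← pow_add, wordDeg_cons, mul_add, mul_assoc]

theorem sym_mul_comm {m n : ℕ} {x y : B.SymCarrier} (hx : x ∈ B.symDeg m) (hy : y ∈ B.symDeg n) :
    x * y = (-1 : ZMod p) ^ (m * n) • (y * x) := by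
  induction hx using Submodule.span_induction with
  | mem a ha =>
    obtain ⟨l, rfl, rfl⟩ := ha
    induction hy using Submodule.span_induction with
    | mem b hb =>
      obtain ⟨m, rfl, rfl⟩ := hb
      induction l with
      | nil => simp
      | cons z l ih =>
        rw [symWord_cons, mul_assoc, ih, mul_smul_comm, ← mul_assoc, B.symι_mul_comm_word,
          smul_mul_assoc, smul_smul, ← pow_add, wordDeg_cons, add_mul, add_comm, mul_assoc]
    | zero => simp
    | add x y _ _ h1 h2 => rw [mul_add, h1, h2, add_mul, smul_add]
    | smul c x _ h => rw [mul_smul_comm, h, smul_mul_assoc, smul_comm]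
  | zero => simp
  | add x y _ _ h1 h2 => rw [add_mul, h1, h2, mul_add, smul_add]
  | smul c x _ h => rw [mul_smul_comm, smul_mul_assoc, h, smul_comm]

theorem neg_one_pow_degP (m n i j : ℕ) :
    (-1 : ZMod p) ^ ((m + degP p i) * (n + degP p j)) = (-1 : ZMod p) ^ (m * n) := by
  by_cases hp : p = 2
  · subst hp
    rw [show (-1 : ZMod 2) = 1 from rfl, one_pow, one_pow]
  · have h : ∀ i, Even (degP p i) := fun i => by
      simp only [degP, if_neg hp, mul_assoc]; exact even_two_mul _
    rw [add_mul, mul_add, add_assoc, pow_add]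
    rw [Even.neg_one_pow (n := m * degP p j + degP p i * (n + degP p j)), mul_one]
    exact ((h j).mul_left m).add ((h i).mul_right _)

variable {B} in
/-- The operation `P i` on homogeneous elements. -/
def Gen.P (i : ℕ) (x : B.Gen) : B.Gen :=
  ⟨x.d + degP p i, B.ops.P i x.val, Nat.add_pos_left x.pos _, B.P_mem i x.mem⟩

variable {B} in
/-- The Bockstein on homogeneous elements. -/
def Gen.β (x : B.Gen) : B.Gen :=
  ⟨x.d + 1, B.ops.β x.val, Nat.succ_pos _, B.β_mem x.mem⟩

/-- The total power operation `s ↦ ∑ P i (s) t ^ i`, as the algebra map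
`S(B) → S(B)⟦t⟧` with `[x] ↦ ∑ [P i x] t ^ i`. -/
noncomputable def symTotal : B.SymCarrier →ₐ[ZMod p] PowerSeries B.SymCarrier :=
  B.symLift (fun x => PowerSeries.mk fun i => B.symι (x.P i))
    (by
      intro n hn x y hx hy
      ext i
      simp only [PowerSeries.coeff_mk, map_add, Gen.P]
      exact B.symι_add _ _ _ _ (B.P_mem i hx) (B.P_mem i hy))
    (by
      intro n hn c x hx
      ext i
      rw [LinearMap.map_smul_of_tower]
      simp only [PowerSeries.coeff_mk, map_smul, Gen.P]
      exact B.symι_smul _ _ c _ (B.P_mem i hx))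
    (by
      intro x y
      ext n
      rw [LinearMap.map_smul_of_tower]
      simp only [PowerSeries.coeff_mul, PowerSeries.coeff_mk, Finset.smul_sum]
      refine Finset.sum_equiv (Equiv.prodComm ℕ ℕ) (by simp [add_comm]) fun ij _ => ?_
      rw [B.symι_comm (x.P ij.1) (y.P ij.2)]
      simp only [Gen.P, neg_one_pow_degP, Equiv.prodComm_apply, Prod.fst_swap, Prod.snd_swap])

/-- The operation `P i` on `S(B)`, extended from `B` by the Cartan formula. -/
noncomputable def symP (i : ℕ) : B.SymCarrier →ₗ[ZMod p] B.SymCarrier where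
  toFun s := PowerSeries.coeff i (B.symTotal s)
  map_add' x y := by simp
  map_smul' c x := by rw [map_smul, LinearMap.map_smul_of_tower]; rfl

theorem symP_ι (i : ℕ) (x : B.Gen) : B.symP i (B.symι x) = B.symι (x.P i) := by
  simp [symP, symTotal]

theorem symP_one (i : ℕ) : B.symP i 1 = if i = 0 then 1 else 0 := by
  simp [symP, PowerSeries.coeff_one]

theorem symP_mul (n : ℕ) (x y : B.SymCarrier) : B.symP n (x * y) =
    ∑ ij ∈ Finset.HasAntidiagonal.antidiagonal n, B.symP ij.1 x * B.symP ij.2 y := by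
  simp [symP, PowerSeries.coeff_mul]

theorem degP_add (i j : ℕ) : degP p (i + j) = degP p i + degP p j := by
  unfold degP; split_ifs
  · rfl
  · ring

theorem symP_mem (i : ℕ) {n : ℕ} {x : B.SymCarrier} (hx : x ∈ B.symDeg n) :
    B.symP i x ∈ B.symDeg (n + degP p i) := by
  induction hx using Submodule.span_induction with
  | mem a ha =>
    obtain ⟨l, rfl, rfl⟩ := ha
    induction l generalizing i with
    | nil =>
      rw [symWord_nil, symP_one]
      split_ifs with h
      · subst h; simpa [degP] using B.sym_one_mem
      · exact zero_mem _
    | cons x l ih =>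
      rw [symWord_cons, symP_mul]
      refine Submodule.sum_mem _ fun ij hij => ?_
      rw [Finset.HasAntidiagonal.mem_antidiagonal] at hij
      rw [← hij, degP_add, wordDeg_cons, symP_ι, add_add_add_comm]
      exact B.sym_mul_mem (B.symι_mem (x.P ij.1)) (ih ij.2)
  | zero => simp
  | add x y _ _ h1 h2 => rw [map_add]; exact add_mem h1 h2
  | smul c x _ h => rw [map_smul]; exact Submodule.smul_mem _ c h

theorem symP_zero (x : B.SymCarrier) : B.symP 0 x = x := by
  have : B.symP 0 = LinearMap.id := by
    apply B.sym_ext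
    intro l
    induction l with
    | nil => simp [symP_one]
    | cons x l ih =>
      have hx : x.P 0 = x := by
        ext
        · simp [Gen.P, degP]
        · simp [Gen.P, B.P_zero]
      rw [symWord_cons, symP_mul]
      simp [symP_ι, hx] at ih ⊢
      rw [ih]
  rw [this]; rfl

/-- The algebra map `[x] ↦ !![±[x], [β x]; 0, [x]]` into upper triangular matrices, whose upper
right entry is the Bockstein of `S(B)`. -/
noncomputable def symTriangular : B.SymCarrier →ₐ[ZMod p] Matrix (Fin 2) (Fin 2) B.SymCarrier :=
  B.symLift (fun x => !![(-1 : ZMod p) ^ x.d • B.symι x, B.symι x.β; 0, B.symι x])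
    (by
      intro n hn x y hx hy
      have h1 := B.symι_add n hn x y hx hy
      have h2 := B.symι_add _ (Nat.succ_pos n) _ _ (B.β_mem hx) (B.β_mem hy)
      ext i j
      fin_cases i <;> fin_cases j <;> simp [Gen.β, h1]
      exact h2)
    (by
      intro n hn c x hx
      have h1 := B.symι_smul n hn c x hx
      have h2 := B.symι_smul _ (Nat.succ_pos n) c _ (B.β_mem hx)
      ext i j
      fin_cases i <;> fin_cases j <;> simp [Gen.β, h1, smul_comm c]
      exact h2)
    (by
      intro x y
      have h1 := B.symι_comm x y
      have h2 := B.symι_comm x y.β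
      have h3 := B.symι_comm x.β y
      have e2 : (-1 : ZMod p) ^ x.d * (-1) ^ (x.d * (y.d + 1)) = (-1) ^ (x.d * y.d) := by
        rw [← pow_add, mul_add, mul_one, add_left_comm, pow_add, ← two_mul, pow_mul]
        simp
      have e3 : (-1 : ZMod p) ^ ((x.d + 1) * y.d) = (-1) ^ (x.d * y.d) * (-1) ^ y.d := by
        rw [← pow_add, add_mul, one_mul]
      ext i j
      fin_cases i <;> fin_cases j
      · simp only [Matrix.mul_apply, Fin.sum_univ_two, Fin.zero_eta, Matrix.of_apply,
          Matrix.cons_val', Matrix.cons_val_zero, Matrix.cons_val_one, mul_zero, add_zero,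
          smul_mul_smul_comm, Matrix.smul_apply, Matrix.cons_val_fin_one, h1, smul_smul]
        congr 1
        ring
      · simp only [Gen.β] at h2 h3
        simp [Matrix.mul_apply, h2, h3, smul_smul, Gen.β, e2, e3, add_comm]
      · simp [Matrix.mul_apply]
      · simp [Matrix.mul_apply, h1])

/-- The Bockstein on `S(B)`, extended from `B` as a graded derivation. -/
noncomputable def symβ : B.SymCarrier →ₗ[ZMod p] B.SymCarrier where
  toFun s := B.symTriangular s 0 1
  map_add' x y := by simp
  map_smul' c x := by simp

theorem symβ_ι (x : B.Gen) : B.symβ (B.symι x) = B.symι x.β := by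
  simp [symβ, symTriangular]

theorem symβ_one : B.symβ 1 = 0 := by
  simp [symβ]

theorem symTriangular_diag (x : B.SymCarrier) :
    B.symTriangular x 1 1 = x := by
  have h : ∀ x, B.symTriangular x 1 0 = 0 ∧ B.symTriangular x 1 1 = x := by
    intro x
    have hx : x ∈ Submodule.span (ZMod p) (Set.range B.symWord) := by
      rw [B.sym_span]; trivial
    induction hx using Submodule.span_induction with
    | mem a ha =>
      obtain ⟨l, rfl⟩ := ha
      induction l with
      | nil => simp
      | cons x l ih =>
        rw [symWord_cons, map_mul, Matrix.mul_apply, Matrix.mul_apply, Fin.sum_univ_two,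
          Fin.sum_univ_two, ih.1, ih.2]
        simp [symTriangular]
    | zero => simp
    | add x y _ _ h1 h2 => simp [h1, h2]
    | smul c x _ h => simp [h]
  exact (h x).2

theorem symTriangular_sign {n : ℕ} {x : B.SymCarrier} (hx : x ∈ B.symDeg n) :
    B.symTriangular x 0 0 = (-1 : ZMod p) ^ n • x := by
  induction hx using Submodule.span_induction with
  | mem a ha =>
    obtain ⟨l, rfl, rfl⟩ := ha
    have h0 : ∀ l : List B.Gen, B.symTriangular (B.symWord l) 1 0 = 0 := by
      intro l
      induction l with
      | nil => simp
      | cons x l ih =>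
        rw [symWord_cons, map_mul, Matrix.mul_apply, Fin.sum_univ_two, ih]
        simp [symTriangular]
    induction l with
    | nil => simp
    | cons x l ih =>
      rw [symWord_cons, map_mul, Matrix.mul_apply, Fin.sum_univ_two, ih, h0, mul_zero, add_zero,
        wordDeg_cons, pow_add]
      simp [symTriangular, smul_smul]
      exact congrArg (· • (B.symι x * B.symWord l)) (mul_comm _ _)
  | zero => simp
  | add x y _ _ h1 h2 => simp [h1, h2]
  | smul c x _ h => simp [h, smul_comm c]

theorem symβ_mul {m : ℕ} {x : B.SymCarrier} (y : B.SymCarrier) (hx : x ∈ B.symDeg m) :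
    B.symβ (x * y) = B.symβ x * y + (-1 : ZMod p) ^ m • (x * B.symβ y) := by
  change B.symTriangular (x * y) 0 1 = _
  rw [map_mul, Matrix.mul_apply, Fin.sum_univ_two, B.symTriangular_sign hx,
    B.symTriangular_diag, add_comm, smul_mul_assoc]
  rfl

theorem symβ_mem {n : ℕ} {x : B.SymCarrier} (hx : x ∈ B.symDeg n) :
    B.symβ x ∈ B.symDeg (n + 1) := by
  induction hx using Submodule.span_induction with
  | mem a ha =>
    obtain ⟨l, rfl, rfl⟩ := ha
    induction l with
    | nil => rw [symWord_nil, symβ_one]; exact zero_mem _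
    | cons x l ih =>
      rw [symWord_cons, B.symβ_mul _ (B.symι_mem x), wordDeg_cons, symβ_ι]
      refine add_mem ?_ (Submodule.smul_mem _ _ ?_)
      · rw [add_right_comm]
        exact B.sym_mul_mem (B.symι_mem x.β) (B.symWord_mem l)
      · rw [add_assoc]
        exact B.sym_mul_mem (B.symι_mem x) ih
  | zero => simp
  | add x y _ _ h1 h2 => rw [map_add]; exact add_mem h1 h2
  | smul c x _ h => rw [map_smul]; exact Submodule.smul_mem _ c h

/-- The free graded commutative algebra `S(B)` on the augmentation ideal of `B`, with the
operations extended from `B` by the Cartan formulas. -/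
noncomputable def sym : SteenrodCAlg.{u} p where
  carrier := B.SymCarrier
  ops := ⟨B.symDeg, B.symP, B.symβ⟩
  isInternal := B.sym_isInternal
  mul_mem_deg := B.sym_mul_mem
  nontrivial_one := B.sym_nontrivial_one
  connected := B.sym_connected
  graded_comm := B.sym_mul_comm
  P_mem := B.symP_mem
  β_mem := B.symβ_mem
  P_zero := B.symP_zero
  P_mul := B.symP_mul
  β_mul := B.symβ_mul

section

variable {B} {C : SteenrodCAlg.{u} p} (F : B.SymCarrier →ₐ[ZMod p] C.carrier)

theorem symF_deg (hdeg : ∀ x, F (B.symι x) ∈ C.ops.deg x.d) {n : ℕ} {x : B.SymCarrier}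
    (hx : x ∈ B.symDeg n) : F x ∈ C.ops.deg n := by
  induction hx using Submodule.span_induction with
  | mem a ha =>
    obtain ⟨l, rfl, rfl⟩ := ha
    induction l with
    | nil => rw [symWord_nil, map_one]; exact C.one_mem_deg
    | cons x l ih =>
      rw [symWord_cons, map_mul, wordDeg_cons]
      exact C.mul_mem_deg (hdeg x) ih
  | zero => rw [map_zero]; exact zero_mem _
  | add x y _ _ h1 h2 => rw [map_add]; exact add_mem h1 h2
  | smul c x _ h => rw [map_smul]; exact Submodule.smul_mem _ c h

theorem symF_P (hP : ∀ i x, F (B.symι (x.P i)) = C.ops.P i (F (B.symι x))) (i : ℕ)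
    (x : B.SymCarrier) : F (B.symP i x) = C.ops.P i (F x) := by
  have : ∀ i, F.toLinearMap ∘ₗ B.symP i = C.ops.P i ∘ₗ F.toLinearMap := by
    intro i
    apply B.sym_ext
    intro l
    simp only [LinearMap.comp_apply, AlgHom.toLinearMap_apply]
    induction l generalizing i with
    | nil =>
      rw [symWord_nil, symP_one, map_one]
      split_ifs with h
      · rw [h, C.P_zero, map_one]
      · rw [C.P_one i (Nat.pos_of_ne_zero h), map_zero]
    | cons x l ih =>
      rw [symWord_cons, symP_mul, map_sum, map_mul, C.P_mul]
      refine Finset.sum_congr rfl fun ij _ => ?_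
      rw [map_mul, ih, symP_ι, hP]
  exact LinearMap.congr_fun (this i) x

theorem symF_β (hdeg : ∀ x, F (B.symι x) ∈ C.ops.deg x.d)
    (hβ : ∀ x : B.Gen, F (B.symι x.β) = C.ops.β (F (B.symι x))) (x : B.SymCarrier) :
    F (B.symβ x) = C.ops.β (F x) := by
  have : F.toLinearMap ∘ₗ B.symβ = C.ops.β ∘ₗ F.toLinearMap := by
    apply B.sym_ext
    intro l
    simp only [LinearMap.comp_apply, AlgHom.toLinearMap_apply]
    induction l with
    | nil => rw [symWord_nil, symβ_one, map_one, C.β_one, map_zero]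
    | cons x l ih =>
      rw [symWord_cons, B.symβ_mul _ (B.symι_mem x), map_mul, C.β_mul _ (hdeg x), map_add,
        map_mul, map_smul, map_mul, ih, symβ_ι, hβ]
  exact LinearMap.congr_fun this x

end

/-- The map `S(B) → C` determined by a map `f` on the generators that is linear in each degree
and compatible with degrees and operations. -/
noncomputable def symHom (C : SteenrodCAlg.{u} p) (f : B.Gen → C.carrier)
    (hadd : ∀ n hn x y hx hy,
      f ⟨n, x + y, hn, add_mem hx hy⟩ = f ⟨n, x, hn, hx⟩ + f ⟨n, y, hn, hy⟩)
    (hsmul : ∀ n hn (c : ZMod p) x hx,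
      f ⟨n, c • x, hn, Submodule.smul_mem _ c hx⟩ = c • f ⟨n, x, hn, hx⟩)
    (hdeg : ∀ x, f x ∈ C.ops.deg x.d)
    (hP : ∀ i x, f (x.P i) = C.ops.P i (f x))
    (hβ : ∀ x, f x.β = C.ops.β (f x)) : Hom B.sym C where
  toAlgHom := B.symLift f hadd hsmul (fun x y => C.graded_comm (hdeg x) (hdeg y))
  map_deg := symF_deg _ (fun x => by rw [symLift_ι]; exact hdeg x)
  map_P := symF_P _ (fun i x => by rw [symLift_ι, symLift_ι, hP])
  map_β := symF_β _ (fun x => by rw [symLift_ι]; exact hdeg x)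
    (fun x => by rw [symLift_ι, symLift_ι, hβ])

theorem symHom_ι (C : SteenrodCAlg.{u} p) (f : B.Gen → C.carrier) (h1 h2 h3 h4 h5) (x : B.Gen) :
    (B.symHom C f h1 h2 h3 h4 h5).toAlgHom (B.symι x) = f x :=
  B.symLift_ι f h1 h2 (fun x y => C.graded_comm (h3 x) (h3 y)) x

/-- The counit `S(B) → B`, `[x] ↦ x`, of the symmetric algebra comonad. -/
noncomputable def counit : Hom B.sym B :=
  B.symHom B Gen.val (fun _ _ _ _ _ _ => rfl) (fun _ _ _ _ _ => rfl) Gen.mem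
    (fun _ _ => rfl) (fun _ => rfl)

variable {B} in
/-- Functoriality on homogeneous elements. -/
def Gen.map {C : SteenrodCAlg.{u} p} (f : Hom B C) (x : B.Gen) : C.Gen :=
  ⟨x.d, f.toAlgHom x.val, x.pos, f.map_deg x.mem⟩

variable {B} in
theorem Gen.map_P {C : SteenrodCAlg.{u} p} (f : Hom B C) (i : ℕ) (x : B.Gen) :
    (x.P i).map f = (x.map f).P i := by
  ext
  · rfl
  · exact f.map_P i x.val

variable {B} in
theorem Gen.map_β {C : SteenrodCAlg.{u} p} (f : Hom B C) (x : B.Gen) :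
    x.β.map f = (x.map f).β := by
  ext
  · rfl
  · exact f.map_β x.val

variable {B} in
/-- Functoriality of `S`: the map `S(f) : S(B) → S(C)`, `[x] ↦ [f x]`. -/
noncomputable def symMap {C : SteenrodCAlg.{u} p} (f : Hom B C) : Hom B.sym C.sym :=
  B.symHom C.sym (fun x => C.symι (x.map f))
    (by
      intro n hn x y hx hy
      simp only [Gen.map, map_add]
      exact C.symι_add n hn _ _ (f.map_deg hx) (f.map_deg hy))
    (by
      intro n hn c x hx
      simp only [Gen.map, map_smul]
      exact C.symι_smul n hn c _ (f.map_deg hx))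
    (fun x => C.symι_mem (x.map f))
    (fun i x => (congrArg C.symι (x.map_P f i)).trans (C.symP_ι i (x.map f)).symm)
    (fun x => (congrArg C.symι (x.map_β f)).trans (C.symβ_ι (x.map f)).symm)

end Sym

/-! ### Indecomposables -/

section Indec

variable (B : SteenrodCAlg.{u} p)

/-- The augmentation ideal: the span of the homogeneous elements of positive degree. -/
def augIdeal : Submodule (ZMod p) B.carrier :=
  Submodule.span (ZMod p) {x | ∃ n, 0 < n ∧ x ∈ B.ops.deg n}

variable {B} in
theorem Gen.mem_augIdeal (x : B.Gen) : x.val ∈ B.augIdeal :=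
  Submodule.subset_span ⟨x.d, x.pos, x.mem⟩

theorem augIdeal_stable : B.ops.IsStable B.augIdeal := by
  constructor
  · intro i x hx
    induction hx using Submodule.span_induction with
    | mem a ha =>
      obtain ⟨n, hn, ha⟩ := ha
      exact Submodule.subset_span ⟨_, Nat.add_pos_left hn _, B.P_mem i ha⟩
    | zero => rw [map_zero]; exact zero_mem _
    | add x y _ _ h1 h2 => rw [map_add]; exact add_mem h1 h2
    | smul c x _ h => rw [map_smul]; exact Submodule.smul_mem _ c h
  · intro x hx
    induction hx using Submodule.span_induction with
    | mem a ha =>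
      obtain ⟨n, hn, ha⟩ := ha
      exact Submodule.subset_span ⟨_, Nat.succ_pos n, B.β_mem ha⟩
    | zero => rw [map_zero]; exact zero_mem _
    | add x y _ _ h1 h2 => rw [map_add]; exact add_mem h1 h2
    | smul c x _ h => rw [map_smul]; exact Submodule.smul_mem _ c h

/-- The decomposable elements, as a subspace of the augmentation ideal: the span of the products
of two elements of the augmentation ideal. -/
def decomposables : Submodule (ZMod p) B.augIdeal :=
  (Submodule.span (ZMod p)
    {z : B.carrier | ∃ x ∈ B.augIdeal, ∃ y ∈ B.augIdeal, x * y = z}).comap B.augIdeal.subtype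

/-- Degrees and operations on the augmentation ideal. -/
def augOps : SteenrodData p B.augIdeal := B.ops.sub B.augIdeal B.augIdeal_stable

theorem decomposables_stable : B.augOps.IsStable B.decomposables := by
  set D := Submodule.span (ZMod p)
    {z : B.carrier | ∃ x ∈ B.augIdeal, ∃ y ∈ B.augIdeal, x * y = z} with hD
  have hst := B.augIdeal_stable
  have h : B.ops.IsStable D := by
    constructor
    · intro i z hz
      induction hz using Submodule.span_induction with
      | mem a ha =>
        obtain ⟨x, hx, y, hy, rfl⟩ := ha
        rw [B.P_mul]
        exact Submodule.sum_mem _ fun ij _ =>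
          Submodule.subset_span ⟨_, hst.1 _ _ hx, _, hst.1 _ _ hy, rfl⟩
      | zero => rw [map_zero]; exact zero_mem _
      | add x y _ _ h1 h2 => rw [map_add]; exact add_mem h1 h2
      | smul c x _ h => rw [map_smul]; exact Submodule.smul_mem _ c h
    · intro z hz
      induction hz using Submodule.span_induction with
      | mem a ha =>
        obtain ⟨x, hx, y, hy, rfl⟩ := ha
        induction hx using Submodule.span_induction with
        | mem a ha =>
          obtain ⟨n, hn, ha⟩ := ha
          have ha' : a ∈ B.augIdeal := Submodule.subset_span ⟨n, hn, ha⟩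
          rw [B.β_mul y ha]
          exact add_mem (Submodule.subset_span ⟨_, hst.2 _ ha', _, hy, rfl⟩)
            (Submodule.smul_mem _ _ (Submodule.subset_span ⟨_, ha', _, hst.2 _ hy, rfl⟩))
        | zero => rw [zero_mul, map_zero]; exact zero_mem _
        | add x y _ _ h1 h2 => rw [add_mul, map_add]; exact add_mem h1 h2
        | smul c x _ h => rw [smul_mul_assoc, map_smul]; exact Submodule.smul_mem _ c h
      | zero => rw [map_zero]; exact zero_mem _
      | add x y _ _ h1 h2 => rw [map_add]; exact add_mem h1 h2
      | smul c x _ h => rw [map_smul]; exact Submodule.smul_mem _ c h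
  exact ⟨fun i x hx => h.1 i x hx, fun x hx => h.2 x hx⟩

/-- The module of indecomposables `QB`. -/
abbrev Indec : Type u := B.augIdeal ⧸ B.decomposables

/-- Degrees and operations on `QB`. -/
def indecOps : SteenrodData p B.Indec := B.augOps.quot B.decomposables B.decomposables_stable

variable {B} in
/-- The class in `QB` of a homogeneous element of positive degree. -/
def Gen.toIndec (x : B.Gen) : B.Indec := B.decomposables.mkQ ⟨x.val, x.mem_augIdeal⟩

variable {B} {C : SteenrodCAlg.{u} p}

theorem Hom.map_augIdeal (f : Hom B C) : ∀ x ∈ B.augIdeal, f.toAlgHom.toLinearMap x ∈ C.augIdeal := by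
  intro x hx
  induction hx using Submodule.span_induction with
  | mem a ha =>
    obtain ⟨n, hn, ha⟩ := ha
    exact Submodule.subset_span ⟨n, hn, f.map_deg ha⟩
  | zero => rw [map_zero]; exact zero_mem _
  | add x y _ _ h1 h2 => rw [map_add]; exact add_mem h1 h2
  | smul c x _ h => rw [map_smul]; exact Submodule.smul_mem _ c h

theorem Hom.map_decomposables (f : Hom B C) :
    B.decomposables ≤ C.decomposables.comap (f.toAlgHom.toLinearMap.restrict f.map_augIdeal) := by
  rintro ⟨x, hx⟩ h
  change f.toAlgHom x ∈ Submodule.span _ _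
  change x ∈ Submodule.span _ _ at h
  clear hx
  induction h using Submodule.span_induction with
  | mem a ha =>
    obtain ⟨x, hx, y, hy, rfl⟩ := ha
    rw [map_mul]
    exact Submodule.subset_span ⟨_, f.map_augIdeal _ hx, _, f.map_augIdeal _ hy, rfl⟩
  | zero => rw [map_zero]; exact zero_mem _
  | add x y _ _ h1 h2 => rw [map_add]; exact add_mem h1 h2
  | smul c x _ h => rw [map_smul]; exact Submodule.smul_mem _ c h

/-- Functoriality of `Q`. -/
def Hom.mapIndec (f : Hom B C) : B.Indec →ₗ[ZMod p] C.Indec :=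
  B.decomposables.mapQ C.decomposables (f.toAlgHom.toLinearMap.restrict f.map_augIdeal)
    f.map_decomposables

theorem Hom.mapIndec_P (f : Hom B C) (i : ℕ) (x : B.Indec) :
    f.mapIndec (B.indecOps.P i x) = C.indecOps.P i (f.mapIndec x) := by
  obtain ⟨x, rfl⟩ := B.decomposables.mkQ_surjective x
  exact congrArg C.decomposables.mkQ (Subtype.ext (f.map_P i x.1))

theorem Hom.mapIndec_β (f : Hom B C) (x : B.Indec) :
    f.mapIndec (B.indecOps.β x) = C.indecOps.β (f.mapIndec x) := by
  obtain ⟨x, rfl⟩ := B.decomposables.mkQ_surjective x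
  exact congrArg C.decomposables.mkQ (Subtype.ext (f.map_β x.1))

theorem Hom.mapIndec_toIndec (f : Hom B C) (x : B.Gen) :
    f.mapIndec x.toIndec = (x.map f).toIndec := rfl

end Indec

/-! ### André–Quillen homology -/

section AndreQuillen

variable (A : SteenrodCAlg.{u} p)

/-- The iterates `S^n(A)` of the symmetric algebra comonad. -/
noncomputable def symIter : ℕ → SteenrodCAlg.{u} p
  | 0 => A
  | n + 1 => (symIter n).sym

/-- The face maps `d_i : S^{n+1}(A) → S^n(A)` of the simplicial resolution `S^•(A) → A`:
`d_i = S^i(η)` where `η : S(S^{n-i}(A)) → S^{n-i}(A)` is the counit of the comonad. -/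
noncomputable def face : (n : ℕ) → Fin (n + 1) → Hom (A.symIter (n + 1)) (A.symIter n)
  | 0, _ => A.counit
  | n + 1, i => Fin.cases (A.symIter (n + 1)).counit (fun j => symMap (face n j)) i

/-- The `n`-th term `Q(S^{n+1}(A))` of the complex of indecomposables of the simplicial
resolution. -/
abbrev AQChain (n : ℕ) : Type u := (A.symIter (n + 1)).Indec

/-- The differential `∑ (-1)^i Q(d_i)`. -/
noncomputable def aqD (n : ℕ) : A.AQChain (n + 1) →ₗ[ZMod p] A.AQChain n :=
  ∑ i : Fin (n + 2), (-1 : ZMod p) ^ (i : ℕ) • (A.face (n + 1) i).mapIndec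

/-- Degrees and operations on the chains. -/
noncomputable def aqChainOps (n : ℕ) : SteenrodData p (A.AQChain n) :=
  (A.symIter (n + 1)).indecOps

theorem aqD_P (n i : ℕ) (x : A.AQChain (n + 1)) :
    A.aqD n ((A.aqChainOps (n + 1)).P i x) = (A.aqChainOps n).P i (A.aqD n x) := by
  simp only [aqD, LinearMap.sum_apply, LinearMap.smul_apply, map_sum, map_smul]
  exact Finset.sum_congr rfl fun j _ => congrArg _ (Hom.mapIndec_P _ i x)

theorem aqD_β (n : ℕ) (x : A.AQChain (n + 1)) :
    A.aqD n ((A.aqChainOps (n + 1)).β x) = (A.aqChainOps n).β (A.aqD n x) := by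
  simp only [aqD, LinearMap.sum_apply, LinearMap.smul_apply, map_sum, map_smul]
  exact Finset.sum_congr rfl fun j _ => congrArg _ (Hom.mapIndec_β _ x)

/-- The cycles; every `0`-chain is a cycle. -/
noncomputable def aqCycles : (n : ℕ) → Submodule (ZMod p) (A.AQChain n)
  | 0 => ⊤
  | n + 1 => LinearMap.ker (A.aqD n)

theorem aqCycles_stable (n : ℕ) : (A.aqChainOps n).IsStable (A.aqCycles n) := by
  cases n with
  | zero => exact ⟨fun _ _ _ => trivial, fun _ _ => trivial⟩
  | succ n =>
    constructor
    · intro i x hx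
      have hx : A.aqD n x = 0 := hx
      change A.aqD n _ = 0
      rw [aqD_P, hx, map_zero]
    · intro x hx
      have hx : A.aqD n x = 0 := hx
      change A.aqD n _ = 0
      rw [aqD_β, hx, map_zero]

/-- Degrees and operations on the cycles. -/
noncomputable def aqCycleOps (n : ℕ) : SteenrodData p (A.aqCycles n) :=
  (A.aqChainOps n).sub (A.aqCycles n) (A.aqCycles_stable n)

/-- The boundaries, as a subspace of the cycles. -/
noncomputable def aqBoundaries (n : ℕ) : Submodule (ZMod p) (A.aqCycles n) :=
  (LinearMap.range (A.aqD n)).comap (A.aqCycles n).subtype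

theorem aqBoundaries_stable (n : ℕ) : (A.aqCycleOps n).IsStable (A.aqBoundaries n) := by
  constructor
  · rintro i x ⟨y, hy⟩
    exact ⟨(A.aqChainOps (n + 1)).P i y, (A.aqD_P n i y).trans (congrArg _ hy)⟩
  · rintro x ⟨y, hy⟩
    exact ⟨(A.aqChainOps (n + 1)).β y, (A.aqD_β n y).trans (congrArg _ hy)⟩

/-- The André–Quillen homology `H_n^Q(A)`. -/
abbrev AQ (n : ℕ) : Type u := A.aqCycles n ⧸ A.aqBoundaries n

/-- Degrees and Steenrod operations on `H_n^Q(A)`. -/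
noncomputable def aqOps (n : ℕ) : SteenrodData p (A.AQ n) :=
  (A.aqCycleOps n).quot (A.aqBoundaries n) (A.aqBoundaries_stable n)

variable {A}

/-- The tensor power `x^{⊗ m} ∈ S(A)`, that is, the `m`-th power of the generator `[x]` in the
algebra `S(A)`. -/
noncomputable def Gen.tensorPow (x : A.Gen) (m : ℕ) (hm : 0 < m) : A.sym.Gen :=
  ⟨m * x.d, A.symι x ^ m, Nat.mul_pos hm x.pos, A.sym.pow_mem_deg (A.symι_mem x) m⟩

/-- The generator `[x]`, as a homogeneous element of `S(B)`. -/
noncomputable def Gen.unit {B : SteenrodCAlg.{u} p} (x : B.Gen) : B.sym.Gen :=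
  ⟨x.d, B.symι x, x.pos, B.symι_mem x⟩

/-- The `1`-chain given by a homogeneous element `s` of `S(A)` of positive degree: the class of
`[s]` in `Q(S(S(A)))`. -/
noncomputable def Gen.toChain (s : A.sym.Gen) : A.AQChain 1 :=
  Gen.toIndec (B := A.sym.sym) s.unit

theorem counit_ι (x : A.Gen) : A.counit.toAlgHom (A.symι x) = x.val :=
  A.symLift_ι Gen.val (fun _ _ _ _ _ _ => rfl) (fun _ _ _ _ _ => rfl)
    (fun x y => A.graded_comm x.mem y.mem) x

theorem symMap_ι {B C : SteenrodCAlg.{u} p} (f : Hom B C) (x : B.Gen) :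
    (symMap f).toAlgHom (B.symι x) = C.symι (x.map f) :=
  B.symHom_ι C.sym (fun x => C.symι (x.map f)) _ _ _ _ _ x

theorem aqD_zero_toChain (s : A.sym.Gen) :
    A.aqD 0 s.toChain = s.toIndec - (s.map A.counit).unit.toIndec := by
  have h0 : (A.face 1 0).mapIndec s.toChain = s.toIndec := by
    refine ((A.sym.counit).mapIndec_toIndec s.unit).trans (congrArg Gen.toIndec ?_)
    ext
    · rfl
    · exact counit_ι s
  have h1 : (A.face 1 1).mapIndec s.toChain = (s.map A.counit).unit.toIndec := by
    refine ((symMap A.counit).mapIndec_toIndec s.unit).trans (congrArg Gen.toIndec ?_)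
    ext
    · rfl
    · exact symMap_ι A.counit s
  have h2 : ∀ (V : Type u) [AddCommGroup V] [Module (ZMod p) V] (a b : V),
      (-1 : ZMod p) ^ ((0 : Fin 2) : ℕ) • a + (-1 : ZMod p) ^ ((1 : Fin 2) : ℕ) • b = a - b := by
    intro V _ _ a b
    simp [sub_eq_add_neg]
  rw [aqD, Fin.sum_univ_two, LinearMap.add_apply, LinearMap.smul_apply, LinearMap.smul_apply, h0,
    h1]
  exact h2 _ _ _

theorem tensorPow_mem_cycles (x : A.Gen) (m : ℕ) (hm : 1 < m) (hx : x.val ^ m = 0) :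
    (x.tensorPow m (Nat.zero_lt_of_lt hm)).toChain ∈ A.aqCycles 1 := by
  set s := x.tensorPow m (Nat.zero_lt_of_lt hm) with hs
  have h1 : s.toIndec = 0 := by
    refine (Submodule.Quotient.mk_eq_zero _).2 (Submodule.subset_span ?_)
    obtain ⟨k, rfl⟩ : ∃ k, m = k + 1 := ⟨m - 1, by omega⟩
    refine ⟨A.symι x ^ k, ?_, A.symι x, x.unit.mem_augIdeal, (pow_succ _ _).symm⟩
    exact (x.tensorPow k (by omega)).mem_augIdeal
  have h2 : (s.map A.counit).unit.toIndec = 0 := by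
    have h3 : (s.map A.counit).val = 0 := by
      change A.counit.toAlgHom (A.symι x ^ m) = 0
      exact (map_pow A.counit.toAlgHom (A.symι x) m).trans
        ((congrArg (· ^ m) (counit_ι x)).trans hx)
    have h4 := A.symι_eq_zero _ h3
    refine (Submodule.Quotient.mk_eq_zero _).2 ?_
    rw [show (⟨_, (s.map A.counit).unit.mem_augIdeal⟩ : A.sym.augIdeal) = 0 from Subtype.ext h4]
    exact zero_mem _
  have h := aqD_zero_toChain s
  rw [h1, h2, sub_zero] at h
  exact h

/-- The class of `x^{⊗ m}` in `H_1^Q(A)`, for `x` with `x ^ m = 0` and `m ≥ 2`. -/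
noncomputable def tensorPowClass (x : A.Gen) (m : ℕ) (hm : 1 < m) (hx : x.val ^ m = 0) : A.AQ 1 :=
  (A.aqBoundaries 1).mkQ ⟨_, tensorPow_mem_cycles x m hm hx⟩

end AndreQuillen

/-! ### Unstable algebras, Hopf algebras, truncated generators -/

section Hypotheses

variable (A : SteenrodCAlg.{u} p)

/-- Unstable algebras over the Steenrod algebra. -/
structure IsUnstable : Prop where
  isUnstable : A.ops.IsUnstable
  top_two : p = 2 → ∀ n x, x ∈ A.ops.deg n → A.ops.P n x = x ^ 2
  top_odd : p ≠ 2 → ∀ n x, x ∈ A.ops.deg (2 * n) → A.ops.P n x = x ^ p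

/-- Finite generation as an algebra over the Steenrod algebra: some finite set is contained in no
proper subalgebra that is stable under the operations. -/
def FG : Prop :=
  ∃ s : Set A.carrier, s.Finite ∧ ∀ W : Subalgebra (ZMod p) A.carrier,
    s ⊆ W → A.ops.IsStable (Subalgebra.toSubmodule W) → W = ⊤

noncomputable instance : GradedAlgebra A.ops.deg where
  one_mem := A.one_mem_deg
  mul_mem := fun _ _ _ _ => A.mul_mem_deg
  toDecomposition := A.isInternal.chooseDecomposition

/-- Hopf algebra structures on the connected algebra `A`: a map of graded algebras
`Δ : A → A ⊗ A` (the tensor product carries the multiplication with the Koszul sign) with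
`Δ x = x ⊗ 1 + 1 ⊗ x + ∑ x' ⊗ x''`, `deg x', deg x'' > 0`, for `x` of positive degree. (In other
words, `Δ` is counital for the augmentation. Coassociativity is not required, as for the
cohomology of an `H`-space. In the coassociative case an antipode exists by connectedness.) -/
structure HopfStructure where
  Δ : A.carrier →ₐ[ZMod p] (A.ops.deg ᵍ⊗[ZMod p] A.ops.deg)
  Δ_mem : ∀ n x, 0 < n → x ∈ A.ops.deg n →
    Δ x - x ᵍ⊗ₜ[ZMod p] (1 : A.carrier) - (1 : A.carrier) ᵍ⊗ₜ[ZMod p] x ∈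
      Submodule.span (ZMod p) {z | ∃ i j : ℕ, 0 < i ∧ 0 < j ∧ i + j = n ∧
        ∃ a ∈ A.ops.deg i, ∃ b ∈ A.ops.deg j, z = a ᵍ⊗ₜ[ZMod p] b}

/-- Borel decompositions of `A`: families of homogeneous elements `g i` of positive degree that
exhibit `A`, as an algebra, as the tensor product of the monogenic algebras on the `g i`, each of
which is a truncated polynomial algebra `𝔽_p[g i] / (g i ^ (p ^ k))` with `k ≥ 1` or a polynomial
algebra `𝔽_p[g i]` (both with `g i` of even degree if `p` is odd) or, for `p` odd, an exterior
algebra on `g i` of odd degree. -/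
structure BorelSystem where
  idx : Type u
  [linearOrder : LinearOrder idx]
  g : idx → A.Gen
  height : idx → ℕ∞
  height_even : ∀ i, (p = 2 ∨ Even (g i).d) →
    height i = ⊤ ∨ ∃ k : ℕ, 0 < k ∧ height i = ((p ^ k : ℕ) : ℕ∞)
  height_odd : ∀ i, p ≠ 2 → Odd (g i).d → height i = 2
  pow_eq_zero : ∀ i (m : ℕ), height i = m → (g i).val ^ m = 0
  /-- The monomials with exponents below the heights are a basis. -/
  linearIndependent : LinearIndependent (ZMod p)
    (fun e : {e : idx →₀ ℕ // ∀ i, (e i : ℕ∞) < height i} =>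
      ((e.1.support.sort (· ≤ ·)).map fun i => (g i).val ^ e.1 i).prod)
  span_eq_top : Submodule.span (ZMod p) (Set.range
    (fun e : {e : idx →₀ ℕ // ∀ i, (e i : ℕ∞) < height i} =>
      ((e.1.support.sort (· ≤ ·)).map fun i => (g i).val ^ e.1 i).prod)) = ⊤

variable {A}

/-- The indices of the truncated polynomial generators of height `p ^ k`, `k ≥ 1`. -/
def BorelSystem.truncated (b : A.BorelSystem) (k : ℕ) : Set b.idx :=
  {i | 0 < k ∧ b.height i = ((p ^ k : ℕ) : ℕ∞)}

/-- The class of `g i^{⊗ p ^ k}` in `H_1^Q(A)`, for a truncated generator `g i` of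
height `p ^ k`. -/
noncomputable def BorelSystem.powClass [Fact p.Prime] (b : A.BorelSystem) {k : ℕ} {i : b.idx}
    (hi : i ∈ b.truncated k) : A.AQ 1 :=
  tensorPowClass (b.g i) (p ^ k) (Nat.one_lt_pow hi.1.ne' (Fact.out : p.Prime).one_lt)
    (b.pow_eq_zero i (p ^ k) hi.2)

end Hypotheses

end SteenrodCAlg

/-!
The proof has three independent ingredients.

**Chains.** The complex `Q(S(S(A))) → Q(S(A)) → QA → 0` is exact (`range_dOne`). The boundaries of
the elements `[u]`, `[u] * [v]` of `S(S(A))` show that `H_1` is generated by the classes of the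
decomposable `s` in `S(A)` with image zero in `A`, and that products of which one factor has image
zero in `A` do not contribute (`chain_mul_sub_mem_boundaries`). With respect to a Borel
decomposition of `A`, a monomial in the `[g i]` whose image in `A` vanishes is of this form, unless
it is one of the tensor powers `[g i]^(p^k)` of the truncated generators; hence these span `H_1`
(`BorelSystem.span_powCls`). The map `x ↦ [x]^(p^k)`, for even `x` with `x^(p^k) = 0`, is additive
and carries `P^j` to `P^(p^k j)` by the Cartan formula, while all other operations vanish on its
values. As binomial coefficients mod `p` are compatible with this scaling by Lucas' theorem, `H_1`
inherits the Adem relations from `A` (`BorelSystem.aqOne_isUnstable`).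

**Noetherianity.** A finitely generated unstable module is Noetherian, even over the `P^i` alone
(`IsUnstable.isNoetherian`). For a cyclic module one divides by the values of the top operations,
which desuspends it, until it is finite; conversely, the top operation `P^k` on the degrees `2k`
(`k` if `p = 2`) is semilinear along `P^j ↦ P^(pj)`, and an argument as in the Hilbert basis theorem
with this operation in the role of the variable (`isNoetherian_of_frobenius`) lifts Noetherianity
from the quotient. Applied to `QA`, this bounds the heights of the truncated generators, because the
classes of the elements with `x^(p^k) = 0` form an ascending chain of submodules, and it gives a
finite set `J` such that, for each `k`, the elements of height `p^k` in `J` generate the same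
submodule of `QA` as all generators of height `p^k`. That the tensor powers of the elements of `J`
generate `H_1` follows by induction on the degree: a truncated generator of height `p^k` is obtained
from those in `J` by the `P^i` up to a decomposable element, whose `p^k`-th tensor power is a
combination of tensor powers of generators of smaller degree (`BorelSystem.span_powCls_eq_top`).

**Borel's theorem.** That `H_1` is finitely generated and unstable is a statement without a Borel
decomposition, so the existence of one is needed (`exists_borelSystem`). Generators are homogeneous
representatives of a basis of `QA` that is adapted to the filtration by the classes of the elements
with `x^(p^k) = 0`, each representative being chosen with the least possible height. To see that the
monomials below the heights are independent, write a relation as `z^q = 0` with the largest possible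
power `q` of `p`. A functional `f` on `QA` gives a derivation `D = (1 ⊗ f) ∘ Δ` of `A`;
coassociativity plays no role. If `f` is the coordinate of a generator of maximal degree among those
whose exponents in `z` are not all divisible by `p`, then `f` vanishes on all elements with `q`-th
power zero and hence `(D z)^q = 0` (`HopfStructure.deriv_pow_eq_zero`), which is a nontrivial
relation in a smaller degree.
-/

/-! ### Graded vector spaces -/

section Graded

variable {K : Type*} {V : Type*} [CommRing K] [AddCommGroup V] [Module K V]
  {deg : ℕ → Submodule K V}

/-- The projection of a graded module onto its part of degree `n`, as an endomorphism. -/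
noncomputable def degProj (h : DirectSum.IsInternal deg) (n : ℕ) : V →ₗ[K] V :=
  (deg n).subtype ∘ₗ DirectSum.component K ℕ (fun i => deg i) n ∘ₗ
    (LinearEquiv.ofBijective (DirectSum.coeLinearMap deg) h).symm.toLinearMap

variable (h : DirectSum.IsInternal deg)

theorem degProj_mem (n : ℕ) (x : V) : degProj h n x ∈ deg n :=
  Submodule.coe_mem _

theorem ofBijective_symm_of_mem {n : ℕ} {x : V} (hx : x ∈ deg n) :
    (LinearEquiv.ofBijective (DirectSum.coeLinearMap deg) h).symm x =
      DirectSum.lof K ℕ (fun i => deg i) n ⟨x, hx⟩ := by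
  rw [LinearEquiv.symm_apply_eq]
  exact (DirectSum.coeLinearMap_lof deg n ⟨x, hx⟩).symm

theorem degProj_of_mem {n : ℕ} {x : V} (hx : x ∈ deg n) : degProj h n x = x := by
  simp [degProj, ofBijective_symm_of_mem h hx, DirectSum.component.lof_self]

theorem degProj_of_mem_ne {m n : ℕ} (hmn : m ≠ n) {x : V} (hx : x ∈ deg m) :
    degProj h n x = 0 := by
  simp [degProj, ofBijective_symm_of_mem h hx, DirectSum.component.of, hmn]

theorem degProj_of_mem_ite {m n : ℕ} {x : V} (hx : x ∈ deg m) :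
    degProj h n x = if m = n then x else 0 := by
  split_ifs with hmn
  · subst hmn; exact degProj_of_mem h hx
  · exact degProj_of_mem_ne h hmn hx

/-- An induction principle: additive statements need only be checked on homogeneous elements. -/
theorem homogeneous_induction (h : DirectSum.IsInternal deg) {motive : V → Prop} (zero : motive 0)
    (add : ∀ x y, motive x → motive y → motive (x + y))
    (mem : ∀ n x, x ∈ deg n → motive x) (x : V) : motive x := by
  have hx : x ∈ ⨆ n, deg n := by rw [h.submodule_iSup_eq_top]; trivial
  induction hx using Submodule.iSup_induction' with
  | mem n x hx => exact mem n x hx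
  | zero => exact zero
  | add x y _ _ h1 h2 => exact add x y h1 h2

theorem exists_sum_degProj (x : V) :
    ∃ s : Finset ℕ, ∀ t, s ⊆ t → ∑ n ∈ t, degProj h n x = x := by
  classical
  induction x using homogeneous_induction h with
  | zero => exact ⟨∅, by simp⟩
  | add x y h1 h2 =>
    obtain ⟨s, hs⟩ := h1
    obtain ⟨t, ht⟩ := h2
    refine ⟨s ∪ t, fun w hw => ?_⟩
    simp only [map_add, Finset.sum_add_distrib]
    rw [hs w (Finset.union_subset_left hw), ht w (Finset.union_subset_right hw)]
  | mem n x hx =>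
    refine ⟨{n}, fun t ht => ?_⟩
    rw [Finset.sum_eq_single n]
    · exact degProj_of_mem h hx
    · intro m _ hm; exact degProj_of_mem_ne h hm.symm hx
    · intro hn; exact absurd (ht (Finset.mem_singleton_self n)) hn

theorem eq_zero_of_degProj {x : V} (hx : ∀ n, degProj h n x = 0) : x = 0 := by
  obtain ⟨s, hs⟩ := exists_sum_degProj h x
  rw [← hs s subset_rfl]
  exact Finset.sum_eq_zero fun n _ => hx n

theorem mem_of_degProj_mem {W : Submodule K V} {x : V} (hx : ∀ n, degProj h n x ∈ W) : x ∈ W := by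
  obtain ⟨s, hs⟩ := exists_sum_degProj h x
  rw [← hs s subset_rfl]
  exact sum_mem fun n _ => hx n

/-- Graded pieces that admit projections and span form a grading. -/
theorem isInternal_of_proj (π : ℕ → V →ₗ[K] V) (h1 : ∀ n, ∀ x ∈ deg n, π n x = x)
    (h2 : ∀ m n, m ≠ n → ∀ x ∈ deg m, π n x = 0) (h3 : ∀ x : V, x ∈ ⨆ n, deg n) :
    DirectSum.IsInternal deg := by
  classical
  rw [DirectSum.isInternal_submodule_iff_iSupIndep_and_iSup_eq_top]
  refine ⟨?_, eq_top_iff.2 fun x _ => h3 x⟩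
  rw [iSupIndep_def]
  intro n
  rw [Submodule.disjoint_def]
  intro x hx hx'
  have h4 : (⨆ j, ⨆ (_ : j ≠ n), deg j) ≤ LinearMap.ker (π n) :=
    iSup₂_le fun j hj y hy => h2 j n hj y hy
  rw [← h1 n x hx]
  exact h4 hx'

/-- The linear map that is given by `φ n` on the part of degree `n`. -/
noncomputable def degLift {V' : Type*} [AddCommGroup V'] [Module K V']
    (h : DirectSum.IsInternal deg) (φ : ∀ n, deg n →ₗ[K] V') : V →ₗ[K] V' :=
  DirectSum.toModule K ℕ V' φ ∘ₗ
    (LinearEquiv.ofBijective (DirectSum.coeLinearMap deg) h).symm.toLinearMap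

theorem degLift_of_mem {V' : Type*} [AddCommGroup V'] [Module K V'] (φ : ∀ n, deg n →ₗ[K] V')
    {n : ℕ} {x : V} (hx : x ∈ deg n) : degLift h φ x = φ n ⟨x, hx⟩ := by
  simp [degLift, ofBijective_symm_of_mem h hx, DirectSum.toModule_lof]

/-- A subspace is homogeneous if it contains the homogeneous components of its elements. -/
def IsHomogeneousSub (W : Submodule K V) : Prop := ∀ n, ∀ x ∈ W, degProj h n x ∈ W

theorem isHomogeneousSub_span {s : Set V} (hs : ∀ x ∈ s, ∃ n, x ∈ deg n) :
    IsHomogeneousSub h (Submodule.span K s) := by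
  intro n x hx
  induction hx using Submodule.span_induction with
  | mem x hx =>
    obtain ⟨m, hm⟩ := hs x hx
    rw [degProj_of_mem_ite h hm]
    split_ifs
    · exact Submodule.subset_span hx
    · exact zero_mem _
  | zero => rw [map_zero]; exact zero_mem _
  | add x y _ _ h1 h2 => rw [map_add]; exact add_mem h1 h2
  | smul c x _ h => rw [map_smul]; exact Submodule.smul_mem _ c h

theorem isInternal_sub {W : Submodule K V} (hW : IsHomogeneousSub h W) :
    DirectSum.IsInternal fun n => (deg n).comap W.subtype := by
  refine isInternal_of_proj (fun n => (degProj h n).restrict (hW n))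
    (fun n x hx => Subtype.ext (degProj_of_mem h hx))
    (fun m n hmn x hx => Subtype.ext (degProj_of_mem_ne h hmn hx)) fun x => ?_
  obtain ⟨s, hs⟩ := exists_sum_degProj h (x : V)
  have : x = ∑ n ∈ s, (degProj h n).restrict (hW n) x := by
    apply Subtype.ext
    rw [AddSubmonoidClass.coe_finsetSum]
    exact (hs s subset_rfl).symm
  rw [this]
  exact sum_mem fun n _ => Submodule.mem_iSup_of_mem n (degProj_mem h n x)

theorem degProj_sub {W : Submodule K V} (hW : IsHomogeneousSub h W) (n : ℕ) (x : W) :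
    (degProj (isInternal_sub h hW) n x : V) = degProj h n x := by
  induction x using homogeneous_induction (isInternal_sub h hW) with
  | zero => simp
  | add x y h1 h2 => simp [h1, h2]
  | mem m x hx =>
    rw [degProj_of_mem_ite (isInternal_sub h hW) (m := m) (x := x) hx,
      degProj_of_mem_ite h (show (x : V) ∈ deg m from hx)]
    split_ifs <;> rfl

theorem isInternal_quot {W : Submodule K V} (hW : IsHomogeneousSub h W) :
    DirectSum.IsInternal fun n => (deg n).map W.mkQ := by
  refine isInternal_of_proj (fun n => W.mapQ W (degProj h n) (hW n)) ?_ ?_ fun x => ?_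
  · rintro n _ ⟨x, hx, rfl⟩
    exact congrArg W.mkQ (degProj_of_mem h hx)
  · rintro m n hmn _ ⟨x, hx, rfl⟩
    exact (congrArg W.mkQ (degProj_of_mem_ne h hmn hx)).trans (map_zero _)
  · obtain ⟨x, rfl⟩ := W.mkQ_surjective x
    obtain ⟨s, hs⟩ := exists_sum_degProj h x
    rw [← hs s subset_rfl, map_sum]
    exact sum_mem fun n _ => Submodule.mem_iSup_of_mem n ⟨_, degProj_mem h n x, rfl⟩

theorem degProj_quot {W : Submodule K V} (hW : IsHomogeneousSub h W) (n : ℕ) (x : V) :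
    degProj (isInternal_quot h hW) n (W.mkQ x) = W.mkQ (degProj h n x) := by
  induction x using homogeneous_induction h with
  | zero => simp only [map_zero]
  | add x y h1 h2 => simp only [map_add, h1, h2]
  | mem m x hx =>
    rw [degProj_of_mem_ite _ (Submodule.mem_map_of_mem hx), degProj_of_mem_ite h hx]
    split_ifs
    · rfl
    · rw [map_zero]

/-- A map that shifts degrees by a function of the degree commutes with projections. -/
theorem degProj_map {V' : Type*} [AddCommGroup V'] [Module K V'] {deg' : ℕ → Submodule K V'}
    (h' : DirectSum.IsInternal deg') (f : V →ₗ[K] V') (σ : ℕ → ℕ) (hσ : Function.Injective σ)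
    (hf : ∀ n, ∀ x ∈ deg n, f x ∈ deg' (σ n)) (n : ℕ) (x : V) :
    degProj h' (σ n) (f x) = f (degProj h n x) := by
  induction x using homogeneous_induction h with
  | zero => simp only [map_zero]
  | add x y h1 h2 => simp only [map_add, h1, h2]
  | mem m x hx =>
    rw [degProj_of_mem_ite h hx, degProj_of_mem_ite h' (hf m x hx)]
    simp only [hσ.eq_iff]
    split_ifs <;> simp

theorem degProj_map_of_notMem (h : DirectSum.IsInternal deg) {V' : Type*} [AddCommGroup V']
    [Module K V'] {deg' : ℕ → Submodule K V'}
    (h' : DirectSum.IsInternal deg') (f : V →ₗ[K] V') (σ : ℕ → ℕ)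
    (hf : ∀ n, ∀ x ∈ deg n, f x ∈ deg' (σ n)) (n : ℕ) (hn : ∀ m, σ m ≠ n) (x : V) :
    degProj h' n (f x) = 0 := by
  induction x using homogeneous_induction h with
  | zero => simp only [map_zero]
  | add x y h1 h2 => simp only [map_add, h1, h2, add_zero]
  | mem m x hx => exact degProj_of_mem_ne h' (hn m) (hf m x hx)

theorem isHomogeneousSub_range (h : DirectSum.IsInternal deg) {V' : Type*} [AddCommGroup V']
    [Module K V'] {deg' : ℕ → Submodule K V'} (h' : DirectSum.IsInternal deg') (f : V →ₗ[K] V')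
    (hf : ∀ n, ∀ x ∈ deg n, f x ∈ deg' n) : IsHomogeneousSub h' (LinearMap.range f) := by
  rintro n _ ⟨x, rfl⟩
  exact ⟨degProj h n x, (degProj_map h h' f id Function.injective_id hf n x).symm⟩

/-- A homogeneous element in the span of a set of homogeneous elements lies in the span of the
elements of that set that have the same degree. -/
theorem mem_span_of_mem_deg (h : DirectSum.IsInternal deg) {s : Set V}
    (hs : ∀ x ∈ s, ∃ n, x ∈ deg n) {n : ℕ} {x : V}
    (hx : x ∈ Submodule.span K s) (hn : x ∈ deg n) : x ∈ Submodule.span K (s ∩ deg n) := by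
  rw [← degProj_of_mem h hn]
  clear hn
  induction hx using Submodule.span_induction with
  | mem x hx =>
    obtain ⟨m, hm⟩ := hs x hx
    rw [degProj_of_mem_ite h hm]
    split_ifs with h1
    · subst h1; exact Submodule.subset_span ⟨hx, hm⟩
    · exact zero_mem _
  | zero => rw [map_zero]; exact zero_mem _
  | add x y _ _ h1 h2 => rw [map_add]; exact add_mem h1 h2
  | smul c x _ h => rw [map_smul]; exact Submodule.smul_mem _ c h

end Graded

namespace SteenrodData

variable {p : ℕ} {V : Type u} [AddCommGroup V] [Module (ZMod p) V] {D : SteenrodData p V}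

theorem IsStable.sInf {S : Set (Submodule (ZMod p) V)} (h : ∀ W ∈ S, D.IsStable W) :
    D.IsStable (sInf S) :=
  ⟨fun i x hx => (Submodule.mem_sInf).2 fun W hW => (h W hW).1 i x ((Submodule.mem_sInf).1 hx W hW),
    fun x hx => (Submodule.mem_sInf).2 fun W hW => (h W hW).2 x ((Submodule.mem_sInf).1 hx W hW)⟩

variable (D) in
theorem span_stable (s : Set V) : D.IsStable (D.span s) :=
  IsStable.sInf fun _ hW => hW.1

variable (D) in
theorem subset_span (s : Set V) : s ⊆ D.span s :=
  fun _ hx => (Submodule.mem_sInf).2 fun _ hW => hW.2 hx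

theorem span_le {s : Set V} {W : Submodule (ZMod p) V} (hW : D.IsStable W) (h : s ⊆ W) :
    D.span s ≤ W := sInf_le ⟨hW, h⟩

variable (D) in
theorem spanP_stable (s : Set V) : ∀ i, ∀ x ∈ D.spanP s, D.P i x ∈ D.spanP s :=
  fun i _ hx => (Submodule.mem_sInf).2 fun W hW => hW.1 i _ ((Submodule.mem_sInf).1 hx W hW)

variable (D) in
theorem subset_spanP (s : Set V) : s ⊆ D.spanP s :=
  fun _ hx => (Submodule.mem_sInf).2 fun _ hW => hW.2 hx

theorem spanP_le {s : Set V} {W : Submodule (ZMod p) V} (hW : ∀ i, ∀ x ∈ W, D.P i x ∈ W)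
    (h : s ⊆ W) : D.spanP s ≤ W := sInf_le ⟨hW, h⟩

theorem degProj_P (h : DirectSum.IsInternal D.deg)
    (hP : ∀ i n x, x ∈ D.deg n → D.P i x ∈ D.deg (n + degP p i)) (i n : ℕ) (x : V) :
    degProj h (n + degP p i) (D.P i x) = D.P i (degProj h n x) :=
  degProj_map h h (D.P i) (· + degP p i) (add_left_injective _) (hP i) n x

theorem degProj_P_mem (h : DirectSum.IsInternal D.deg)
    (hP : ∀ i n x, x ∈ D.deg n → D.P i x ∈ D.deg (n + degP p i))
    {W : Submodule (ZMod p) V} (hW : ∀ i, ∀ x ∈ W, D.P i x ∈ W) (i : ℕ) {x : V}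
    (hx : ∀ n, degProj h n x ∈ W) (n : ℕ) : degProj h n (D.P i x) ∈ W := by
  by_cases hn : degP p i ≤ n
  · obtain ⟨m, rfl⟩ := Nat.exists_eq_add_of_le' hn
    rw [degProj_P h hP]
    exact hW i _ (hx m)
  · rw [degProj_map_of_notMem h h (D.P i) (· + degP p i) (hP i) n (fun m hm => hn (by omega))]
    exact zero_mem _

theorem degProj_β_mem (h : DirectSum.IsInternal D.deg)
    (hβ : ∀ n x, x ∈ D.deg n → D.β x ∈ D.deg (n + 1))
    {W : Submodule (ZMod p) V} (hW : ∀ x ∈ W, D.β x ∈ W) {x : V}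
    (hx : ∀ n, degProj h n x ∈ W) (n : ℕ) : degProj h n (D.β x) ∈ W := by
  by_cases hn : 1 ≤ n
  · obtain ⟨m, rfl⟩ := Nat.exists_eq_add_of_le' hn
    rw [degProj_map h h D.β (· + 1) (add_left_injective _) hβ]
    exact hW _ (hx m)
  · rw [degProj_map_of_notMem h h D.β (· + 1) hβ n (fun m hm => hn (by omega))]
    exact zero_mem _

theorem isHomogeneousSub_spanP (h : DirectSum.IsInternal D.deg)
    (hP : ∀ i n x, x ∈ D.deg n → D.P i x ∈ D.deg (n + degP p i))
    {s : Set V} (hs : ∀ x ∈ s, ∃ n, x ∈ D.deg n) : IsHomogeneousSub h (D.spanP s) := by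
  have key : D.spanP s ≤ ⨅ n, (D.spanP s).comap (degProj h n) := by
    apply spanP_le
    · intro i x hx
      simp only [Submodule.mem_iInf, Submodule.mem_comap] at hx ⊢
      exact degProj_P_mem h hP (D.spanP_stable s) i hx
    · intro x hx
      simp only [SetLike.mem_coe, Submodule.mem_iInf, Submodule.mem_comap]
      intro n
      obtain ⟨m, hm⟩ := hs x hx
      rw [degProj_of_mem_ite h hm]
      split_ifs
      · exact D.subset_spanP s hx
      · exact zero_mem _
  intro n x hx
  exact (Submodule.mem_iInf _).1 (key hx) n

theorem isHomogeneousSub_aspan (h : DirectSum.IsInternal D.deg)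
    (hP : ∀ i n x, x ∈ D.deg n → D.P i x ∈ D.deg (n + degP p i))
    (hβ : ∀ n x, x ∈ D.deg n → D.β x ∈ D.deg (n + 1))
    {s : Set V} (hs : ∀ x ∈ s, ∃ n, x ∈ D.deg n) : IsHomogeneousSub h (D.span s) := by
  have key : D.span s ≤ ⨅ n, (D.span s).comap (degProj h n) := by
    apply span_le
    · constructor
      · intro i x hx
        simp only [Submodule.mem_iInf, Submodule.mem_comap] at hx ⊢
        exact degProj_P_mem h hP (D.span_stable s).1 i hx
      · intro x hx
        simp only [Submodule.mem_iInf, Submodule.mem_comap] at hx ⊢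
        exact degProj_β_mem h hβ (D.span_stable s).2 hx
    · intro x hx
      simp only [SetLike.mem_coe, Submodule.mem_iInf, Submodule.mem_comap]
      intro n
      obtain ⟨m, hm⟩ := hs x hx
      rw [degProj_of_mem_ite h hm]
      split_ifs
      · exact D.subset_span s hx
      · exact zero_mem _
  intro n x hx
  exact (Submodule.mem_iInf _).1 (key hx) n

/-- The degree of `P 1` divided by `p - 1`: this is `1` if `p = 2`, and `2` if `p` is odd. -/
def eps (p : ℕ) : ℕ := if p = 2 then 1 else 2

theorem degP_eq (p i : ℕ) : degP p i = eps p * (i * (p - 1)) := by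
  unfold degP eps
  split_ifs with hp
  · subst hp; simp
  · ring

theorem eps_two {p : ℕ} (hp : p = 2) : eps p = 1 := if_pos hp
theorem eps_odd {p : ℕ} (hp : p ≠ 2) : eps p = 2 := if_neg hp
theorem eps_pos (p : ℕ) : 0 < eps p := by unfold eps; split_ifs <;> norm_num

/-- Graded vector spaces with operations that become unstable modules over the Steenrod algebra
when all degrees are lowered by `c`. For `c = 0` these are the unstable modules; the `c`-fold
suspension of an unstable module is of this form. -/
structure IsUnstableAbove (D : SteenrodData p V) (c : ℕ) : Prop where
  isInternal : DirectSum.IsInternal D.deg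
  P_mem : ∀ i n x, x ∈ D.deg n → D.P i x ∈ D.deg (n + degP p i)
  β_mem : ∀ n x, x ∈ D.deg n → D.β x ∈ D.deg (n + 1)
  P_zero : ∀ x, D.P 0 x = x
  β_two : p = 2 → ∀ x, D.β x = D.P 1 x
  β_β : ∀ x, D.β (D.β x) = 0
  adem : ∀ a b, a < p * b → ∀ x, D.P a (D.P b x) =
    ∑ j ∈ Finset.range (a / p + 1),
      ((-1 : ZMod p) ^ (a + j) * (((p - 1) * (b - j) - 1).choose (a - p * j) : ℕ)) •
        D.P (a + b - j) (D.P j x)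
  adem_β : p ≠ 2 → ∀ a b, 0 < a → a ≤ p * b → ∀ x, D.P a (D.β (D.P b x)) =
    (∑ j ∈ Finset.range (a / p + 1),
      ((-1 : ZMod p) ^ (a + j) * (((p - 1) * (b - j)).choose (a - p * j) : ℕ)) •
        D.β (D.P (a + b - j) (D.P j x))) +
    ∑ j ∈ Finset.range ((a - 1) / p + 1),
      ((-1 : ZMod p) ^ (a + j - 1) * (((p - 1) * (b - j) - 1).choose (a - p * j - 1) : ℕ)) •
        D.P (a + b - j) (D.β (D.P j x))
  unstable : ∀ n i x, x ∈ D.deg n → n < eps p * i + c → D.P i x = 0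
  unstable_β : p ≠ 2 → ∀ n i x, x ∈ D.deg n → n < 2 * i + 1 + c → D.β (D.P i x) = 0

theorem isUnstableAbove_zero_iff : D.IsUnstableAbove 0 ↔ D.IsUnstable := by
  constructor
  · intro h
    exact ⟨h.1, h.2, h.3, h.4, h.5, h.6, h.7, h.8,
      fun hp n i x hx hn => h.9 n i x hx (by rw [eps_two hp]; omega),
      fun hp n i x hx hn => h.9 n i x hx (by rw [eps_odd hp]; omega),
      fun hp n i x hx hn => h.10 hp n i x hx (by omega)⟩
  · intro h
    refine ⟨h.1, h.2, h.3, h.4, h.5, h.6, h.7, h.8, fun n i x hx hn => ?_,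
      fun hp n i x hx hn => h.unstable_odd_β hp n i x hx (by omega)⟩
    by_cases hp : p = 2
    · rw [eps_two hp] at hn
      exact h.unstable_two hp n i x hx (by omega)
    · rw [eps_odd hp] at hn
      exact h.unstable_odd hp n i x hx (by omega)

theorem IsUnstableAbove.sub {c : ℕ} (h : D.IsUnstableAbove c) {W : Submodule (ZMod p) V}
    (hW : D.IsStable W) (hom : IsHomogeneousSub h.isInternal W) :
    (D.sub W hW).IsUnstableAbove c where
  isInternal := isInternal_sub h.isInternal hom
  P_mem i n x hx := h.P_mem i n x.1 hx
  β_mem n x hx := h.β_mem n x.1 hx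
  P_zero x := Subtype.ext (h.P_zero x)
  β_two hp x := Subtype.ext (h.β_two hp x)
  β_β x := Subtype.ext (h.β_β x)
  adem a b hab x := Subtype.ext <| (h.adem a b hab x.1).trans <| by
    rw [AddSubmonoidClass.coe_finsetSum]; rfl
  adem_β hp a b ha hab x := Subtype.ext <| (h.adem_β hp a b ha hab x.1).trans <| by
    rw [Submodule.coe_add, AddSubmonoidClass.coe_finsetSum, AddSubmonoidClass.coe_finsetSum]; rfl
  unstable n i x hx hn := Subtype.ext (h.unstable n i x.1 hx hn)
  unstable_β hp n i x hx hn := Subtype.ext (h.unstable_β hp n i x.1 hx hn)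

/-- Passing to the quotient by a stable subspace that contains the values of the top operations
improves the instability condition. -/
theorem IsUnstableAbove.quot {c c' : ℕ} (h : D.IsUnstableAbove c) {W : Submodule (ZMod p) V}
    (hW : D.IsStable W) (hom : IsHomogeneousSub h.isInternal W)
    (h1 : ∀ n i x, x ∈ D.deg n → n < eps p * i + c' → D.P i x ∈ W)
    (h2 : p ≠ 2 → ∀ n i x, x ∈ D.deg n → n < 2 * i + 1 + c' → D.β (D.P i x) ∈ W) :
    (D.quot W hW).IsUnstableAbove c' where
  isInternal := isInternal_quot h.isInternal hom
  P_mem := by rintro i n _ ⟨x, hx, rfl⟩; exact ⟨_, h.P_mem i n x hx, rfl⟩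
  β_mem := by rintro n _ ⟨x, hx, rfl⟩; exact ⟨_, h.β_mem n x hx, rfl⟩
  P_zero x := by obtain ⟨x, rfl⟩ := W.mkQ_surjective x; exact congrArg W.mkQ (h.P_zero x)
  β_two hp x := by obtain ⟨x, rfl⟩ := W.mkQ_surjective x; exact congrArg W.mkQ (h.β_two hp x)
  β_β x := by
    obtain ⟨x, rfl⟩ := W.mkQ_surjective x
    exact (congrArg W.mkQ (h.β_β x)).trans (map_zero _)
  adem a b hab x := by
    obtain ⟨x, rfl⟩ := W.mkQ_surjective x
    exact (congrArg W.mkQ (h.adem a b hab x)).trans (by simp only [map_sum, map_smul]; rfl)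
  adem_β hp a b ha hab x := by
    obtain ⟨x, rfl⟩ := W.mkQ_surjective x
    exact (congrArg W.mkQ (h.adem_β hp a b ha hab x)).trans
      (by simp only [map_add, map_sum, map_smul]; rfl)
  unstable := by
    rintro n i _ ⟨x, hx, rfl⟩ hn
    exact (Submodule.Quotient.mk_eq_zero W).2 (h1 n i x hx hn)
  unstable_β := by
    rintro hp n i _ ⟨x, hx, rfl⟩ hn
    exact (Submodule.Quotient.mk_eq_zero W).2 (h2 hp n i x hx hn)

/-- Homogeneous stable subspaces of unstable modules are unstable modules. -/
theorem IsUnstable.sub (h : D.IsUnstable) {W : Submodule (ZMod p) V} (hW : D.IsStable W)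
    (hom : IsHomogeneousSub h.isInternal W) : (D.sub W hW).IsUnstable :=
  isUnstableAbove_zero_iff.1 ((isUnstableAbove_zero_iff.2 h).sub hW hom)

/-- Quotients of unstable modules by homogeneous stable subspaces are unstable modules. -/
theorem IsUnstable.quot (h : D.IsUnstable) {W : Submodule (ZMod p) V} (hW : D.IsStable W)
    (hom : IsHomogeneousSub h.isInternal W) : (D.quot W hW).IsUnstable := by
  have h' := isUnstableAbove_zero_iff.2 h
  refine isUnstableAbove_zero_iff.1 (h'.quot hW hom (fun n i x hx hn => ?_)
    fun hp n i x hx hn => ?_)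
  · rw [h'.unstable n i x hx hn]; exact zero_mem _
  · rw [h'.unstable_β hp n i x hx hn]; exact zero_mem _

end SteenrodData

/-! ### Modules over a set of operators, and a basis theorem for Frobenius-linear maps -/

/-- The vector space `V`, as a module over the free algebra on symbols that act through the family
of endomorphisms `T`. Its submodules are the subspaces that are stable under `T`. -/
def OpMod {K ι V : Type*} [CommRing K] [AddCommGroup V] [Module K V] (_T : ι → V →ₗ[K] V) :
    Type _ := V

namespace OpMod

variable {K ι V V' : Type*} [CommRing K] [AddCommGroup V] [Module K V] [AddCommGroup V']
  [Module K V'] {T : ι → V →ₗ[K] V} {T' : ι → V' →ₗ[K] V'}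

instance : AddCommGroup (OpMod T) := inferInstanceAs (AddCommGroup V)

instance : Module K (OpMod T) := inferInstanceAs (Module K V)

noncomputable instance : Module (FreeAlgebra K ι) (OpMod T) :=
  Module.compHom V (FreeAlgebra.lift K T : FreeAlgebra K ι →ₐ[K] Module.End K V).toRingHom

variable (T) in
/-- The identity map from `V` to `V` with operators. -/
def mk : V ≃ₗ[K] OpMod T := LinearEquiv.refl K V

theorem ι_smul (i : ι) (x : V) : FreeAlgebra.ι K i • mk T x = mk T (T i x) := by
  change (FreeAlgebra.lift K T : FreeAlgebra K ι →ₐ[K] Module.End K V) (FreeAlgebra.ι K i) x = _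
  rw [FreeAlgebra.lift_ι_apply]
  rfl

theorem algebraMap_smul (c : K) (x : OpMod T) : algebraMap K (FreeAlgebra K ι) c • x = c • x := by
  change (FreeAlgebra.lift K T : FreeAlgebra K ι →ₐ[K] Module.End K V) (algebraMap _ _ c) x = _
  rw [AlgHom.commutes]
  rfl

theorem exists_mk (x : OpMod T) : ∃ v, mk T v = x := ⟨x, rfl⟩

/-- Subspaces that are stable under the operators, as submodules. -/
def ofStable (W : Submodule K V) (hW : ∀ i, ∀ x ∈ W, T i x ∈ W) :
    Submodule (FreeAlgebra K ι) (OpMod T) where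
  carrier := {x | (mk T).symm x ∈ W}
  add_mem' := W.add_mem
  zero_mem' := W.zero_mem
  smul_mem' r x hx := by
    induction r using FreeAlgebra.induction generalizing x with
    | grade0 c => rw [algebraMap_smul]; exact W.smul_mem c hx
    | grade1 i =>
      obtain ⟨x, rfl⟩ := exists_mk x
      rw [ι_smul]
      exact hW i x hx
    | mul a b ha hb => rw [mul_smul]; exact ha _ (hb _ hx)
    | add a b ha hb => rw [add_smul]; exact W.add_mem (ha _ hx) (hb _ hx)

/-- Submodules, as subspaces. -/
def toSubspace (M : Submodule (FreeAlgebra K ι) (OpMod T)) : Submodule K V where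
  carrier := {x | mk T x ∈ M}
  add_mem' := M.add_mem
  zero_mem' := M.zero_mem
  smul_mem' c x hx := by
    have := M.smul_mem (algebraMap K _ c) (show mk T x ∈ M from hx)
    rw [algebraMap_smul] at this
    exact this

theorem mem_toSubspace {M : Submodule (FreeAlgebra K ι) (OpMod T)} {x : V} :
    x ∈ toSubspace M ↔ mk T x ∈ M := Iff.rfl

/-- Linear maps that are compatible with the operators along a ring homomorphism are semilinear. -/
def mapₛₗ (σ : FreeAlgebra K ι →+* FreeAlgebra K ι)
    (hσ : ∀ c, σ (algebraMap K _ c) = algebraMap K _ c) (f : V →ₗ[K] V')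
    (hf : ∀ i x, mk T' (f (T i x)) = σ (FreeAlgebra.ι K i) • mk T' (f x)) :
    OpMod T →ₛₗ[σ] OpMod T' where
  toFun x := mk T' (f ((mk T).symm x))
  map_add' x y := by simp only [map_add]
  map_smul' r x := by
    induction r using FreeAlgebra.induction generalizing x with
    | grade0 c => rw [algebraMap_smul, hσ, algebraMap_smul]; simp only [map_smul]
    | grade1 i => obtain ⟨x, rfl⟩ := exists_mk x; rw [ι_smul]; exact hf i x
    | mul a b ha hb => rw [mul_smul, ha, hb, map_mul, mul_smul]
    | add a b ha hb =>
      rw [add_smul, map_add, map_add, map_add, ha, hb, map_add σ, add_smul]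

/-- Linear maps that commute with the operators. -/
def map (f : V →ₗ[K] V') (hf : ∀ i x, f (T i x) = T' i (f x)) :
    OpMod T →ₗ[FreeAlgebra K ι] OpMod T' :=
  mapₛₗ (RingHom.id _) (fun _ => rfl) f
    (fun i x => (congrArg (mk T') (hf i x)).trans (ι_smul (T := T') i (f x)).symm)

end OpMod

/-- If the elements of a submodule `N` are values of a semilinear map on a Noetherian module, then
`N` is Noetherian. -/
theorem isNoetherian_of_semilinear {R M M' : Type*} [Ring R] [AddCommGroup M] [Module R M]
    [AddCommGroup M'] [Module R M'] [IsNoetherian R M] (σ : R →+* R) (f : M →ₛₗ[σ] M')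
    (N : Submodule R M') (hN : ∀ y ∈ N, ∃ x, f x = y) : IsNoetherian R N := by
  rw [isNoetherian_iff']
  have : StrictMono fun W : Submodule R N => (W.map N.subtype).comap f := by
    refine Monotone.strictMono_of_injective
      (fun W₁ W₂ h => Submodule.comap_mono (Submodule.map_mono h)) fun W₁ W₂ h => ?_
    have key : ∀ W₁ W₂ : Submodule R N,
        (W₁.map N.subtype).comap f = (W₂.map N.subtype).comap f → W₁ ≤ W₂ := by
      intro W₁ W₂ h y hy
      obtain ⟨x, hx⟩ := hN y y.2
      have h1 : x ∈ (W₁.map N.subtype).comap f := by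
        rw [Submodule.mem_comap, hx]; exact ⟨y, hy, rfl⟩
      rw [h, Submodule.mem_comap, hx] at h1
      obtain ⟨z, hz, hzy⟩ := h1
      rwa [Subtype.ext hzy] at hz
    exact le_antisymm (key _ _ h) (key _ _ h.symm)
  exact this.wellFoundedGT

section Frobenius

variable {R M Q : Type*} [Ring R] [AddCommGroup M] [Module R M] [AddCommGroup Q] [Module R Q]
  {σ : R →+* R}

theorem iterate_add_semilinear (lam : M →ₛₗ[σ] M) (k : ℕ) (x y : M) :
    lam^[k] (x + y) = lam^[k] x + lam^[k] y := by
  induction k generalizing x y with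
  | zero => rfl
  | succ k ih => rw [Function.iterate_succ_apply, map_add, ih]; rfl

/-- The elements that a `k`-fold iterate maps into a given submodule. -/
def comapIterate (lam : M →ₛₗ[σ] M) (N : Submodule R M) : ℕ → Submodule R M
  | 0 => N
  | k + 1 => (comapIterate lam N k).comap lam

theorem mem_comapIterate (lam : M →ₛₗ[σ] M) (N : Submodule R M) (k : ℕ) (x : M) :
    x ∈ comapIterate lam N k ↔ lam^[k] x ∈ N := by
  induction k generalizing x with
  | zero => rfl
  | succ k ih =>
    rw [Function.iterate_succ_apply, ← ih]
    rfl

/-- A variant of the Hilbert basis theorem in which a Frobenius-semilinear endomorphism `lam` plays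
the role of the polynomial variable: to a submodule `N` one attaches the ascending chain of the
images of `{x | lam^k x ∈ N}` in the Noetherian module `Q`, and this chain determines `N`. -/
theorem isNoetherian_of_frobenius (lam : M →ₛₗ[σ] M) (g : M →ₗ[R] Q) [IsNoetherian R Q]
    (hg : ∀ x, g x = 0 → ∃ y, lam y = x) (hlam : ∀ x, ∃ r : R, r • x = lam x)
    (hT : ∀ x : M, ∃ (r : R) (k : ℕ), r • x = x ∧ ∀ v, r • lam^[k] v = 0) : IsNoetherian R M := by
  set C : Submodule R M → ℕ → Submodule R Q := fun N k => (comapIterate lam N k).map g with hC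
  have hCmono : ∀ N N' : Submodule R M, N ≤ N' → ∀ k, C N k ≤ C N' k := by
    intro N N' h k
    refine Submodule.map_mono fun x hx => ?_
    rw [mem_comapIterate] at hx ⊢
    exact h hx
  have hCsucc : ∀ (N : Submodule R M) (k : ℕ), C N k ≤ C N (k + 1) := by
    intro N k
    refine Submodule.map_mono fun x hx => ?_
    rw [mem_comapIterate] at hx ⊢
    rw [Function.iterate_succ_apply']
    obtain ⟨r, hr⟩ := hlam (lam^[k] x)
    rw [← hr]
    exact N.smul_mem r hx
  have hCle : ∀ N : Submodule R M, Monotone (C N) := fun N => monotone_nat_of_le_succ (hCsucc N)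
  have main : ∀ N N' : Submodule R M, N ≤ N' → (∀ k, C N' k ≤ C N k) → N' ≤ N := by
    intro N N' hN h x hx
    have key : ∀ k, ∃ m ∈ N, ∃ y, lam^[k] y ∈ N' ∧ x = m + lam^[k] y := by
      intro k
      induction k with
      | zero => exact ⟨0, zero_mem _, x, hx, (zero_add x).symm⟩
      | succ k ih =>
        obtain ⟨m, hm, y, hy, rfl⟩ := ih
        have h1 : g y ∈ C N k := h k ⟨y, (mem_comapIterate lam N' k y).2 hy, rfl⟩
        obtain ⟨y₁, hy₁, hgy⟩ := h1
        have hy₁ : lam^[k] y₁ ∈ N := (mem_comapIterate lam N k y₁).1 hy₁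
        obtain ⟨y₂, hy₂⟩ := hg (y - y₁) (by rw [map_sub, hgy, sub_self])
        have h2 : lam^[k] y = lam^[k] y₁ + lam^[k + 1] y₂ := by
          rw [Function.iterate_succ_apply, ← iterate_add_semilinear, hy₂, add_sub_cancel]
        refine ⟨m + lam^[k] y₁, add_mem hm hy₁, y₂, ?_, by rw [h2, add_assoc]⟩
        rw [h2] at hy
        exact (Submodule.add_mem_iff_right _ (hN hy₁)).1 hy
    obtain ⟨r, k, hr, hr0⟩ := hT x
    obtain ⟨m, hm, y, -, hxy⟩ := key k
    rw [← hr, hxy, smul_add, hr0, add_zero]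
    exact N.smul_mem r hm
  rw [← monotone_stabilizes_iff_noetherian]
  intro f
  have stab : ∀ g : ℕ →o Submodule R Q, ∃ n, ∀ m, n ≤ m → g n = g m :=
    monotone_stabilizes_iff_noetherian.2 inferInstance
  obtain ⟨n, hn⟩ := stab ⟨fun i => C (f i) i, fun i j hij =>
    (hCmono _ _ (f.monotone hij) i).trans (hCle _ hij)⟩
  have hn : ∀ m, n ≤ m → C (f n) n = C (f m) m := hn
  choose N hN using fun k => stab ⟨fun i => C (f i) k, fun i j hij => hCmono _ _ (f.monotone hij) k⟩
  have hN : ∀ k m, N k ≤ m → C (f (N k)) k = C (f m) k := hN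
  refine ⟨max n ((Finset.range n).sup N), fun m hm => ?_⟩
  refine le_antisymm (f.monotone hm) (main _ _ (f.monotone hm) fun k => ?_)
  by_cases hk : k < n
  · have h1 : N k ≤ max n ((Finset.range n).sup N) :=
      le_max_of_le_right (Finset.le_sup (Finset.mem_range.2 hk))
    rw [← hN k _ h1, ← hN k m (h1.trans hm)]
  · push Not at hk
    have h1 : n ≤ m := (le_max_left _ _).trans hm
    calc C (f m) k ≤ C (f (max m k)) (max m k) :=
          (hCmono _ _ (f.monotone (le_max_left _ _)) k).trans (hCle _ (le_max_right _ _))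
      _ = C (f n) n := (hn _ (h1.trans (le_max_left _ _))).symm
      _ ≤ C (f n) k := hCle _ hk
      _ ≤ _ := hCmono _ _ (f.monotone (le_max_left _ _)) k

end Frobenius

/-! ### Unstable modules are locally Noetherian over the reduced powers -/

theorem neg_one_pow_mul_add_self (p a : ℕ) [Fact p.Prime] : (-1 : ZMod p) ^ (p * a + a) = 1 := by
  rcases (Fact.out : p.Prime).eq_two_or_odd' with rfl | hp
  · rw [show (-1 : ZMod 2) = 1 from rfl, one_pow]
  · rw [← Nat.succ_mul]
    exact (hp.add_one.mul_right a).neg_one_pow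

theorem mul_pred_add_self (p j : ℕ) [hp : Fact p.Prime] : j * (p - 1) + j = p * j := by
  obtain ⟨r, hr⟩ := Nat.exists_eq_add_of_lt hp.out.pos
  subst hr
  simp
  ring

namespace SteenrodData

variable {p : ℕ} {V : Type u} [AddCommGroup V] [Module (ZMod p) V]
  {D : SteenrodData p V} {c : ℕ}

/-- The operators that define the homogeneous subspaces that are stable under the operations `P i`:
these operations, and the projections onto the parts of a given degree. -/
noncomputable def opsAndProj (D : SteenrodData p V) (h : DirectSum.IsInternal D.deg) :
    ℕ ⊕ ℕ → V →ₗ[ZMod p] V := Sum.elim D.P (degProj h)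

namespace IsUnstableAbove

theorem eq_zero_of_lt (h : D.IsUnstableAbove c) {n : ℕ} {x : V} (hx : x ∈ D.deg n) (hn : n < c) :
    x = 0 := by
  rw [← h.P_zero x]; exact h.unstable n 0 x hx (by simpa)

theorem deg_cases (h : D.IsUnstableAbove c) {m : ℕ} {x : V} (hx : x ∈ D.deg m) :
    x = 0 ∨ (∃ k, m = c + eps p * k) ∨ (p ≠ 2 ∧ ∃ k, m = c + 2 * k + 1) := by
  by_cases hm : m < c
  · exact Or.inl (h.eq_zero_of_lt hx hm)
  · right
    by_cases hp2 : p = 2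
    · exact Or.inl ⟨m - c, by rw [eps_two hp2]; omega⟩
    · rw [eps_odd hp2]
      rcases Nat.even_or_odd' (m - c) with ⟨k, hk | hk⟩
      · exact Or.inl ⟨k, by omega⟩
      · exact Or.inr ⟨hp2, k, by omega⟩

theorem P_mem_top (h : D.IsUnstableAbove c) {k : ℕ} {x : V} (hx : x ∈ D.deg (c + eps p * k))
    (a : ℕ) : D.P a x ∈ D.deg (c + eps p * (k + a * (p - 1))) := by
  have := h.P_mem a _ x hx
  rwa [degP_eq, add_assoc, ← mul_add] at this

theorem P_mem_odd (h : D.IsUnstableAbove c) (hp2 : p ≠ 2) {k : ℕ} {x : V}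
    (hx : x ∈ D.deg (c + 2 * k + 1)) (a : ℕ) :
    D.P a x ∈ D.deg (c + 2 * (k + a * (p - 1)) + 1) := by
  have := h.P_mem a _ x hx
  rw [degP_eq, eps_odd hp2] at this
  convert this using 2
  ring

theorem βP_mem_odd (h : D.IsUnstableAbove c) (hp2 : p ≠ 2) {k : ℕ} {x : V}
    (hx : x ∈ D.deg (c + 2 * k + 1)) (a : ℕ) :
    D.β (D.P a x) ∈ D.deg (c + eps p * (k + 1 + a * (p - 1))) := by
  rw [eps_odd hp2]
  have := h.β_mem _ _ (h.P_mem_odd hp2 hx a)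
  convert this using 2
  ring

theorem P_P_eq_zero (h : D.IsUnstableAbove c) {k : ℕ} {x : V} (hx : x ∈ D.deg (c + eps p * k))
    {i j : ℕ} (hij : k + j * (p - 1) < i) : D.P i (D.P j x) = 0 := by
  refine h.unstable _ i _ (h.P_mem_top hx j) ?_
  have := Nat.mul_lt_mul_of_pos_left hij (eps_pos p)
  omega

theorem β_P_P_eq_zero (h : D.IsUnstableAbove c) (hp2 : p ≠ 2) {k : ℕ} {x : V}
    (hx : x ∈ D.deg (c + 2 * k + 1)) {i j : ℕ} (hij : k + j * (p - 1) < i) :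
    D.β (D.P i (D.P j x)) = 0 :=
  h.unstable_β hp2 _ i _ (h.P_mem_odd hp2 hx j) (by omega)

theorem P_β_P_eq_zero (h : D.IsUnstableAbove c) (hp2 : p ≠ 2) {k : ℕ} {x : V}
    (hx : x ∈ D.deg (c + 2 * k + 1)) {i j : ℕ} (hij : k + 1 + j * (p - 1) < i) :
    D.P i (D.β (D.P j x)) = 0 := by
  refine h.unstable _ i _ (h.βP_mem_odd hp2 hx j) ?_
  have := Nat.mul_lt_mul_of_pos_left hij (eps_pos p)
  omega

/-- The degrees that differ from `c` by a multiple of the degree of `P 1` divided by `p - 1`. -/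
def IsTopDeg (p c m : ℕ) : Prop := ∃ k, m = c + eps p * k

theorem not_isTopDeg_odd (hp2 : p ≠ 2) {k : ℕ} : ¬ IsTopDeg p c (c + 2 * k + 1) := by
  rintro ⟨j, hj⟩
  rw [eps_odd hp2] at hj
  omega

variable [hp : Fact p.Prime]

/-- By the Adem relations, the top operation `x ↦ P k x` is Frobenius-linear. -/
theorem P_mul_P_top (h : D.IsUnstableAbove c) {k : ℕ} {x : V} (hx : x ∈ D.deg (c + eps p * k))
    (a : ℕ) : D.P (p * a) (D.P k x) = D.P (k + a * (p - 1)) (D.P a x) := by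
  have hpp := hp.out.pos
  rcases lt_trichotomy a k with hak | rfl | hak
  · rw [h.adem _ _ (Nat.mul_lt_mul_of_pos_left hak hpp), Nat.mul_div_cancel_left _ hpp,
      Finset.sum_range_succ, Finset.sum_eq_zero, zero_add, neg_one_pow_mul_add_self, Nat.sub_self,
      Nat.choose_zero_right, Nat.cast_one, mul_one, one_smul]
    · congr 2
      have := mul_pred_add_self p a
      omega
    · intro j hj
      have h1 := Nat.mul_lt_mul_of_pos_left (Finset.mem_range.1 hj) hpp
      have h2 := mul_pred_add_self p j
      rw [h.P_P_eq_zero hx, smul_zero]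
      omega
  · rw [← mul_pred_add_self, add_comm]
  · have h1 := Nat.mul_lt_mul_of_pos_left hak hpp
    have h2 := mul_pred_add_self p k
    have h3 : D.P a x = 0 := h.unstable _ a x hx (by
      have := Nat.mul_lt_mul_of_pos_left hak (eps_pos p); omega)
    rw [h3, map_zero, h.P_P_eq_zero hx]
    omega

theorem P_P_top_of_not_dvd (h : D.IsUnstableAbove c) {k : ℕ} {x : V}
    (hx : x ∈ D.deg (c + eps p * k)) {a : ℕ} (ha : ¬ p ∣ a) : D.P a (D.P k x) = 0 := by
  by_cases hak : a < p * k
  · rw [h.adem _ _ hak]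
    refine Finset.sum_eq_zero fun j hj => ?_
    have h1 : j ≤ a / p := Nat.lt_succ_iff.1 (Finset.mem_range.1 hj)
    have h1 : p * j ≤ a := (Nat.mul_le_mul_left p h1).trans (Nat.mul_div_le a p)
    have h3 : p * j ≠ a := fun h3 => ha ⟨j, h3.symm⟩
    have h2 := mul_pred_add_self p j
    rw [h.P_P_eq_zero hx, smul_zero]
    omega
  · have h3 : p * k ≠ a := fun h3 => ha ⟨k, h3.symm⟩
    have h2 := mul_pred_add_self p k
    exact h.P_P_eq_zero hx (by omega)

/-- The Adem relation for the top operation `x ↦ β (P k x)` in the degrees of the other parity. -/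
theorem P_mul_β_P_top (h : D.IsUnstableAbove c) (hp2 : p ≠ 2) {k : ℕ} {x : V}
    (hx : x ∈ D.deg (c + 2 * k + 1)) (a : ℕ) :
    D.P (p * a) (D.β (D.P k x)) = D.β (D.P (k + a * (p - 1)) (D.P a x)) := by
  have hpp := hp.out.pos
  have hp1 := hp.out.one_lt
  rcases Nat.eq_zero_or_pos a with rfl | ha
  · simp [h.P_zero]
  by_cases hak : a ≤ k
  · have hpa : 0 < p * a := Nat.mul_pos hpp ha
    rw [h.adem_β hp2 _ _ hpa (Nat.mul_le_mul_left p hak), Nat.mul_div_cancel_left _ hpp,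
      Finset.sum_range_succ, Finset.sum_eq_zero, zero_add, neg_one_pow_mul_add_self, Nat.sub_self,
      Nat.choose_zero_right, Nat.cast_one, mul_one, one_smul, Finset.sum_eq_zero, add_zero]
    · congr 3
      have := mul_pred_add_self p a
      omega
    · intro j hj
      have h1 : j ≤ (p * a - 1) / p := Nat.lt_succ_iff.1 (Finset.mem_range.1 hj)
      have h1 : p * j ≤ p * a - 1 := (Nat.mul_le_mul_left p h1).trans (Nat.mul_div_le _ p)
      have h4 : j < a := Nat.lt_of_mul_lt_mul_left (a := p) (by omega)
      have h5 : p * (j + 1) ≤ p * a := Nat.mul_le_mul_left p h4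
      rw [Nat.mul_succ] at h5
      have h2 := mul_pred_add_self p j
      rw [h.P_β_P_eq_zero hp2 hx, smul_zero]
      omega
    · intro j hj
      have h1 := Nat.mul_lt_mul_of_pos_left (Finset.mem_range.1 hj) hpp
      have h2 := mul_pred_add_self p j
      rw [h.β_P_P_eq_zero hp2 hx, smul_zero]
      omega
  · have h5 : p * (k + 1) ≤ p * a := Nat.mul_le_mul_left p (by omega)
    rw [Nat.mul_succ] at h5
    have h2 := mul_pred_add_self p k
    have h3 : D.P a x = 0 := h.unstable _ a x hx (by rw [eps_odd hp2]; omega)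
    rw [h3, map_zero, map_zero, h.P_β_P_eq_zero hp2 hx]
    omega

theorem P_mul_add_one_β_P_top (h : D.IsUnstableAbove c) (hp2 : p ≠ 2) {k : ℕ} {x : V}
    (hx : x ∈ D.deg (c + 2 * k + 1)) (a : ℕ) :
    D.P (p * a + 1) (D.β (D.P k x)) = D.P (k + 1 + a * (p - 1)) (D.β (D.P a x)) := by
  have hpp := hp.out.pos
  have hp1 := hp.out.one_lt
  rcases lt_trichotomy a k with hak | rfl | hak
  · have h5 : p * (a + 1) ≤ p * k := Nat.mul_le_mul_left p hak
    rw [Nat.mul_succ] at h5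
    rw [h.adem_β hp2 (p * a + 1) k (by omega) (by omega)]
    have e1 : (p * a + 1) / p = a := by
      rw [Nat.mul_add_div hpp, Nat.div_eq_of_lt hp1, add_zero]
    rw [e1, Nat.add_sub_cancel, Nat.mul_div_cancel_left _ hpp, Finset.sum_eq_zero, zero_add,
      Finset.sum_range_succ, Finset.sum_eq_zero, zero_add]
    · rw [show p * a + 1 + a - 1 = p * a + a by omega, neg_one_pow_mul_add_self,
        show p * a + 1 - p * a - 1 = 0 by omega, Nat.choose_zero_right, Nat.cast_one, mul_one,
        one_smul]
      congr 2
      have := mul_pred_add_self p a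
      omega
    · intro j hj
      have h1 := Nat.mul_lt_mul_of_pos_left (Finset.mem_range.1 hj) hpp
      have h2 := mul_pred_add_self p j
      rw [h.P_β_P_eq_zero hp2 hx, smul_zero]
      omega
    · intro j hj
      have h1 : p * j ≤ p * a := Nat.mul_le_mul_left p (Nat.lt_succ_iff.1 (Finset.mem_range.1 hj))
      have h2 := mul_pred_add_self p j
      rw [h.β_P_P_eq_zero hp2 hx, smul_zero]
      omega
  · rw [← mul_pred_add_self]
    congr 2
    ring
  · have h5 : p * (k + 1) ≤ p * a := Nat.mul_le_mul_left p hak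
    rw [Nat.mul_succ] at h5
    have h2 := mul_pred_add_self p k
    have h3 : D.P a x = 0 := h.unstable _ a x hx (by rw [eps_odd hp2]; omega)
    rw [h3, map_zero, map_zero, h.P_β_P_eq_zero hp2 hx]
    omega

theorem P_β_P_top_eq_zero (h : D.IsUnstableAbove c) (hp2 : p ≠ 2) {k : ℕ} {x : V}
    (hx : x ∈ D.deg (c + 2 * k + 1)) {a : ℕ} (h0 : ∀ j, a ≠ p * j) (h1 : ∀ j, a ≠ p * j + 1) :
    D.P a (D.β (D.P k x)) = 0 := by
  have ha := h0 0
  by_cases hak : a ≤ p * k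
  · rw [h.adem_β hp2 _ _ (by omega) hak, Finset.sum_eq_zero, Finset.sum_eq_zero, add_zero]
    · intro j hj
      have h3 : j ≤ (a - 1) / p := Nat.lt_succ_iff.1 (Finset.mem_range.1 hj)
      have h3 : p * j ≤ a - 1 := (Nat.mul_le_mul_left p h3).trans (Nat.mul_div_le _ p)
      have h2 := mul_pred_add_self p j
      have := h0 j
      have := h1 j
      rw [h.P_β_P_eq_zero hp2 hx, smul_zero]
      omega
    · intro j hj
      have h3 : j ≤ a / p := Nat.lt_succ_iff.1 (Finset.mem_range.1 hj)
      have h3 : p * j ≤ a := (Nat.mul_le_mul_left p h3).trans (Nat.mul_div_le _ p)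
      have h2 := mul_pred_add_self p j
      have := h0 j
      rw [h.β_P_P_eq_zero hp2 hx, smul_zero]
      omega
  · have h2 := mul_pred_add_self p k
    have := h0 k
    have := h1 k
    exact h.P_β_P_eq_zero hp2 hx (by omega)

open scoped Classical in
/-- The top operation `x ↦ P k x` on the degrees `c + eps p * k`, extended by zero. -/
noncomputable def topP (h : D.IsUnstableAbove c) : V →ₗ[ZMod p] V :=
  degLift h.isInternal fun m =>
    if IsTopDeg p c m then D.P ((m - c) / eps p) ∘ₗ (D.deg m).subtype else 0

open scoped Classical in
/-- The top operation `x ↦ β (P k x)` on the degrees `c + 2 * k + 1`, for odd `p`, extended by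
zero. -/
noncomputable def topβP (h : D.IsUnstableAbove c) : V →ₗ[ZMod p] V :=
  degLift h.isInternal fun m =>
    if IsTopDeg p c m then 0 else D.β ∘ₗ D.P ((m - c) / 2) ∘ₗ (D.deg m).subtype

theorem topP_of_mem (h : D.IsUnstableAbove c) {k : ℕ} {x : V} (hx : x ∈ D.deg (c + eps p * k)) :
    h.topP x = D.P k x := by
  rw [topP, degLift_of_mem _ _ hx, if_pos ⟨k, rfl⟩, Nat.add_sub_cancel_left,
    Nat.mul_div_cancel_left _ (eps_pos p)]
  rfl

theorem topP_of_not {m : ℕ} (h : D.IsUnstableAbove c) (hm : ¬ IsTopDeg p c m) {x : V}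
    (hx : x ∈ D.deg m) : h.topP x = 0 := by
  rw [topP, degLift_of_mem _ _ hx, if_neg hm]
  rfl

theorem topβP_of_mem (h : D.IsUnstableAbove c) (hp2 : p ≠ 2) {k : ℕ} {x : V}
    (hx : x ∈ D.deg (c + 2 * k + 1)) : h.topβP x = D.β (D.P k x) := by
  rw [topβP, degLift_of_mem _ _ hx, if_neg (not_isTopDeg_odd hp2),
    show (c + 2 * k + 1 - c) / 2 = k by omega]
  rfl

theorem topβP_of_top (h : D.IsUnstableAbove c) {k : ℕ} {x : V}
    (hx : x ∈ D.deg (c + eps p * k)) : h.topβP x = 0 := by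
  rw [topβP, degLift_of_mem _ _ hx, if_pos ⟨k, rfl⟩]
  rfl

theorem topP_mem (h : D.IsUnstableAbove c) {k : ℕ} {x : V} (hx : x ∈ D.deg (c + eps p * k)) :
    h.topP x ∈ D.deg (c + eps p * (p * k)) := by
  rw [h.topP_of_mem hx]
  have := h.P_mem_top hx k
  rwa [add_comm k, mul_pred_add_self p k] at this

theorem topβP_mem (h : D.IsUnstableAbove c) (hp2 : p ≠ 2) {k : ℕ} {x : V}
    (hx : x ∈ D.deg (c + 2 * k + 1)) : h.topβP x ∈ D.deg (c + eps p * (p * k + 1)) := by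
  rw [h.topβP_of_mem hp2 hx]
  have := h.βP_mem_odd hp2 hx k
  rwa [show k + 1 + k * (p - 1) = p * k + 1 by rw [← mul_pred_add_self p k]; ring] at this

theorem topP_P (h : D.IsUnstableAbove c) (j : ℕ) (x : V) :
    h.topP (D.P j x) = D.P (p * j) (h.topP x) := by
  induction x using homogeneous_induction h.isInternal with
  | zero => simp only [map_zero]
  | add x y h1 h2 => simp only [map_add, h1, h2]
  | mem m x hx =>
    rcases h.deg_cases hx with rfl | ⟨k, rfl⟩ | ⟨hp2, k, rfl⟩
    · simp only [map_zero]
    · rw [h.topP_of_mem (h.P_mem_top hx j), h.topP_of_mem hx, h.P_mul_P_top hx]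
    · rw [h.topP_of_not (not_isTopDeg_odd hp2) (h.P_mem_odd hp2 hx j),
        h.topP_of_not (not_isTopDeg_odd hp2) hx, map_zero]

theorem topβP_P (h : D.IsUnstableAbove c) (j : ℕ) (x : V) :
    h.topβP (D.P j x) = D.P (p * j) (h.topβP x) := by
  induction x using homogeneous_induction h.isInternal with
  | zero => simp only [map_zero]
  | add x y h1 h2 => simp only [map_add, h1, h2]
  | mem m x hx =>
    rcases h.deg_cases hx with rfl | ⟨k, rfl⟩ | ⟨hp2, k, rfl⟩
    · simp only [map_zero]
    · rw [h.topβP_of_top (h.P_mem_top hx j), h.topβP_of_top hx, map_zero]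
    · rw [h.topβP_of_mem hp2 (h.P_mem_odd hp2 hx j), h.topβP_of_mem hp2 hx,
        h.P_mul_β_P_top hp2 hx]

theorem P_topP_of_not_dvd (h : D.IsUnstableAbove c) {a : ℕ} (ha : ¬ p ∣ a) (x : V) :
    D.P a (h.topP x) = 0 := by
  induction x using homogeneous_induction h.isInternal with
  | zero => simp only [map_zero]
  | add x y h1 h2 => simp only [map_add, h1, h2, add_zero]
  | mem m x hx =>
    rcases h.deg_cases hx with rfl | ⟨k, rfl⟩ | ⟨hp2, k, rfl⟩
    · simp only [map_zero]
    · rw [h.topP_of_mem hx, h.P_P_top_of_not_dvd hx ha]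
    · rw [h.topP_of_not (not_isTopDeg_odd hp2) hx, map_zero]

/-- The subspace of values of the first top operation. -/
noncomputable def topRange (h : D.IsUnstableAbove c) : Submodule (ZMod p) V :=
  LinearMap.range h.topP

/-- The subspace generated by the values of both top operations. The quotient by it is the
suspension of the loop functor applied to the module. -/
noncomputable def topsRange (h : D.IsUnstableAbove c) : Submodule (ZMod p) V :=
  LinearMap.range h.topP ⊔ LinearMap.range h.topβP

theorem degProj_topP (h : D.IsUnstableAbove c) (k : ℕ) (x : V) :
    degProj h.isInternal (c + eps p * (p * k)) (h.topP x) =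
      h.topP (degProj h.isInternal (c + eps p * k) x) := by
  induction x using homogeneous_induction h.isInternal with
  | zero => simp only [map_zero]
  | add x y h1 h2 => simp only [map_add, h1, h2]
  | mem m x hx =>
    rcases h.deg_cases hx with rfl | ⟨j, rfl⟩ | ⟨hp2, j, rfl⟩
    · simp only [map_zero]
    · rw [degProj_of_mem_ite _ hx, degProj_of_mem_ite _ (h.topP_mem hx)]
      have : (c + eps p * (p * j) = c + eps p * (p * k)) ↔ c + eps p * j = c + eps p * k := by
        simp [hp.out.ne_zero, (eps_pos p).ne']
      simp only [this]
      split_ifs <;> simp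
    · rw [h.topP_of_not (not_isTopDeg_odd hp2) hx, degProj_of_mem_ne _ _ hx, map_zero, map_zero]
      rw [eps_odd hp2]
      omega

theorem degProj_topP_of_ne (h : D.IsUnstableAbove c) {m : ℕ}
    (hm : ∀ k, m ≠ c + eps p * (p * k)) (x : V) : degProj h.isInternal m (h.topP x) = 0 := by
  induction x using homogeneous_induction h.isInternal with
  | zero => simp only [map_zero]
  | add x y h1 h2 => simp only [map_add, h1, h2, add_zero]
  | mem n x hx =>
    rcases h.deg_cases hx with rfl | ⟨j, rfl⟩ | ⟨hp2, j, rfl⟩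
    · simp only [map_zero]
    · exact degProj_of_mem_ne _ (hm j).symm (h.topP_mem hx)
    · rw [h.topP_of_not (not_isTopDeg_odd hp2) hx, map_zero]

theorem degProj_topβP (h : D.IsUnstableAbove c) (hp2 : p ≠ 2) (k : ℕ) (x : V) :
    degProj h.isInternal (c + eps p * (p * k + 1)) (h.topβP x) =
      h.topβP (degProj h.isInternal (c + 2 * k + 1) x) := by
  induction x using homogeneous_induction h.isInternal with
  | zero => simp only [map_zero]
  | add x y h1 h2 => simp only [map_add, h1, h2]
  | mem m x hx =>
    rcases h.deg_cases hx with rfl | ⟨j, rfl⟩ | ⟨hp2, j, rfl⟩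
    · simp only [map_zero]
    · rw [h.topβP_of_top hx, degProj_of_mem_ne _ _ hx, map_zero, map_zero]
      rw [eps_odd hp2]
      omega
    · rw [degProj_of_mem_ite _ hx, degProj_of_mem_ite _ (h.topβP_mem hp2 hx)]
      have : (c + eps p * (p * j + 1) = c + eps p * (p * k + 1)) ↔
          c + 2 * j + 1 = c + 2 * k + 1 := by
        simp [hp.out.ne_zero, (eps_pos p).ne']
      simp only [this]
      split_ifs <;> simp

theorem degProj_topβP_of_ne (h : D.IsUnstableAbove c) {m : ℕ}
    (hm : p ≠ 2 → ∀ k, m ≠ c + eps p * (p * k + 1)) (x : V) :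
    degProj h.isInternal m (h.topβP x) = 0 := by
  induction x using homogeneous_induction h.isInternal with
  | zero => simp only [map_zero]
  | add x y h1 h2 => simp only [map_add, h1, h2, add_zero]
  | mem n x hx =>
    rcases h.deg_cases hx with rfl | ⟨j, rfl⟩ | ⟨hp2, j, rfl⟩
    · simp only [map_zero]
    · rw [h.topβP_of_top hx, map_zero]
    · exact degProj_of_mem_ne _ (hm hp2 j).symm (h.topβP_mem hp2 hx)

theorem β_topP (h : D.IsUnstableAbove c) (x : V) : D.β (h.topP x) = 0 := by
  by_cases hp2 : p = 2
  · rw [h.β_two hp2]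
    exact h.P_topP_of_not_dvd (by rw [hp2]; norm_num) x
  induction x using homogeneous_induction h.isInternal with
  | zero => simp only [map_zero]
  | add x y h1 h2 => simp only [map_add, h1, h2, add_zero]
  | mem m x hx =>
    rcases h.deg_cases hx with rfl | ⟨k, rfl⟩ | ⟨hp2, k, rfl⟩
    · simp only [map_zero]
    · rw [h.topP_of_mem hx]
      exact h.unstable_β hp2 _ k _ hx (by rw [eps_odd hp2]; omega)
    · rw [h.topP_of_not (not_isTopDeg_odd hp2) hx, map_zero]

theorem β_topβP (h : D.IsUnstableAbove c) (x : V) : D.β (h.topβP x) = 0 := by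
  induction x using homogeneous_induction h.isInternal with
  | zero => simp only [map_zero]
  | add x y h1 h2 => simp only [map_add, h1, h2, add_zero]
  | mem m x hx =>
    rcases h.deg_cases hx with rfl | ⟨k, rfl⟩ | ⟨hp2, k, rfl⟩
    · simp only [map_zero]
    · rw [h.topβP_of_top hx, map_zero]
    · rw [h.topβP_of_mem hp2 hx, h.β_β]

theorem P_topβP_mem (h : D.IsUnstableAbove c) (a : ℕ) (x : V) :
    D.P a (h.topβP x) ∈ h.topsRange := by
  induction x using homogeneous_induction h.isInternal with
  | zero => rw [map_zero, map_zero]; exact zero_mem _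
  | add x y h1 h2 => rw [map_add, map_add]; exact add_mem h1 h2
  | mem m x hx =>
    rcases h.deg_cases hx with rfl | ⟨k, rfl⟩ | ⟨hp2, k, rfl⟩
    · rw [map_zero, map_zero]; exact zero_mem _
    · rw [h.topβP_of_top hx, map_zero]; exact zero_mem _
    · by_cases h0 : ∃ j, a = p * j
      · obtain ⟨j, rfl⟩ := h0
        rw [← h.topβP_P]
        exact Submodule.mem_sup_right ⟨_, rfl⟩
      by_cases h1 : ∃ j, a = p * j + 1
      · obtain ⟨j, rfl⟩ := h1
        rw [h.topβP_of_mem hp2 hx, h.P_mul_add_one_β_P_top hp2 hx,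
          ← h.topP_of_mem (h.βP_mem_odd hp2 hx j)]
        exact Submodule.mem_sup_left ⟨_, rfl⟩
      · push Not at h0 h1
        rw [h.topβP_of_mem hp2 hx, h.P_β_P_top_eq_zero hp2 hx h0 h1]
        exact zero_mem _

theorem topRange_stable (h : D.IsUnstableAbove c) : D.IsStable h.topRange := by
  constructor
  · rintro a _ ⟨x, rfl⟩
    by_cases ha : p ∣ a
    · obtain ⟨j, rfl⟩ := ha
      rw [← h.topP_P]
      exact ⟨_, rfl⟩
    · rw [h.P_topP_of_not_dvd ha]; exact zero_mem _
  · rintro _ ⟨x, rfl⟩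
    rw [h.β_topP]; exact zero_mem _

theorem topsRange_stable (h : D.IsUnstableAbove c) : D.IsStable h.topsRange := by
  constructor
  · intro a x hx
    obtain ⟨_, hy, _, ⟨z, rfl⟩, rfl⟩ := Submodule.mem_sup.1 hx
    rw [map_add]
    exact add_mem (Submodule.mem_sup_left (h.topRange_stable.1 a _ hy)) (h.P_topβP_mem a z)
  · intro x hx
    obtain ⟨_, ⟨y, rfl⟩, _, ⟨z, rfl⟩, rfl⟩ := Submodule.mem_sup.1 hx
    rw [map_add, h.β_topP, h.β_topβP, add_zero]
    exact zero_mem _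

theorem topRange_homogeneous (h : D.IsUnstableAbove c) :
    IsHomogeneousSub h.isInternal h.topRange := by
  rintro n _ ⟨x, rfl⟩
  by_cases hn : ∃ k, n = c + eps p * (p * k)
  · obtain ⟨k, rfl⟩ := hn
    rw [h.degProj_topP]
    exact ⟨_, rfl⟩
  · push Not at hn
    rw [h.degProj_topP_of_ne hn]; exact zero_mem _

theorem topsRange_homogeneous (h : D.IsUnstableAbove c) :
    IsHomogeneousSub h.isInternal h.topsRange := by
  intro n x hx
  obtain ⟨_, hy, _, ⟨z, rfl⟩, rfl⟩ := Submodule.mem_sup.1 hx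
  rw [map_add]
  refine add_mem (Submodule.mem_sup_left (h.topRange_homogeneous n _ hy)) ?_
  by_cases hn : p ≠ 2 ∧ ∃ k, n = c + eps p * (p * k + 1)
  · obtain ⟨hp2, k, rfl⟩ := hn
    rw [h.degProj_topβP hp2]
    exact Submodule.mem_sup_right ⟨_, rfl⟩
  · push Not at hn
    rw [h.degProj_topβP_of_ne hn]; exact zero_mem _

theorem degProj_topsRange (h : D.IsUnstableAbove c) {m : ℕ} (hm : ¬ IsTopDeg p c m) {x : V}
    (hx : x ∈ h.topsRange) : degProj h.isInternal m x = 0 := by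
  obtain ⟨_, ⟨y, rfl⟩, _, ⟨z, rfl⟩, rfl⟩ := Submodule.mem_sup.1 hx
  rw [map_add, h.degProj_topP_of_ne, h.degProj_topβP_of_ne, add_zero]
  · rintro - k rfl; exact hm ⟨_, rfl⟩
  · rintro k rfl; exact hm ⟨_, rfl⟩

end IsUnstableAbove
end SteenrodData

namespace SteenrodData

variable {p : ℕ} {V : Type u} [AddCommGroup V] [Module (ZMod p) V]
  {D : SteenrodData p V} {c : ℕ}

/-- The projection to a quotient, as a map of modules over the operators. -/
noncomputable def quotOpMap (h : DirectSum.IsInternal D.deg) {W : Submodule (ZMod p) V}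
    (hW : D.IsStable W) (hom : IsHomogeneousSub h W) :
    OpMod (D.opsAndProj h) →ₗ[FreeAlgebra (ZMod p) (ℕ ⊕ ℕ)]
      OpMod ((D.quot W hW).opsAndProj (isInternal_quot h hom)) :=
  OpMod.map W.mkQ (by
    rintro (j | m) x
    · rfl
    · exact (degProj_quot h hom m x).symm)

namespace IsUnstableAbove

theorem degProj_eq_zero_of_span (h : D.IsUnstableAbove c) {n : ℕ} {x : V} (hx : x ∈ D.deg n)
    (hspan : D.span {x} = ⊤) {m : ℕ} (hm : m < n) (y : V) : degProj h.isInternal m y = 0 := by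
  have key : D.span {x} ≤ ⨅ m, ⨅ (_ : m < n), LinearMap.ker (degProj h.isInternal m) := by
    apply span_le
    · constructor
      · intro i y hy
        simp only [Submodule.mem_iInf, LinearMap.mem_ker] at hy ⊢
        intro m hm
        by_cases hi : degP p i ≤ m
        · obtain ⟨m, rfl⟩ := Nat.exists_eq_add_of_le' hi
          rw [degProj_P h.isInternal h.P_mem, hy m (by omega), map_zero]
        · exact degProj_map_of_notMem h.isInternal h.isInternal (D.P i) (· + degP p i) (h.P_mem i) m
            (fun _ _ => hi (by omega)) y
      · intro y hy
        simp only [Submodule.mem_iInf, LinearMap.mem_ker] at hy ⊢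
        intro m hm
        by_cases hi : 1 ≤ m
        · obtain ⟨m, rfl⟩ := Nat.exists_eq_add_of_le' hi
          rw [degProj_map h.isInternal h.isInternal D.β (· + 1) (add_left_injective _) h.β_mem,
            hy m (by omega), map_zero]
        · exact degProj_map_of_notMem h.isInternal h.isInternal D.β (· + 1) h.β_mem m
            (fun _ _ => hi (by omega)) y
    · rw [Set.singleton_subset_iff, SetLike.mem_coe]
      simp only [Submodule.mem_iInf, LinearMap.mem_ker]
      intro m hm
      exact degProj_of_mem_ne _ (by omega) hx
  rw [hspan] at key
  have := key (Submodule.mem_top (x := y))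
  simp only [Submodule.mem_iInf, LinearMap.mem_ker] at this
  exact this m hm

theorem finite_of_span (h : D.IsUnstableAbove c) [Fact p.Prime] {n : ℕ} {x : V}
    (hx : x ∈ D.deg n) (hspan : D.span {x} = ⊤) (hn : n ≤ c) : Finite V := by
  have hP : ∀ i, 0 < i → D.P i x = 0 := fun i hi => h.unstable n i x hx (by
    have := Nat.mul_pos (eps_pos p) hi; omega)
  have hβ : D.β x = 0 := by
    by_cases hp2 : p = 2
    · rw [h.β_two hp2, hP 1 one_pos]
    · rw [← h.P_zero x]; exact h.unstable_β hp2 n 0 x hx (by omega)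
  have key : D.span {x} ≤ Submodule.span (ZMod p) {x} := by
    apply span_le
    · constructor
      · intro i y hy
        obtain ⟨a, rfl⟩ := Submodule.mem_span_singleton.1 hy
        rw [map_smul]
        rcases Nat.eq_zero_or_pos i with rfl | hi
        · rw [h.P_zero]; exact hy
        · rw [hP i hi, smul_zero]; exact zero_mem _
      · intro y hy
        obtain ⟨a, rfl⟩ := Submodule.mem_span_singleton.1 hy
        rw [map_smul, hβ, smul_zero]; exact zero_mem _
    · exact Submodule.subset_span
  rw [hspan] at key
  refine Finite.of_surjective (fun a : ZMod p => a • x) fun y => ?_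
  exact Submodule.mem_span_singleton.1 (key (Submodule.mem_top (x := y)))

theorem topP_iterate_degProj (h : D.IsUnstableAbove c) [hp : Fact p.Prime]
    (h0 : ∀ y, degProj h.isInternal c y = 0) (k : ℕ) (v : V) :
    ∀ m < c + p ^ k, degProj h.isInternal m (h.topP^[k] v) = 0 := by
  induction k with
  | zero =>
    intro m hm
    rcases Nat.lt_or_eq_of_le (show m ≤ c by simpa [Nat.lt_succ_iff] using hm) with hm | rfl
    · exact h.eq_zero_of_lt (degProj_mem _ m _) hm
    · exact h0 _
  | succ k ih =>
    intro m hm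
    rw [Function.iterate_succ_apply']
    by_cases hmk : ∃ j, m = c + eps p * (p * j)
    · obtain ⟨j, rfl⟩ := hmk
      rw [h.degProj_topP, ih, map_zero]
      have h1 : p * (eps p * j) < p * p ^ k := by
        rw [← pow_succ', mul_left_comm]; omega
      have := Nat.lt_of_mul_lt_mul_left h1
      omega
    · push Not at hmk
      exact h.degProj_topP_of_ne hmk _

variable [hp : Fact p.Prime]

open scoped Classical in
/-- The endomorphism of the free algebra along which the first top operation is semilinear. -/
noncomputable def topσ (p c : ℕ) :
    FreeAlgebra (ZMod p) (ℕ ⊕ ℕ) →ₐ[ZMod p] FreeAlgebra (ZMod p) (ℕ ⊕ ℕ) :=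
  FreeAlgebra.lift (ZMod p) (Sum.elim (fun j => FreeAlgebra.ι (ZMod p) (Sum.inl (p * j)))
    fun m => if IsTopDeg p c m then FreeAlgebra.ι (ZMod p) (Sum.inr (c + p * (m - c))) else 0)

open scoped Classical in
/-- The endomorphism of the free algebra along which the second top operation is semilinear. -/
noncomputable def topβσ (p c : ℕ) :
    FreeAlgebra (ZMod p) (ℕ ⊕ ℕ) →ₐ[ZMod p] FreeAlgebra (ZMod p) (ℕ ⊕ ℕ) :=
  FreeAlgebra.lift (ZMod p) (Sum.elim (fun j => FreeAlgebra.ι (ZMod p) (Sum.inl (p * j)))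
    fun m => if p ≠ 2 ∧ ∃ k, m = c + 2 * k + 1 then
      FreeAlgebra.ι (ZMod p) (Sum.inr (c + eps p * (p * ((m - c) / 2) + 1))) else 0)

theorem topP_opsAndProj (h : D.IsUnstableAbove c) (i : ℕ ⊕ ℕ) (x : V) :
    OpMod.mk (D.opsAndProj h.isInternal) (h.topP (D.opsAndProj h.isInternal i x)) =
      topσ p c (FreeAlgebra.ι (ZMod p) i) •
        OpMod.mk (D.opsAndProj h.isInternal) (h.topP x) := by
  rcases i with j | m
  · rw [topσ, FreeAlgebra.lift_ι_apply, Sum.elim_inl, OpMod.ι_smul]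
    exact congrArg _ (h.topP_P j x)
  · rw [topσ, FreeAlgebra.lift_ι_apply, Sum.elim_inr]
    change OpMod.mk _ (h.topP (degProj h.isInternal m x)) = _
    split_ifs with hm
    · rw [OpMod.ι_smul]
      obtain ⟨k, rfl⟩ := hm
      rw [← h.degProj_topP, Nat.add_sub_cancel_left, mul_left_comm]
      rfl
    · rw [zero_smul, h.topP_of_not hm (degProj_mem _ m x), map_zero]

theorem topβP_opsAndProj (h : D.IsUnstableAbove c) (i : ℕ ⊕ ℕ) (x : V) :
    OpMod.mk (D.opsAndProj h.isInternal) (h.topβP (D.opsAndProj h.isInternal i x)) =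
      topβσ p c (FreeAlgebra.ι (ZMod p) i) •
        OpMod.mk (D.opsAndProj h.isInternal) (h.topβP x) := by
  rcases i with j | m
  · rw [topβσ, FreeAlgebra.lift_ι_apply, Sum.elim_inl, OpMod.ι_smul]
    exact congrArg _ (h.topβP_P j x)
  · rw [topβσ, FreeAlgebra.lift_ι_apply, Sum.elim_inr]
    change OpMod.mk _ (h.topβP (degProj h.isInternal m x)) = _
    split_ifs with hm
    · rw [OpMod.ι_smul]
      obtain ⟨hp2, k, rfl⟩ := hm
      rw [← h.degProj_topβP hp2, show (c + 2 * k + 1 - c) / 2 = k by omega]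
      rfl
    · rw [zero_smul]
      have hx := degProj_mem h.isInternal m x
      rcases h.deg_cases hx with h0 | ⟨k, rfl⟩ | hk
      · rw [h0, map_zero, map_zero]
      · rw [h.topβP_of_top hx, map_zero]
      · exact absurd hk hm

/-- The first top operation as a semilinear map. -/
noncomputable def topPₛₗ (h : D.IsUnstableAbove c) :
    OpMod (D.opsAndProj h.isInternal) →ₛₗ[(topσ p c).toRingHom]
      OpMod (D.opsAndProj h.isInternal) :=
  OpMod.mapₛₗ _ (fun a => (topσ p c).commutes a) h.topP h.topP_opsAndProj

theorem topPₛₗ_mk (h : D.IsUnstableAbove c) (x : V) :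
    h.topPₛₗ (OpMod.mk _ x) = OpMod.mk _ (h.topP x) := rfl

theorem topPₛₗ_iterate (h : D.IsUnstableAbove c) (k : ℕ) (x : V) :
    h.topPₛₗ^[k] (OpMod.mk _ x) = OpMod.mk _ (h.topP^[k] x) := by
  induction k generalizing x with
  | zero => rfl
  | succ k ih => rw [Function.iterate_succ_apply, topPₛₗ_mk, ih]; rfl

/-- The second top operation as a semilinear map. -/
noncomputable def topβPₛₗ (h : D.IsUnstableAbove c) :
    OpMod (D.opsAndProj h.isInternal) →ₛₗ[(topβσ p c).toRingHom]
      OpMod (D.opsAndProj h.isInternal) :=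
  OpMod.mapₛₗ _ (fun a => (topβσ p c).commutes a) h.topβP h.topβP_opsAndProj

/-- A Noetherian quotient by the values of the top operations forces Noetherianity. -/
theorem isNoetherian_of_quot (h : D.IsUnstableAbove c)
    (h0 : ∀ y, degProj h.isInternal c y = 0)
    (hN : IsNoetherian (FreeAlgebra (ZMod p) (ℕ ⊕ ℕ))
      (OpMod ((D.quot h.topsRange h.topsRange_stable).opsAndProj
        (isInternal_quot h.isInternal h.topsRange_homogeneous)))) :
    IsNoetherian (FreeAlgebra (ZMod p) (ℕ ⊕ ℕ)) (OpMod (D.opsAndProj h.isInternal)) := by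
  set T := D.opsAndProj h.isInternal with hT
  set R := FreeAlgebra (ZMod p) (ℕ ⊕ ℕ) with hR
  set T0 := (D.quot h.topRange h.topRange_stable).opsAndProj
    (isInternal_quot h.isInternal h.topRange_homogeneous) with hT0
  set T1 := (D.quot h.topsRange h.topsRange_stable).opsAndProj
    (isInternal_quot h.isInternal h.topsRange_homogeneous) with hT1
  let g0 : OpMod T →ₗ[R] OpMod T0 := quotOpMap h.isInternal h.topRange_stable h.topRange_homogeneous
  let g1 : OpMod T →ₗ[R] OpMod T1 :=
    quotOpMap h.isInternal h.topsRange_stable h.topsRange_homogeneous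
  have hg0 : ∀ x, g0 x = 0 → x ∈ h.topRange := fun x hx =>
    (Submodule.Quotient.mk_eq_zero _).1 hx
  have hg1 : ∀ x, g1 x = 0 → x ∈ h.topsRange := fun x hx =>
    (Submodule.Quotient.mk_eq_zero _).1 hx
  have g0_surj : Function.Surjective g0 := h.topRange.mkQ_surjective
  -- The part of the degrees on which the first top operation is not defined.
  let odd : Submodule (ZMod p) V :=
    ⨅ m, ⨅ (_ : IsTopDeg p c m), LinearMap.ker (degProj h.isInternal m)
  have mem_odd : ∀ x, x ∈ odd ↔ ∀ m, IsTopDeg p c m → degProj h.isInternal m x = 0 := by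
    intro x
    simp only [odd, Submodule.mem_iInf, LinearMap.mem_ker]
  have odd_stable : ∀ i, ∀ x ∈ odd, T i x ∈ odd := by
    rintro (j | m) x hx
    · rw [mem_odd] at hx ⊢
      rintro m ⟨k, rfl⟩
      change degProj h.isInternal _ (D.P j x) = 0
      by_cases hj : j * (p - 1) ≤ k
      · obtain ⟨k, rfl⟩ := Nat.exists_eq_add_of_le' hj
        rw [mul_add, ← add_assoc, ← degP_eq, degProj_P h.isInternal h.P_mem, hx _ ⟨k, rfl⟩,
          map_zero]
      · by_cases hj' : degP p j ≤ c + eps p * k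
        · obtain ⟨m, hm⟩ := Nat.exists_eq_add_of_le' hj'
          have : m < c := by
            have h1 := Nat.mul_lt_mul_of_pos_left (not_le.1 hj) (eps_pos p)
            rw [← degP_eq] at h1
            omega
          rw [hm, degProj_P h.isInternal h.P_mem, h.eq_zero_of_lt (degProj_mem _ m x) this,
            map_zero]
        · exact degProj_map_of_notMem h.isInternal h.isInternal (D.P j) (· + degP p j) (h.P_mem j) _
            (fun _ _ => hj' (by omega)) x
    · rw [mem_odd] at hx ⊢
      intro n hn
      change degProj h.isInternal n (degProj h.isInternal m x) = 0
      rw [degProj_of_mem_ite _ (degProj_mem _ m x)]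
      split_ifs with hmn
      · subst hmn; exact hx _ hn
      · rfl
  -- Elements of such degrees embed into the quotient by the values of both top operations.
  let O : Submodule R (OpMod T) := OpMod.ofStable odd odd_stable
  have hO : IsNoetherian R O := by
    refine isNoetherian_of_injective (g1.comp O.subtype) ?_
    rw [injective_iff_map_eq_zero]
    rintro ⟨x, hx⟩ hx0
    have h1 := hg1 x hx0
    apply Subtype.ext
    refine eq_zero_of_degProj h.isInternal fun m => ?_
    by_cases hm : IsTopDeg p c m
    · exact (mem_odd x).1 hx m hm
    · exact h.degProj_topsRange hm h1
  let gg : OpMod T0 →ₗ[R] OpMod T1 := OpMod.map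
    (h.topRange.liftQ h.topsRange.mkQ (by
      rw [Submodule.ker_mkQ]; exact le_sup_left)) (by
    intro i x
    obtain ⟨x, rfl⟩ := h.topRange.mkQ_surjective x
    have e0 : T0 i (h.topRange.mkQ x) = h.topRange.mkQ (T i x) := by
      rcases i with j | m
      · rfl
      · exact degProj_quot h.isInternal h.topRange_homogeneous m x
    have e1 : T1 i (h.topsRange.mkQ x) = h.topsRange.mkQ (T i x) := by
      rcases i with j | m
      · rfl
      · exact degProj_quot h.isInternal h.topsRange_homogeneous m x
    rw [e0]
    exact e1.symm)
  have hgg : ∀ x, gg (g0 x) = g1 x := fun x => rfl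
  -- The kernel of `T0 → T1` consists of values of the second top operation on these degrees.
  have hK : IsNoetherian R (LinearMap.ker gg) := by
    refine isNoetherian_of_semilinear _ ((g0.comp h.topβPₛₗ).comp O.subtype) _ ?_
    intro y hy
    obtain ⟨x, rfl⟩ := g0_surj y
    have h1 : (OpMod.mk T).symm x ∈ h.topsRange := hg1 x ((hgg x).symm.trans hy)
    obtain ⟨_, ⟨a, rfl⟩, _, ⟨b, rfl⟩, hab⟩ := Submodule.mem_sup.1 h1
    have hb : ∃ b' ∈ odd, h.topβP b' = h.topβP b := by
      clear hab
      induction b using homogeneous_induction h.isInternal with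
      | zero => exact ⟨0, zero_mem _, rfl⟩
      | add x y h1 h2 =>
        obtain ⟨x', hx', hx⟩ := h1
        obtain ⟨y', hy', hy⟩ := h2
        exact ⟨x' + y', add_mem hx' hy', by rw [map_add, map_add, hx, hy]⟩
      | mem m x hx =>
        by_cases hm : IsTopDeg p c m
        · obtain ⟨k, rfl⟩ := hm
          exact ⟨0, zero_mem _, by rw [map_zero, h.topβP_of_top hx]⟩
        · refine ⟨x, (mem_odd x).2 fun n hn => degProj_of_mem_ne _ ?_ hx, rfl⟩
          rintro rfl
          exact hm hn
    obtain ⟨b', hb', hbb⟩ := hb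
    refine ⟨⟨OpMod.mk _ b', hb'⟩, ?_⟩
    have e1 : x = OpMod.mk (D.opsAndProj h.isInternal) (h.topP a) +
        OpMod.mk (D.opsAndProj h.isInternal) (h.topβP b) := hab.symm
    have e2 : g0 (OpMod.mk (D.opsAndProj h.isInternal) (h.topP a)) = 0 :=
      (Submodule.Quotient.mk_eq_zero h.topRange).2 ⟨a, rfl⟩
    rw [e1, map_add, e2, zero_add, ← hbb]
    rfl
  have hQ0 : IsNoetherian R (OpMod T0) :=
    isNoetherian_of_range_eq_ker (LinearMap.ker gg).subtype gg (Submodule.range_subtype _)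
  refine isNoetherian_of_frobenius h.topPₛₗ g0 (fun x hx => ?_) (fun x => ?_) fun x => ?_
  · obtain ⟨y, hy⟩ := hg0 x hx
    exact ⟨OpMod.mk _ y, hy⟩
  · obtain ⟨x, rfl⟩ := OpMod.exists_mk x
    obtain ⟨s, hs⟩ := exists_sum_degProj h.isInternal x
    classical
    refine ⟨∑ m ∈ s, if IsTopDeg p c m then FreeAlgebra.ι (ZMod p) (Sum.inl ((m - c) / eps p)) *
      FreeAlgebra.ι (ZMod p) (Sum.inr m) else 0, ?_⟩
    rw [topPₛₗ_mk]
    conv_rhs => rw [← hs s subset_rfl]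
    rw [Finset.sum_smul, map_sum, map_sum]
    refine Finset.sum_congr rfl fun m _ => ?_
    split_ifs with hm
    · obtain ⟨k, rfl⟩ := hm
      rw [mul_smul, OpMod.ι_smul, OpMod.ι_smul, h.topP_of_mem (degProj_mem _ _ x),
        Nat.add_sub_cancel_left, Nat.mul_div_cancel_left _ (eps_pos p)]
      rfl
    · rw [zero_smul, h.topP_of_not hm (degProj_mem _ _ x), map_zero]
  · obtain ⟨x, rfl⟩ := OpMod.exists_mk x
    obtain ⟨s, hs⟩ := exists_sum_degProj h.isInternal x
    refine ⟨∑ m ∈ s, FreeAlgebra.ι (ZMod p) (Sum.inr m), s.sup id + 1, ?_, fun v => ?_⟩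
    · conv_rhs => rw [← hs s subset_rfl]
      rw [Finset.sum_smul, map_sum]
      refine Finset.sum_congr rfl fun m _ => ?_
      rw [OpMod.ι_smul]
      rfl
    · obtain ⟨v, rfl⟩ := OpMod.exists_mk v
      rw [topPₛₗ_iterate, Finset.sum_smul]
      refine Finset.sum_eq_zero fun m hm => ?_
      rw [OpMod.ι_smul]
      refine (congrArg _ (h.topP_iterate_degProj h0 _ v m ?_)).trans (map_zero _)
      have h1 : m ≤ s.sup id := Finset.le_sup (f := id) hm
      have h2 := Nat.lt_pow_self (n := s.sup id + 1) hp.out.one_lt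
      omega

/-- Cyclic modules are Noetherian: dividing by the values of the top operations raises `c` by one,
and when `c` reaches the degree of the generator, the module is finite. -/
theorem isNoetherian_of_span_singleton_aux (d : ℕ) :
    ∀ (V : Type u) [AddCommGroup V] [Module (ZMod p) V] (D : SteenrodData p V) (c n : ℕ) (x : V)
      (h : D.IsUnstableAbove c), x ∈ D.deg n → D.span {x} = ⊤ → n ≤ c + d →
      IsNoetherian (FreeAlgebra (ZMod p) (ℕ ⊕ ℕ)) (OpMod (D.opsAndProj h.isInternal)) := by
  have base : ∀ (V : Type u) [AddCommGroup V] [Module (ZMod p) V] (D : SteenrodData p V)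
      (c n : ℕ) (x : V) (h : D.IsUnstableAbove c), x ∈ D.deg n → D.span {x} = ⊤ → n ≤ c →
      IsNoetherian (FreeAlgebra (ZMod p) (ℕ ⊕ ℕ)) (OpMod (D.opsAndProj h.isInternal)) := by
    intro V _ _ D c n x h hx hspan hn
    have : Finite V := h.finite_of_span hx hspan hn
    have : Finite (OpMod (D.opsAndProj h.isInternal)) := this
    infer_instance
  induction d with
  | zero => intro V _ _ D c n x h hx hspan hn; exact base V D c n x h hx hspan hn
  | succ d ih =>
    intro V _ _ D c n x h hx hspan hn
    by_cases hnc : n ≤ c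
    · exact base V D c n x h hx hspan hnc
    refine h.isNoetherian_of_quot (h.degProj_eq_zero_of_span hx hspan (not_le.1 hnc)) ?_
    have hq : (D.quot h.topsRange h.topsRange_stable).IsUnstableAbove (c + 1) := by
      refine h.quot h.topsRange_stable h.topsRange_homogeneous (fun m i y hy hm => ?_)
        fun hp2 m i y hy hm => ?_
      · rcases Nat.lt_or_ge m (eps p * i + c) with hm' | hm'
        · rw [h.unstable m i y hy hm']; exact zero_mem _
        · obtain rfl : m = c + eps p * i := by omega
          rw [← h.topP_of_mem hy]
          exact Submodule.mem_sup_left ⟨_, rfl⟩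
      · rcases Nat.lt_or_ge m (2 * i + 1 + c) with hm' | hm'
        · rw [h.unstable_β hp2 m i y hy hm']; exact zero_mem _
        · obtain rfl : m = c + 2 * i + 1 := by omega
          rw [← h.topβP_of_mem hp2 hy]
          exact Submodule.mem_sup_right ⟨_, rfl⟩
    refine ih _ _ (c + 1) n (h.topsRange.mkQ x) hq ⟨x, hx, rfl⟩ ?_ (by omega)
    rw [eq_top_iff]
    rintro y -
    obtain ⟨y, rfl⟩ := h.topsRange.mkQ_surjective y
    have key : D.span {x} ≤
        ((D.quot h.topsRange h.topsRange_stable).span {h.topsRange.mkQ x}).comap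
          h.topsRange.mkQ := by
      have hst := (D.quot h.topsRange h.topsRange_stable).span_stable {h.topsRange.mkQ x}
      refine span_le ⟨fun i y hy => hst.1 i _ hy, fun y hy => hst.2 _ hy⟩ ?_
      rw [Set.singleton_subset_iff]
      exact SteenrodData.subset_span _ _ rfl
    rw [hspan] at key
    exact key (Submodule.mem_top (x := y))

end IsUnstableAbove

variable [hp : Fact p.Prime]

/-- Finitely generated unstable modules over the Steenrod algebra are Noetherian, even as modules
over the subalgebra generated by the operations `P i`. -/
theorem IsUnstable.isNoetherian (h : D.IsUnstable) (hfg : D.FG) :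
    IsNoetherian (FreeAlgebra (ZMod p) (ℕ ⊕ ℕ)) (OpMod (D.opsAndProj h.isInternal)) := by
  classical
  obtain ⟨s, hs, hspan⟩ := hfg
  choose N hN using fun x => exists_sum_degProj h.isInternal x
  set t : Set V := ⋃ x ∈ s, (fun m => degProj h.isInternal m x) '' (N x : Set ℕ) with ht
  have htfin : t.Finite := hs.biUnion fun x _ => (N x).finite_toSet.image _
  have hthom : ∀ y ∈ t, ∃ n, y ∈ D.deg n := by
    intro y hy
    simp only [ht, Set.mem_iUnion] at hy
    obtain ⟨x, -, m, -, rfl⟩ := hy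
    exact ⟨m, degProj_mem _ m x⟩
  have cyc : ∀ y ∈ t, ∃ M : Submodule (FreeAlgebra (ZMod p) (ℕ ⊕ ℕ))
      (OpMod (D.opsAndProj h.isInternal)), IsNoetherian (FreeAlgebra (ZMod p) (ℕ ⊕ ℕ)) M ∧
      ∀ x, OpMod.mk _ x ∈ M ↔ x ∈ D.span {y} := by
    intro y hy
    obtain ⟨n, hn⟩ := hthom y hy
    set W := D.span {y} with hW
    have hst := D.span_stable {y}
    have hom : IsHomogeneousSub h.isInternal W := isHomogeneousSub_aspan h.isInternal h.P_mem
      h.β_mem (by rintro _ rfl; exact ⟨n, hn⟩)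
    have hyW : y ∈ W := D.subset_span {y} rfl
    have hop : ∀ i, ∀ x ∈ W, D.opsAndProj h.isInternal i x ∈ W := by
      rintro (j | m) x hx
      · exact hst.1 j x hx
      · exact hom m x hx
    have hsub := isUnstableAbove_zero_iff.2 (h.sub hst hom)
    have hNo := IsUnstableAbove.isNoetherian_of_span_singleton_aux n W (D.sub W hst) 0 n ⟨y, hyW⟩
      hsub hn (by
        rw [eq_top_iff]
        rintro ⟨x, hx⟩ -
        have key : W ≤ ((D.sub W hst).span {⟨y, hyW⟩}).map W.subtype := by
          have hst' := (D.sub W hst).span_stable {⟨y, hyW⟩}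
          refine span_le ⟨?_, ?_⟩ ?_
          · rintro i _ ⟨z, hz, rfl⟩
            exact ⟨_, hst'.1 i z hz, rfl⟩
          · rintro _ ⟨z, hz, rfl⟩
            exact ⟨_, hst'.2 z hz, rfl⟩
          · rw [Set.singleton_subset_iff]
            exact ⟨_, SteenrodData.subset_span _ _ rfl, rfl⟩
        obtain ⟨z, hz, hzx⟩ := key hx
        rwa [show z = ⟨x, hx⟩ from Subtype.ext hzx] at hz) (by omega)
    refine ⟨OpMod.ofStable W hop, ?_, fun x => Iff.rfl⟩
    let f : OpMod ((D.sub W hst).opsAndProj hsub.isInternal) →ₗ[FreeAlgebra (ZMod p) (ℕ ⊕ ℕ)]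
        OpMod (D.opsAndProj h.isInternal) := OpMod.map W.subtype (by
      rintro (j | m) x
      · rfl
      · exact degProj_sub h.isInternal hom m x)
    refine isNoetherian_of_semilinear _ f _ ?_
    intro x hx
    exact ⟨OpMod.mk _ ⟨x, hx⟩, rfl⟩
  choose! M hM hM' using cyc
  have : Finite t := htfin
  have hsup : IsNoetherian (FreeAlgebra (ZMod p) (ℕ ⊕ ℕ)) (⨆ y : t, M y : Submodule _ _) := by
    have : ∀ y : t, IsNoetherian (FreeAlgebra (ZMod p) (ℕ ⊕ ℕ)) (M y) := fun y => hM y y.2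
    infer_instance
  have htop : (⨆ y : t, M y) = ⊤ := by
    rw [eq_top_iff]
    rintro x -
    obtain ⟨x, rfl⟩ := OpMod.exists_mk x
    rw [← OpMod.mem_toSubspace]
    have key : D.span s ≤ ⨆ y : t, D.span {y.1} := by
      apply span_le
      · constructor
        · intro i x hx
          have h1 : (⨆ y : t, D.span {y.1}) ≤ (⨆ y : t, D.span {y.1}).comap (D.P i) :=
            iSup_le fun y z hz => Submodule.mem_iSup_of_mem y ((D.span_stable _).1 i z hz)
          exact h1 hx
        · intro x hx
          have h1 : (⨆ y : t, D.span {y.1}) ≤ (⨆ y : t, D.span {y.1}).comap D.β :=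
            iSup_le fun y z hz => Submodule.mem_iSup_of_mem y ((D.span_stable _).2 z hz)
          exact h1 hx
      · intro x hx
        rw [← hN x _ subset_rfl]
        refine sum_mem fun m hm => ?_
        have hy : degProj h.isInternal m x ∈ t := Set.mem_biUnion hx ⟨m, hm, rfl⟩
        exact Submodule.mem_iSup_of_mem (⟨_, hy⟩ : t) (D.subset_span _ rfl)
    have key2 : (⨆ y : t, D.span {y.1}) ≤ OpMod.toSubspace (⨆ y : t, M y) := by
      refine iSup_le fun y x hx => ?_
      have h1 : M y ≤ ⨆ y : t, M y := le_iSup (fun y : t => M y) y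
      exact h1 ((hM' y y.2 x).2 hx)
    refine key2 ?_
    rw [hspan] at key
    exact key (Submodule.mem_top (x := x))
  rw [htop] at hsup
  exact isNoetherian_top_iff.1 hsup

end SteenrodData

/-! ### Powers and monomials in graded commutative algebras -/

section Frobenius

variable {p : ℕ} [hp : Fact p.Prime] {T : Type*} [Ring T] [Algebra (ZMod p) T]

theorem natCast_prime_eq_zero : (p : T) = 0 := by
  rw [← map_natCast (algebraMap (ZMod p) T), ZMod.natCast_self, map_zero]

theorem add_pow_prime_pow_of_commute {x y : T} (h : Commute x y) (k : ℕ) :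
    (x + y) ^ p ^ k = x ^ p ^ k + y ^ p ^ k := by
  rw [h.add_pow_prime_pow_eq hp.out k, natCast_prime_eq_zero]
  simp

theorem sum_pow_prime_pow {ι : Type*} (s : Finset ι) (f : ι → T)
    (h : ∀ i ∈ s, ∀ j ∈ s, Commute (f i) (f j)) (k : ℕ) :
    (∑ i ∈ s, f i) ^ p ^ k = ∑ i ∈ s, f i ^ p ^ k := by
  classical
  induction s using Finset.induction_on with
  | empty => simp [hp.out.ne_zero]
  | insert a s ha ih =>
    rw [Finset.sum_insert ha, Finset.sum_insert ha, add_pow_prime_pow_of_commute, ih]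
    · exact fun i hi j hj => h i (Finset.mem_insert_of_mem hi) j (Finset.mem_insert_of_mem hj)
    · exact Commute.sum_right _ _ _ fun j hj =>
        h a (Finset.mem_insert_self a s) j (Finset.mem_insert_of_mem hj)

theorem smul_pow_prime_pow (c : ZMod p) (x : T) (k : ℕ) : (c • x) ^ p ^ k = c • x ^ p ^ k := by
  rw [smul_pow, ZMod.pow_card_pow]

theorem sub_pow_prime_pow_of_commute {x y : T} (h : Commute x y) (k : ℕ) :
    (x - y) ^ p ^ k = x ^ p ^ k - y ^ p ^ k := by
  have := add_pow_prime_pow_of_commute (p := p) (h.smul_right (-1 : ZMod p)) k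
  rwa [smul_pow_prime_pow, neg_one_smul, neg_one_smul, ← sub_eq_add_neg, ← sub_eq_add_neg] at this

end Frobenius

/-- The degrees in which graded commutativity is commutativity: all degrees if `p = 2`, and the even
degrees if `p` is odd. -/
def IsEvenDeg (p n : ℕ) : Prop := p = 2 ∨ Even n

theorem IsEvenDeg.neg_one_pow {p n : ℕ} (h : IsEvenDeg p n) : (-1 : ZMod p) ^ n = 1 := by
  rcases h with rfl | h
  · rw [show (-1 : ZMod 2) = 1 from rfl, one_pow]
  · exact h.neg_one_pow

theorem IsEvenDeg.mul_right {p n : ℕ} (h : IsEvenDeg p n) (m : ℕ) : IsEvenDeg p (n * m) :=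
  h.imp_right fun h => h.mul_right m

theorem IsEvenDeg.mul_left {p n : ℕ} (h : IsEvenDeg p n) (m : ℕ) : IsEvenDeg p (m * n) :=
  h.imp_right fun h => h.mul_left m

theorem IsEvenDeg.add_degP {p n : ℕ} (h : IsEvenDeg p n) (i : ℕ) : IsEvenDeg p (n + degP p i) := by
  by_cases hp : p = 2
  · exact Or.inl hp
  · refine Or.inr ((h.resolve_left hp).add ?_)
    rw [degP, if_neg hp, mul_assoc]
    exact even_two_mul _

namespace SteenrodCAlg

variable {p : ℕ} (B : SteenrodCAlg.{u} p)

section Even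

variable {B}

theorem commute_of_isEvenDeg {n : ℕ} (hn : IsEvenDeg p n) {x : B.carrier} (hx : x ∈ B.ops.deg n)
    (y : B.carrier) : Commute x y := by
  induction y using homogeneous_induction B.isInternal with
  | zero => exact Commute.zero_right x
  | add y z h1 h2 => exact h1.add_right h2
  | mem m y hy =>
    have := B.graded_comm hx hy
    rwa [(hn.mul_right m).neg_one_pow, one_smul] at this

theorem sq_eq_zero_of_odd [hp : Fact p.Prime] (hp2 : p ≠ 2) {n : ℕ} (hn : Odd n) {x : B.carrier}
    (hx : x ∈ B.ops.deg n) : x ^ 2 = 0 := by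
  have h1 := B.graded_comm hx hx
  rw [(hn.mul hn).neg_one_pow, neg_one_smul, ← sq] at h1
  have h2 : (2 : ZMod p) • x ^ 2 = 0 := by
    rw [two_smul]
    exact eq_neg_iff_add_eq_zero.1 h1
  have h3 : (2 : ZMod p) ≠ 0 := by
    intro h3
    have : ((2 : ℕ) : ZMod p) = 0 := by exact_mod_cast h3
    rw [ZMod.natCast_eq_zero_iff] at this
    exact hp2 ((Nat.prime_dvd_prime_iff_eq hp.out Nat.prime_two).1 this)
  exact (smul_eq_zero_iff_right h3).1 h2

variable (B) in
/-- The total operation `x ↦ ∑ P i x * t ^ i`. -/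
noncomputable def totalP (x : B.carrier) : PowerSeries B.carrier :=
  PowerSeries.mk fun i => B.ops.P i x

theorem totalP_mul (x y : B.carrier) : B.totalP (x * y) = B.totalP x * B.totalP y := by
  ext n
  simp only [totalP, PowerSeries.coeff_mk, PowerSeries.coeff_mul, B.P_mul]

theorem totalP_one : B.totalP 1 = 1 := by
  ext n
  rw [totalP, PowerSeries.coeff_mk, PowerSeries.coeff_one]
  split_ifs with h
  · rw [h, B.P_zero]
  · exact B.P_one n (Nat.pos_of_ne_zero h)

theorem totalP_pow (x : B.carrier) (k : ℕ) : B.totalP (x ^ k) = B.totalP x ^ k := by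
  induction k with
  | zero => rw [pow_zero, pow_zero, totalP_one]
  | succ k ih => rw [pow_succ, pow_succ, totalP_mul, ih]

/-- The Cartan formula for a `p ^ k`-th power: in characteristic `p` only the terms in which all
factors carry the same operation survive. -/
theorem P_pow_prime_pow [hp : Fact p.Prime] {m : ℕ} (hm : IsEvenDeg p m) {x : B.carrier}
    (hx : x ∈ B.ops.deg m) (k n : ℕ) :
    B.ops.P n (x ^ p ^ k) = if p ^ k ∣ n then B.ops.P (n / p ^ k) x ^ p ^ k else 0 := by
  classical
  have hq : 0 < p ^ k := pow_pos hp.out.pos k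
  have hc : ∀ i (f : PowerSeries B.carrier),
      Commute (PowerSeries.monomial i (B.ops.P i x)) f := by
    intro i f
    ext j
    rw [PowerSeries.coeff_mul, PowerSeries.coeff_mul]
    refine Finset.sum_equiv (Equiv.prodComm ℕ ℕ) (by simp [add_comm]) fun ij _ => ?_
    rw [Equiv.prodComm_apply, Prod.fst_swap, Prod.snd_swap, PowerSeries.coeff_monomial]
    split_ifs
    · exact commute_of_isEvenDeg (hm.add_degP i) (B.P_mem i hx) _
    · rw [zero_mul, mul_zero]
  have hmon : ∀ (i j : ℕ) (a : B.carrier), (PowerSeries.monomial i a) ^ j =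
      PowerSeries.monomial (j * i) (a ^ j) := by
    intro i j a
    induction j with
    | zero => simp
    | succ j ih => rw [pow_succ, ih, PowerSeries.monomial_mul_monomial, pow_succ, Nat.succ_mul]
  set F : PowerSeries B.carrier :=
    ∑ i ∈ Finset.range (n + 1), PowerSeries.monomial i (B.ops.P i x) with hF
  set G : PowerSeries B.carrier := B.totalP x - F with hG
  have hGc : ∀ i ≤ n, PowerSeries.coeff i G = 0 := by
    intro i hi
    rw [hG, map_sub, hF, map_sum, Finset.sum_eq_single i, PowerSeries.coeff_monomial, if_pos rfl,
      totalP, PowerSeries.coeff_mk, sub_self]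
    · intro j _ hj; rw [PowerSeries.coeff_monomial, if_neg hj.symm]
    · intro hi'; exact absurd (Finset.mem_range.2 (Nat.lt_succ_of_le hi)) hi'
  have hGp : ∀ j, 0 < j → ∀ i ≤ n, PowerSeries.coeff i (G ^ j) = 0 := by
    intro j hj i hi
    obtain ⟨j, rfl⟩ := Nat.exists_eq_add_of_lt hj
    rw [zero_add, pow_succ, PowerSeries.coeff_mul]
    refine Finset.sum_eq_zero fun ab hab => ?_
    rw [Finset.HasAntidiagonal.mem_antidiagonal] at hab
    rw [hGc ab.2 (by omega), mul_zero]
  have hFG : Commute F G := Commute.sum_left _ _ _ fun i _ => hc i G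
  have key : PowerSeries.coeff n (B.totalP (x ^ p ^ k)) = PowerSeries.coeff n (F ^ p ^ k) := by
    have h2 : PowerSeries.coeff n ((F + G) ^ p ^ k) = PowerSeries.coeff n (F ^ p ^ k) := by
      rw [add_pow_prime_pow_of_commute hFG, map_add, hGp _ hq n le_rfl, add_zero]
    rwa [totalP_pow, ← show F + G = B.totalP x by rw [hG, add_sub_cancel]]
  rw [totalP, PowerSeries.coeff_mk] at key
  rw [key, hF, sum_pow_prime_pow _ _ (fun i _ j _ => hc i _), map_sum]
  simp only [hmon, PowerSeries.coeff_monomial]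
  split_ifs with hn
  · obtain ⟨j, rfl⟩ := hn
    rw [Nat.mul_div_cancel_left _ hq, Finset.sum_eq_single j]
    · rw [if_pos rfl]
    · intro i _ hij
      rw [if_neg]
      intro h
      exact hij (Nat.eq_of_mul_eq_mul_left hq h).symm
    · intro hj
      have : j ≤ p ^ k * j := Nat.le_mul_of_pos_left j hq
      exact absurd (Finset.mem_range.2 (by omega)) hj
  · exact Finset.sum_eq_zero fun i _ => if_neg fun h => hn ⟨i, h⟩

theorem β_pow_prime_pow [hp : Fact p.Prime] {m : ℕ} (hm : IsEvenDeg p m) {x : B.carrier}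
    (hx : x ∈ B.ops.deg m) {k : ℕ} (hk : 0 < k) : B.ops.β (x ^ p ^ k) = 0 := by
  have hc : ∀ y, Commute x y := commute_of_isEvenDeg hm hx
  have key : ∀ j, B.ops.β (x ^ (j + 1)) = (j + 1 : ℕ) • (x ^ j * B.ops.β x) := by
    intro j
    induction j with
    | zero => simp
    | succ j ih =>
      have h1 : B.ops.β (x * x ^ (j + 1)) =
          B.ops.β x * x ^ (j + 1) + x * B.ops.β (x ^ (j + 1)) := by
        rw [B.β_mul _ hx, hm.neg_one_pow, one_smul]
      rw [pow_succ', h1, ih, mul_smul_comm, ← mul_assoc, ← pow_succ',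
        ((hc (B.ops.β x)).pow_left (j + 1)).eq, succ_nsmul _ (j + 1), add_comm]
  have hq : 0 < p ^ k := pow_pos hp.out.pos k
  obtain ⟨j, hj⟩ : ∃ j, p ^ k = j + 1 := ⟨p ^ k - 1, by omega⟩
  rw [hj, key, ← hj, ← Nat.cast_smul_eq_nsmul (ZMod p)]
  rw [Nat.cast_pow, ZMod.natCast_self, zero_pow hk.ne', zero_smul]

end Even

/-! ### Words and monomials -/

section Mono

variable {B} {I : Type*} (g : I → B.Gen)

/-- The product of a word in a family of homogeneous elements. -/
def word (l : List I) : B.carrier := (l.map fun i => (g i).val).prod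

/-- The degree of a monomial in a family of homogeneous elements, given by its exponents. -/
noncomputable def monoDeg (e : I →₀ ℕ) : ℕ := e.sum fun i n => n * (g i).d

theorem monoDeg_add (e f : I →₀ ℕ) : monoDeg g (e + f) = monoDeg g e + monoDeg g f :=
  Finsupp.sum_add_index' (fun _ => zero_mul _) fun _ _ _ => add_mul _ _ _

theorem monoDeg_single (i : I) (n : ℕ) : monoDeg g (Finsupp.single i n) = n * (g i).d :=
  Finsupp.sum_single_index (zero_mul _)

theorem monoDeg_zero : monoDeg g 0 = 0 := Finsupp.sum_zero_index

theorem monoDeg_nsmul (n : ℕ) (e : I →₀ ℕ) : monoDeg g (n • e) = n * monoDeg g e := by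
  induction n with
  | zero => simp [monoDeg_zero]
  | succ n ih => rw [succ_nsmul, monoDeg_add, ih, Nat.succ_mul]

theorem monoDeg_eq_zero_iff {e : I →₀ ℕ} : monoDeg g e = 0 ↔ e = 0 := by
  refine ⟨fun h => ?_, fun h => by rw [h, monoDeg_zero]⟩
  ext i
  by_contra hi
  have h1 : e i * (g i).d = 0 := Finset.sum_eq_zero_iff.1 h i (Finsupp.mem_support_iff.2 hi)
  exact (mul_ne_zero hi (g i).pos.ne') h1

theorem word_cons (i : I) (l : List I) : word g (i :: l) = (g i).val * word g l := rfl
theorem word_append (l m : List I) : word g (l ++ m) = word g l * word g m := by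
  simp [word]
theorem word_replicate (n : ℕ) (i : I) : word g (List.replicate n i) = (g i).val ^ n := by
  simp [word]

theorem word_flatten (L : List (List I)) : word g L.flatten = (L.map (word g)).prod := by
  induction L with
  | nil => rfl
  | cons l L ih => rw [List.flatten_cons, word_append, ih, List.map_cons, List.prod_cons]

/-- Rearranging the factors changes a product by a sign only. -/
theorem word_perm [Fact p.Prime] {l m : List I} (h : l.Perm m) :
    ∃ c : ZMod p, c ≠ 0 ∧ word g l = c • word g m := by
  induction h with
  | nil => exact ⟨1, one_ne_zero, (one_smul _ _).symm⟩
  | cons x _ ih =>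
    obtain ⟨c, hc, h⟩ := ih
    exact ⟨c, hc, by rw [word_cons, word_cons, h, mul_smul_comm]⟩
  | swap x y l =>
    refine ⟨_, pow_ne_zero ((g y).d * (g x).d) (neg_ne_zero.2 one_ne_zero), ?_⟩
    rw [word_cons, word_cons, word_cons, word_cons, ← mul_assoc, ← mul_assoc,
      B.graded_comm (g y).mem (g x).mem, smul_mul_assoc]
  | trans _ _ h1 h2 =>
    obtain ⟨c, hc, h1⟩ := h1
    obtain ⟨d, hd, h2⟩ := h2
    exact ⟨c * d, mul_ne_zero hc hd, by rw [h1, h2, smul_smul]⟩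

variable [LinearOrder I]

/-- The monomial with given exponents, its factors in increasing order. -/
def mono (e : I →₀ ℕ) : B.carrier :=
  ((e.support.sort (· ≤ ·)).map fun i => (g i).val ^ e i).prod

theorem exists_word_eq_mono (e : I →₀ ℕ) :
    ∃ l : List I, (∀ i, l.count i = e i) ∧ word g l = mono g e := by
  refine ⟨((e.support.sort (· ≤ ·)).map fun i => List.replicate (e i) i).flatten, fun i => ?_, ?_⟩
  · rw [List.count_flatten, List.map_map]
    have : ((e.support.sort (· ≤ ·)).map (List.count i ∘ fun j => List.replicate (e j) j)) =
        (e.support.sort (· ≤ ·)).map fun j => if j = i then e j else 0 := by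
      refine List.map_congr_left fun j _ => ?_
      simp [List.count_replicate]
    rw [this, ← Multiset.sum_coe, ← Multiset.map_coe, Finset.sort_eq]
    change ∑ j ∈ e.support, (if j = i then e j else 0) = e i
    rw [Finset.sum_ite_eq']
    split_ifs with h
    · rfl
    · exact (Finsupp.notMem_support_iff.1 h).symm
  · rw [word_flatten, List.map_map, mono]
    congr 1
    exact List.map_congr_left fun i _ => word_replicate g (e i) i

theorem mono_zero : mono g (0 : I →₀ ℕ) = 1 := by simp [mono]

theorem mono_single (i : I) (n : ℕ) : mono g (Finsupp.single i n) = (g i).val ^ n := by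
  rcases Nat.eq_zero_or_pos n with rfl | hn
  · rw [Finsupp.single_zero, mono_zero, pow_zero]
  · have : (Finsupp.single i n).support = {i} := by
      ext j; simp [eq_comm, hn.ne']
    rw [mono, this]
    simp

variable [hp : Fact p.Prime]

/-- Words are monomials up to a sign. -/
theorem mono_eq_smul_word {e : I →₀ ℕ} {l : List I} (hl : ∀ i, l.count i = e i) :
    ∃ c : ZMod p, c ≠ 0 ∧ mono g e = c • word g l := by
  obtain ⟨m, hm, hme⟩ := exists_word_eq_mono g e
  rw [← hme]
  exact word_perm g (List.perm_iff_count.2 fun i => by rw [hl, hm])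

theorem mono_add (e f : I →₀ ℕ) :
    ∃ c : ZMod p, c ≠ 0 ∧ mono g (e + f) = c • (mono g e * mono g f) := by
  obtain ⟨l, hl, hle⟩ := exists_word_eq_mono g e
  obtain ⟨m, hm, hme⟩ := exists_word_eq_mono g f
  rw [← hle, ← hme, ← word_append]
  exact mono_eq_smul_word g fun i => by rw [List.count_append, hl, hm]; rfl

theorem mono_nsmul (n : ℕ) (e : I →₀ ℕ) :
    ∃ c : ZMod p, c ≠ 0 ∧ mono g (n • e) = c • mono g e ^ n := by
  induction n with
  | zero => exact ⟨1, one_ne_zero, by rw [zero_smul, mono_zero, pow_zero, one_smul]⟩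
  | succ n ih =>
    obtain ⟨c, hc, h⟩ := ih
    obtain ⟨d, hd, h'⟩ := mono_add g (n • e) e
    exact ⟨d * c, mul_ne_zero hd hc, by
      rw [succ_nsmul, h', h, pow_succ, smul_mul_assoc, smul_smul]⟩

theorem mono_mem (e : I →₀ ℕ) : mono g e ∈ B.ops.deg (monoDeg g e) := by
  induction e using Finsupp.induction with
  | zero => rw [mono_zero, monoDeg_zero]; exact B.one_mem_deg
  | single_add i n e hi hn ih =>
    obtain ⟨c, -, h⟩ := mono_add g (Finsupp.single i n) e
    rw [h, monoDeg_add, mono_single, monoDeg_single]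
    exact Submodule.smul_mem _ _ (B.mul_mem_deg (B.pow_mem_deg (g i).mem n) ih)

theorem mono_eq_zero_of_pow {e : I →₀ ℕ} {i : I} {m : ℕ} (hm : m ≤ e i) (h : (g i).val ^ m = 0) :
    mono g e = 0 := by
  obtain ⟨n, hn⟩ := Nat.exists_eq_add_of_le' hm
  have he : e = Finsupp.single i (e i) + e.erase i := (Finsupp.single_add_erase i e).symm
  obtain ⟨c, -, hc⟩ := mono_add g (Finsupp.single i (e i)) (e.erase i)
  rw [he, hc, mono_single, hn, pow_add, h, mul_zero, zero_mul, smul_zero]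

end Mono

end SteenrodCAlg

/-! ### The augmentation ideal and the indecomposables -/

namespace SteenrodCAlg

section Indecomposables

variable {p : ℕ} (B : SteenrodCAlg.{u} p)

theorem augIdeal_homogeneous : IsHomogeneousSub B.isInternal B.augIdeal :=
  isHomogeneousSub_span _ fun _ ⟨n, _, hx⟩ => ⟨n, hx⟩

theorem mem_augIdeal_of_deg {n : ℕ} (hn : 0 < n) {x : B.carrier} (hx : x ∈ B.ops.deg n) :
    x ∈ B.augIdeal := Submodule.subset_span ⟨n, hn, hx⟩

theorem mem_augIdeal_iff {x : B.carrier} : x ∈ B.augIdeal ↔ degProj B.isInternal 0 x = 0 := by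
  constructor
  · intro hx
    induction hx using Submodule.span_induction with
    | mem a ha =>
      obtain ⟨n, hn, ha⟩ := ha
      exact degProj_of_mem_ne _ hn.ne' ha
    | zero => exact map_zero _
    | add x y _ _ h1 h2 => rw [map_add, h1, h2, add_zero]
    | smul c x _ h => rw [map_smul, h, smul_zero]
  · intro hx
    refine mem_of_degProj_mem B.isInternal fun n => ?_
    rcases Nat.eq_zero_or_pos n with rfl | hn
    · rw [hx]; exact zero_mem _
    · exact B.mem_augIdeal_of_deg hn (degProj_mem _ n x)

/-- The augmentation ideal is an ideal. -/
theorem mul_mem_augIdeal {x : B.carrier} (y : B.carrier) (hx : x ∈ B.augIdeal) :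
    x * y ∈ B.augIdeal := by
  induction hx using Submodule.span_induction with
  | mem a ha =>
    obtain ⟨n, hn, ha⟩ := ha
    induction y using homogeneous_induction B.isInternal with
    | zero => rw [mul_zero]; exact zero_mem _
    | add y z h1 h2 => rw [mul_add]; exact add_mem h1 h2
    | mem m y hy => exact B.mem_augIdeal_of_deg (Nat.add_pos_left hn m) (B.mul_mem_deg ha hy)
  | zero => rw [zero_mul]; exact zero_mem _
  | add x z _ _ h1 h2 => rw [add_mul]; exact add_mem h1 h2
  | smul c x _ h => rw [smul_mul_assoc]; exact Submodule.smul_mem _ c h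

/-- The decomposable elements, as a subspace of the algebra. -/
def decSub : Submodule (ZMod p) B.carrier :=
  Submodule.span (ZMod p) {z : B.carrier | ∃ x ∈ B.augIdeal, ∃ y ∈ B.augIdeal, x * y = z}

theorem mul_mem_decSub {x y : B.carrier} (hx : x ∈ B.augIdeal) (hy : y ∈ B.augIdeal) :
    x * y ∈ B.decSub := Submodule.subset_span ⟨x, hx, y, hy, rfl⟩

theorem mem_decSub_iff (x : B.augIdeal) : x ∈ B.decomposables ↔ (x : B.carrier) ∈ B.decSub :=
  Iff.rfl

/-- Decomposable elements are sums of products of homogeneous elements of positive degree. -/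
theorem decSub_eq : B.decSub = Submodule.span (ZMod p) {z : B.carrier | ∃ i j : ℕ, 0 < i ∧ 0 < j ∧
    ∃ x ∈ B.ops.deg i, ∃ y ∈ B.ops.deg j, x * y = z} := by
  apply le_antisymm
  · refine Submodule.span_le.2 ?_
    rintro _ ⟨x, hx, y, hy, rfl⟩
    induction hx using Submodule.span_induction with
    | mem a ha =>
      obtain ⟨n, hn, ha⟩ := ha
      induction hy using Submodule.span_induction with
      | mem b hb =>
        obtain ⟨m, hm, hb⟩ := hb
        exact Submodule.subset_span ⟨n, m, hn, hm, a, ha, b, hb, rfl⟩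
      | zero => rw [mul_zero]; exact zero_mem _
      | add y z _ _ h1 h2 => rw [mul_add]; exact add_mem h1 h2
      | smul c y _ h => rw [mul_smul_comm]; exact Submodule.smul_mem _ c h
    | zero => rw [zero_mul]; exact zero_mem _
    | add x z _ _ h1 h2 => rw [add_mul]; exact add_mem h1 h2
    | smul c x _ h => rw [smul_mul_assoc]; exact Submodule.smul_mem _ c h
  · refine Submodule.span_le.2 ?_
    rintro _ ⟨i, j, hi, hj, x, hx, y, hy, rfl⟩
    exact B.mul_mem_decSub (B.mem_augIdeal_of_deg hi hx) (B.mem_augIdeal_of_deg hj hy)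

theorem decSub_homogeneous : IsHomogeneousSub B.isInternal B.decSub := by
  rw [decSub_eq]
  refine isHomogeneousSub_span _ ?_
  rintro _ ⟨i, j, hi, hj, x, hx, y, hy, rfl⟩
  exact ⟨_, B.mul_mem_deg hx hy⟩

theorem decSub_le_augIdeal : B.decSub ≤ B.augIdeal := by
  refine Submodule.span_le.2 ?_
  rintro _ ⟨x, hx, y, -, rfl⟩
  exact B.mul_mem_augIdeal y hx

/-- A homogeneous decomposable element is a sum of products of elements of smaller degree. -/
theorem decSub_deg {n : ℕ} {x : B.carrier} (hx : x ∈ B.decSub) (hn : x ∈ B.ops.deg n) :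
    x ∈ Submodule.span (ZMod p) {z : B.carrier | ∃ i j : ℕ, 0 < i ∧ 0 < j ∧ i + j = n ∧
      ∃ x ∈ B.ops.deg i, ∃ y ∈ B.ops.deg j, x * y = z} := by
  rw [← degProj_of_mem B.isInternal hn]
  clear hn
  rw [decSub_eq] at hx
  induction hx using Submodule.span_induction with
  | mem z hz =>
    obtain ⟨i, j, hi, hj, x, hx, y, hy, rfl⟩ := hz
    rw [degProj_of_mem_ite _ (B.mul_mem_deg hx hy)]
    split_ifs with h
    · exact Submodule.subset_span ⟨i, j, hi, hj, h, x, hx, y, hy, rfl⟩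
    · exact zero_mem _
  | zero => rw [map_zero]; exact zero_mem _
  | add x z _ _ h1 h2 => rw [map_add]; exact add_mem h1 h2
  | smul c x _ h => rw [map_smul]; exact Submodule.smul_mem _ c h

/-- The projection of the algebra onto its augmentation ideal. -/
noncomputable def augProj : B.carrier →ₗ[ZMod p] B.augIdeal :=
  (LinearMap.id - degProj B.isInternal 0).codRestrict B.augIdeal fun x => by
    rw [mem_augIdeal_iff, LinearMap.sub_apply, LinearMap.id_apply, map_sub,
      degProj_of_mem _ (degProj_mem _ 0 x), sub_self]

theorem augProj_of_mem {x : B.carrier} (hx : x ∈ B.augIdeal) : B.augProj x = ⟨x, hx⟩ := by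
  apply Subtype.ext
  change x - degProj B.isInternal 0 x = x
  rw [B.mem_augIdeal_iff.1 hx, sub_zero]

/-- The class in `QB` of the part of positive degree of an element. -/
noncomputable def toQ : B.carrier →ₗ[ZMod p] B.Indec := B.decomposables.mkQ ∘ₗ B.augProj

theorem toQ_of_mem {x : B.carrier} (hx : x ∈ B.augIdeal) :
    B.toQ x = B.decomposables.mkQ ⟨x, hx⟩ := by
  rw [toQ, LinearMap.comp_apply, augProj_of_mem _ hx]

theorem toQ_val (x : B.Gen) : B.toQ x.val = x.toIndec := B.toQ_of_mem x.mem_augIdeal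

theorem toQ_eq_zero_iff {x : B.carrier} (hx : x ∈ B.augIdeal) : B.toQ x = 0 ↔ x ∈ B.decSub := by
  rw [toQ_of_mem _ hx]
  exact Submodule.Quotient.mk_eq_zero _

theorem toQ_of_mem_decSub {x : B.carrier} (hx : x ∈ B.decSub) : B.toQ x = 0 :=
  (B.toQ_eq_zero_iff (B.decSub_le_augIdeal hx)).2 hx

theorem toQ_of_deg_zero {x : B.carrier} (hx : x ∈ B.ops.deg 0) : B.toQ x = 0 := by
  have : B.augProj x = 0 := Subtype.ext (by
    change x - degProj B.isInternal 0 x = 0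
    rw [degProj_of_mem _ hx, sub_self])
  rw [toQ, LinearMap.comp_apply, this, map_zero]

theorem exists_toQ (v : B.Indec) : ∃ x ∈ B.augIdeal, B.toQ x = v := by
  obtain ⟨x, rfl⟩ := B.decomposables.mkQ_surjective v
  exact ⟨x, x.2, B.toQ_of_mem x.2⟩

theorem decomposables_homogeneous :
    IsHomogeneousSub (isInternal_sub B.isInternal B.augIdeal_homogeneous) B.decomposables := by
  intro n x hx
  rw [mem_decSub_iff, degProj_sub B.isInternal B.augIdeal_homogeneous]
  exact B.decSub_homogeneous n _ hx

theorem indec_isInternal : DirectSum.IsInternal B.indecOps.deg :=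
  isInternal_quot (isInternal_sub B.isInternal B.augIdeal_homogeneous) B.decomposables_homogeneous

theorem toQ_mem_deg {n : ℕ} {x : B.carrier} (hx : x ∈ B.ops.deg n) :
    B.toQ x ∈ B.indecOps.deg n := by
  rcases Nat.eq_zero_or_pos n with rfl | hn
  · rw [B.toQ_of_deg_zero hx]; exact zero_mem _
  · rw [B.toQ_of_mem (B.mem_augIdeal_of_deg hn hx)]
    exact ⟨_, hx, rfl⟩

theorem exists_toQ_of_deg {n : ℕ} {v : B.Indec} (hv : v ∈ B.indecOps.deg n) :
    ∃ x ∈ B.ops.deg n, x ∈ B.augIdeal ∧ B.toQ x = v := by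
  obtain ⟨x, hx, rfl⟩ := hv
  exact ⟨x, hx, x.2, B.toQ_of_mem x.2⟩

theorem degProj_toQ (n : ℕ) (x : B.carrier) :
    degProj B.indec_isInternal n (B.toQ x) = B.toQ (degProj B.isInternal n x) :=
  degProj_map B.isInternal B.indec_isInternal B.toQ id Function.injective_id
    (fun _ _ hx => B.toQ_mem_deg hx) n x

theorem toQ_P (i : ℕ) (x : B.carrier) : B.toQ (B.ops.P i x) = B.indecOps.P i (B.toQ x) := by
  induction x using homogeneous_induction B.isInternal with
  | zero => simp only [map_zero]
  | add x y h1 h2 => simp only [map_add, h1, h2]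
  | mem n x hx =>
    rcases Nat.eq_zero_or_pos n with rfl | hn
    · rw [B.toQ_of_deg_zero hx, map_zero]
      rw [B.connected] at hx
      obtain ⟨c, rfl⟩ := Submodule.mem_span_singleton.1 hx
      rcases Nat.eq_zero_or_pos i with rfl | hi
      · rw [B.P_zero]; exact B.toQ_of_deg_zero (Submodule.smul_mem _ _ B.one_mem_deg)
      · rw [map_smul, B.P_one i hi, smul_zero, map_zero]
    · have h1 := B.mem_augIdeal_of_deg hn hx
      rw [B.toQ_of_mem h1, B.toQ_of_mem (B.augIdeal_stable.1 i x h1)]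
      rfl

theorem toQ_β (x : B.carrier) : B.toQ (B.ops.β x) = B.indecOps.β (B.toQ x) := by
  induction x using homogeneous_induction B.isInternal with
  | zero => simp only [map_zero]
  | add x y h1 h2 => simp only [map_add, h1, h2]
  | mem n x hx =>
    rcases Nat.eq_zero_or_pos n with rfl | hn
    · rw [B.toQ_of_deg_zero hx, map_zero]
      rw [B.connected] at hx
      obtain ⟨c, rfl⟩ := Submodule.mem_span_singleton.1 hx
      rw [map_smul, B.β_one, smul_zero, map_zero]
    · have h1 := B.mem_augIdeal_of_deg hn hx
      rw [B.toQ_of_mem h1, B.toQ_of_mem (B.augIdeal_stable.2 x h1)]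
      rfl

theorem mapIndec_toQ {B C : SteenrodCAlg.{u} p} (f : Hom B C) (x : B.carrier) :
    f.mapIndec (B.toQ x) = C.toQ (f.toAlgHom x) := by
  induction x using homogeneous_induction B.isInternal with
  | zero => simp only [map_zero]
  | add x y h1 h2 => simp only [map_add, h1, h2]
  | mem n x hx =>
    rcases Nat.eq_zero_or_pos n with rfl | hn
    · rw [B.toQ_of_deg_zero hx, map_zero, C.toQ_of_deg_zero (f.map_deg hx)]
    · have h1 := B.mem_augIdeal_of_deg hn hx
      rw [B.toQ_of_mem h1]
      exact (C.toQ_of_mem (f.map_augIdeal x h1)).symm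

/-- The indecomposables of an unstable algebra form an unstable module. -/
theorem IsUnstable.indec {B : SteenrodCAlg.{u} p} (h : B.IsUnstable) : B.indecOps.IsUnstable :=
  (h.isUnstable.sub B.augIdeal_stable B.augIdeal_homogeneous).quot B.decomposables_stable
    B.decomposables_homogeneous

/-- If an algebra is generated by finitely many elements over the Steenrod algebra, then so are its
indecomposables. -/
theorem FG.indec {B : SteenrodCAlg.{u} p} (h : B.FG) : B.indecOps.FG := by
  obtain ⟨s, hs, h⟩ := h
  refine ⟨B.toQ '' s, hs.image _, ?_⟩
  set M := B.indecOps.span (B.toQ '' s) with hM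
  have hst := B.indecOps.span_stable (B.toQ '' s)
  have hmul : ∀ x y, B.toQ x ∈ M → B.toQ y ∈ M → B.toQ (x * y) ∈ M := by
    have h0 : ∀ x, ∃ c : ZMod p, x - c • (1 : B.carrier) ∈ B.augIdeal := by
      intro x
      have h1 := degProj_mem B.isInternal 0 x
      rw [B.connected] at h1
      obtain ⟨c, hc⟩ := Submodule.mem_span_singleton.1 h1
      refine ⟨c, ?_⟩
      rw [mem_augIdeal_iff, hc, map_sub, degProj_of_mem _ (degProj_mem _ 0 x), sub_self]
    intro x y hx hy
    obtain ⟨c, hc⟩ := h0 x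
    obtain ⟨d, hd⟩ := h0 y
    have e : x * y = (x - c • 1) * (y - d • 1) + c • y + d • x - (c * d) • (1 : B.carrier) := by
      simp only [sub_mul, mul_sub, smul_mul_assoc, mul_smul_comm, one_mul, mul_one, smul_sub,
        smul_smul]
      rw [mul_comm d c]
      abel
    rw [e, map_sub, map_add, map_add, B.toQ_of_mem_decSub (B.mul_mem_decSub hc hd), map_smul,
      map_smul, map_smul, B.toQ_of_deg_zero B.one_mem_deg, smul_zero, sub_zero, zero_add]
    exact add_mem (M.smul_mem c hy) (M.smul_mem d hx)
  let W : Subalgebra (ZMod p) B.carrier :=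
    { carrier := {x | B.toQ x ∈ M}
      mul_mem' := fun {x y} hx hy => hmul x y hx hy
      add_mem' := fun {x y} hx hy => by
        change B.toQ (x + y) ∈ M
        rw [map_add]; exact add_mem hx hy
      algebraMap_mem' := fun c => by
        change B.toQ (algebraMap _ _ c) ∈ M
        rw [Algebra.algebraMap_eq_smul_one, map_smul, B.toQ_of_deg_zero B.one_mem_deg, smul_zero]
        exact zero_mem _ }
  have hW : W = ⊤ := by
    refine h W (fun x hx => B.indecOps.subset_span _ ⟨x, hx, rfl⟩)
      ⟨fun i x hx => ?_, fun x hx => ?_⟩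
    · change B.toQ _ ∈ M
      rw [toQ_P]; exact hst.1 i _ hx
    · change B.toQ _ ∈ M
      rw [toQ_β]; exact hst.2 _ hx
  rw [eq_top_iff]
  rintro v -
  obtain ⟨x, -, rfl⟩ := B.exists_toQ v
  have : x ∈ W := by rw [hW]; trivial
  exact this

end Indecomposables

end SteenrodCAlg

/-! ### Chains in low degrees, and the computation of `H_0` -/

namespace SteenrodCAlg

section Chains

variable {p : ℕ} (B : SteenrodCAlg.{u} p)

theorem mapIndec_mem_deg {B C : SteenrodCAlg.{u} p} (f : Hom B C) {n : ℕ} {v : B.Indec}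
    (hv : v ∈ B.indecOps.deg n) : f.mapIndec v ∈ C.indecOps.deg n := by
  obtain ⟨x, hx, -, rfl⟩ := B.exists_toQ_of_deg hv
  rw [mapIndec_toQ]
  exact C.toQ_mem_deg (f.map_deg hx)

/-- The linear map `x ↦ [x]` from `B` to `S(B)`, extended by zero on the degree zero part. -/
noncomputable def genLin : B.carrier →ₗ[ZMod p] B.sym.carrier :=
  degLift B.isInternal fun n =>
    if hn : 0 < n then
      { toFun := fun x => B.symι ⟨n, x, hn, x.2⟩
        map_add' := fun x y => B.symι_add n hn x y x.2 y.2
        map_smul' := fun c x => B.symι_smul n hn c x x.2 }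
    else 0

theorem genLin_val (x : B.Gen) : B.genLin x.val = B.symι x := by
  rw [genLin, degLift_of_mem _ _ x.mem, dif_pos x.pos]
  rfl

theorem genLin_of_deg_zero {x : B.carrier} (hx : x ∈ B.ops.deg 0) : B.genLin x = 0 := by
  rw [genLin, degLift_of_mem _ _ hx, dif_neg (lt_irrefl 0)]
  rfl

theorem genLin_mem_deg {n : ℕ} {x : B.carrier} (hx : x ∈ B.ops.deg n) :
    B.genLin x ∈ B.sym.ops.deg n := by
  rcases Nat.eq_zero_or_pos n with rfl | hn
  · rw [B.genLin_of_deg_zero hx]; exact zero_mem _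
  · rw [B.genLin_val ⟨n, x, hn, hx⟩]; exact B.symι_mem ⟨n, x, hn, hx⟩

theorem genLin_mem_augIdeal (x : B.carrier) : B.genLin x ∈ B.sym.augIdeal := by
  induction x using homogeneous_induction B.isInternal with
  | zero => rw [map_zero]; exact zero_mem _
  | add x y h1 h2 => rw [map_add]; exact add_mem h1 h2
  | mem n x hx =>
    rcases Nat.eq_zero_or_pos n with rfl | hn
    · rw [B.genLin_of_deg_zero hx]; exact zero_mem _
    · exact B.sym.mem_augIdeal_of_deg hn (B.genLin_mem_deg hx)

theorem counit_genLin {x : B.carrier} (hx : x ∈ B.augIdeal) :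
    B.counit.toAlgHom (B.genLin x) = x := by
  induction hx using Submodule.span_induction with
  | mem a ha =>
    obtain ⟨n, hn, ha⟩ := ha
    rw [B.genLin_val ⟨n, a, hn, ha⟩]; exact counit_ι _
  | zero => rw [map_zero, map_zero]
  | add x y _ _ h1 h2 => rw [map_add, map_add, h1, h2]
  | smul c x _ h => rw [map_smul, map_smul, h]

theorem toQ_counit_genLin (x : B.carrier) : B.toQ (B.counit.toAlgHom (B.genLin x)) = B.toQ x := by
  induction x using homogeneous_induction B.isInternal with
  | zero => simp only [map_zero]
  | add x y h1 h2 => simp only [map_add, h1, h2]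
  | mem n x hx =>
    rcases Nat.eq_zero_or_pos n with rfl | hn
    · rw [B.genLin_of_deg_zero hx, map_zero, map_zero, B.toQ_of_deg_zero hx]
    · rw [B.counit_genLin (B.mem_augIdeal_of_deg hn hx)]

theorem symMap_genLin {B C : SteenrodCAlg.{u} p} (f : Hom B C) (x : B.carrier) :
    (symMap f).toAlgHom (B.genLin x) = C.genLin (f.toAlgHom x) := by
  induction x using homogeneous_induction B.isInternal with
  | zero => simp only [map_zero]
  | add x y h1 h2 => simp only [map_add, h1, h2]
  | mem n x hx =>
    rcases Nat.eq_zero_or_pos n with rfl | hn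
    · rw [B.genLin_of_deg_zero hx, map_zero, C.genLin_of_deg_zero (f.map_deg hx)]
    · rw [B.genLin_val ⟨n, x, hn, hx⟩, C.genLin_val ⟨n, f.toAlgHom x, hn, f.map_deg hx⟩]
      exact symMap_ι f _

theorem genLin_P (i : ℕ) (x : B.carrier) :
    B.genLin (B.ops.P i x) = B.sym.ops.P i (B.genLin x) := by
  induction x using homogeneous_induction B.isInternal with
  | zero => simp only [map_zero]
  | add x y h1 h2 => simp only [map_add, h1, h2]
  | mem n x hx =>
    rcases Nat.eq_zero_or_pos n with rfl | hn
    · rw [B.genLin_of_deg_zero hx, map_zero]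
      rw [B.connected] at hx
      obtain ⟨c, rfl⟩ := Submodule.mem_span_singleton.1 hx
      rcases Nat.eq_zero_or_pos i with rfl | hi
      · rw [B.P_zero]; exact B.genLin_of_deg_zero (Submodule.smul_mem _ _ B.one_mem_deg)
      · rw [map_smul, B.P_one i hi, smul_zero, map_zero]
    · rw [B.genLin_val ⟨n, x, hn, hx⟩]
      exact (B.genLin_val (Gen.P i ⟨n, x, hn, hx⟩)).trans (B.symP_ι i _).symm

theorem genLin_β (x : B.carrier) : B.genLin (B.ops.β x) = B.sym.ops.β (B.genLin x) := by
  induction x using homogeneous_induction B.isInternal with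
  | zero => simp only [map_zero]
  | add x y h1 h2 => simp only [map_add, h1, h2]
  | mem n x hx =>
    rcases Nat.eq_zero_or_pos n with rfl | hn
    · rw [B.genLin_of_deg_zero hx, map_zero]
      rw [B.connected] at hx
      obtain ⟨c, rfl⟩ := Submodule.mem_span_singleton.1 hx
      rw [map_smul, B.β_one, smul_zero, map_zero]
    · rw [B.genLin_val ⟨n, x, hn, hx⟩]
      exact (B.genLin_val (Gen.β ⟨n, x, hn, hx⟩)).trans (B.symβ_ι _).symm

theorem symWord_mem_augIdeal (x : B.Gen) (l : List B.Gen) :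
    B.symWord (x :: l) ∈ B.sym.augIdeal := by
  refine B.sym.mem_augIdeal_of_deg ?_ (B.symWord_mem (x :: l))
  rw [wordDeg_cons]
  exact Nat.add_pos_left x.pos _

/-- The indecomposables of a free graded commutative algebra are spanned by the generators. -/
theorem exists_toQ_genLin (c : B.sym.Indec) : ∃ b ∈ B.augIdeal, B.sym.toQ (B.genLin b) = c := by
  obtain ⟨s, -, rfl⟩ := B.sym.exists_toQ c
  have hs : s ∈ Submodule.span (ZMod p) (Set.range B.symWord) := by rw [B.sym_span]; trivial
  induction hs using Submodule.span_induction with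
  | mem s hs =>
    obtain ⟨l, rfl⟩ := hs
    match l with
    | [] =>
      refine ⟨0, zero_mem _, ?_⟩
      rw [map_zero, map_zero]
      exact (B.sym.toQ_of_deg_zero B.sym.one_mem_deg).symm
    | [x] =>
      refine ⟨x.val, x.mem_augIdeal, ?_⟩
      rw [B.genLin_val, symWord_cons, symWord_nil, mul_one]
    | x :: y :: l =>
      refine ⟨0, zero_mem _, ?_⟩
      rw [map_zero, map_zero, symWord_cons]
      exact (B.sym.toQ_of_mem_decSub
        (B.sym.mul_mem_decSub x.unit.mem_augIdeal (B.symWord_mem_augIdeal y l))).symm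
  | zero => exact ⟨0, zero_mem _, congrArg B.sym.toQ (map_zero B.genLin)⟩
  | add x y _ _ h1 h2 =>
    obtain ⟨a, ha, h1⟩ := h1
    obtain ⟨b, hb, h2⟩ := h2
    exact ⟨a + b, add_mem ha hb, by rw [map_add, map_add, h1, h2, map_add]⟩
  | smul c x _ h =>
    obtain ⟨a, ha, h⟩ := h
    exact ⟨c • a, Submodule.smul_mem _ c ha, by rw [map_smul, map_smul, h, map_smul]⟩

end Chains

section LowDegrees

variable {p : ℕ} (A : SteenrodCAlg.{u} p)

/-- The differential `aqD 0`, with source and target in terms of the iterates `S(S(A))`, `S(A)`. -/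
noncomputable def dOne : A.sym.sym.Indec →ₗ[ZMod p] A.sym.Indec := A.aqD 0

/-- The differential `aqD 1`, with source and target in terms of the iterates of `S`. -/
noncomputable def dTwo : A.sym.sym.sym.Indec →ₗ[ZMod p] A.sym.sym.Indec := A.aqD 1

/-- The `1`-chain `[s]` given by an element `s` of `S(A)`. -/
noncomputable def chain : A.sym.carrier →ₗ[ZMod p] A.sym.sym.Indec := A.sym.sym.toQ ∘ₗ A.sym.genLin

theorem chain_val (s : A.sym.Gen) : A.chain s.val = s.toChain := by
  rw [chain, LinearMap.comp_apply, A.sym.genLin_val]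
  exact A.sym.sym.toQ_val s.unit

theorem chain_mem_deg {n : ℕ} {s : A.sym.carrier} (hs : s ∈ A.sym.ops.deg n) :
    A.chain s ∈ A.sym.sym.indecOps.deg n :=
  A.sym.sym.toQ_mem_deg (A.sym.genLin_mem_deg hs)

theorem degProj_chain (n : ℕ) (s : A.sym.carrier) :
    degProj A.sym.sym.indec_isInternal n (A.chain s) = A.chain (degProj A.sym.isInternal n s) :=
  degProj_map A.sym.isInternal A.sym.sym.indec_isInternal A.chain id
    Function.injective_id (fun _ _ hx => A.chain_mem_deg hx) n s

theorem chain_P (i : ℕ) (s : A.sym.carrier) :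
    A.chain (A.sym.ops.P i s) = A.sym.sym.indecOps.P i (A.chain s) := by
  rw [chain, LinearMap.comp_apply, genLin_P]
  exact A.sym.sym.toQ_P i _

theorem chain_β (s : A.sym.carrier) :
    A.chain (A.sym.ops.β s) = A.sym.sym.indecOps.β (A.chain s) := by
  rw [chain, LinearMap.comp_apply, genLin_β]
  exact A.sym.sym.toQ_β _

theorem dOne_chain (s : A.sym.carrier) : A.dOne (A.chain s) =
    A.sym.toQ s - A.sym.toQ (A.genLin (A.counit.toAlgHom s)) := by
  induction s using homogeneous_induction A.sym.isInternal with
  | zero => simp only [map_zero, sub_zero]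
  | add x y h1 h2 => simp only [map_add, h1, h2, add_sub_add_comm]
  | mem n x hx =>
    rcases Nat.eq_zero_or_pos n with rfl | hn
    · rw [A.genLin_of_deg_zero (A.counit.map_deg hx), map_zero, A.sym.toQ_of_deg_zero hx, sub_zero,
        chain, LinearMap.comp_apply, A.sym.genLin_of_deg_zero hx, map_zero, map_zero]
    · have h := aqD_zero_toChain (A := A) (⟨n, x, hn, hx⟩ : A.sym.Gen)
      rw [← chain_val] at h
      refine h.trans ?_
      refine (congrArg₂ (· - ·) (A.sym.toQ_val _).symm (A.sym.toQ_val _).symm).trans ?_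
      exact congrArg (fun z => A.sym.toQ x - A.sym.toQ z)
        (A.genLin_val (Gen.map A.counit ⟨n, x, hn, hx⟩)).symm

theorem dTwo_eq : A.dTwo = A.sym.sym.counit.mapIndec - (symMap A.sym.counit).mapIndec +
    (symMap (symMap A.counit)).mapIndec := by
  have e : A.dTwo = ∑ i : Fin 3, (-1 : ZMod p) ^ (i : ℕ) •
      (show A.sym.sym.sym.Indec →ₗ[ZMod p] A.sym.sym.Indec from (A.face 2 i).mapIndec) := rfl
  rw [e, Fin.sum_univ_three]
  have h3 : ∀ (V : Type u) [AddCommGroup V] [Module (ZMod p) V] (a b c : V),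
      (-1 : ZMod p) ^ ((0 : Fin 3) : ℕ) • a + (-1 : ZMod p) ^ ((1 : Fin 3) : ℕ) • b +
        (-1 : ZMod p) ^ ((2 : Fin 3) : ℕ) • c = a - b + c := by
    intro V _ _ a b c
    simp [sub_eq_add_neg]
  exact h3 _ _ _ _

theorem dTwo_toQ_genLin (w : A.sym.sym.carrier) :
    A.dTwo (A.sym.sym.sym.toQ (A.sym.sym.genLin w)) = A.sym.sym.toQ w -
      A.chain (A.sym.counit.toAlgHom w) + A.chain ((symMap A.counit).toAlgHom w) := by
  have h0 : A.sym.sym.counit.mapIndec (A.sym.sym.sym.toQ (A.sym.sym.genLin w)) = A.sym.sym.toQ w :=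
    (mapIndec_toQ A.sym.sym.counit _).trans (A.sym.sym.toQ_counit_genLin w)
  have h1 : (symMap A.sym.counit).mapIndec (A.sym.sym.sym.toQ (A.sym.sym.genLin w)) =
      A.chain (A.sym.counit.toAlgHom w) :=
    (mapIndec_toQ (symMap A.sym.counit) _).trans
      (congrArg A.sym.sym.toQ (symMap_genLin A.sym.counit w))
  have h2 : (symMap (symMap A.counit)).mapIndec (A.sym.sym.sym.toQ (A.sym.sym.genLin w)) =
      A.chain ((symMap A.counit).toAlgHom w) :=
    (mapIndec_toQ (symMap (symMap A.counit)) _).trans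
      (congrArg A.sym.sym.toQ (symMap_genLin (symMap A.counit) w))
  rw [dTwo_eq, LinearMap.add_apply, LinearMap.sub_apply, h0, h1, h2]

/-- The `1`-chains `[[a]]` are boundaries. -/
theorem chain_genLin_mem_boundaries (a : A.carrier) :
    A.chain (A.genLin a) ∈ LinearMap.range A.dTwo := by
  induction a using homogeneous_induction A.isInternal with
  | zero => rw [map_zero, map_zero]; exact zero_mem _
  | add x y h1 h2 => rw [map_add, map_add]; exact add_mem h1 h2
  | mem n a ha =>
    rcases Nat.eq_zero_or_pos n with rfl | hn
    · rw [A.genLin_of_deg_zero ha, map_zero]; exact zero_mem _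
    · have h := A.dTwo_toQ_genLin (A.sym.genLin (A.genLin a))
      rw [symMap_genLin, A.counit_genLin (A.mem_augIdeal_of_deg hn ha),
        A.sym.counit_genLin (A.genLin_mem_augIdeal a)] at h
      exact ⟨_, h.trans ((congrArg (· + _) (sub_self _)).trans (zero_add _))⟩

/-- Modulo boundaries, the class of a product only depends on the images of the factors in `A`. -/
theorem chain_mul_sub_mem_boundaries {s t : A.sym.carrier} (hs : s ∈ A.sym.augIdeal)
    (ht : t ∈ A.sym.augIdeal) :
    A.chain (s * t) - A.chain (A.genLin (A.counit.toAlgHom s) * A.genLin (A.counit.toAlgHom t)) ∈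
      LinearMap.range A.dTwo := by
  have h := A.dTwo_toQ_genLin (A.sym.genLin s * A.sym.genLin t)
  rw [map_mul A.sym.counit.toAlgHom, map_mul (symMap A.counit).toAlgHom, A.sym.counit_genLin hs,
    A.sym.counit_genLin ht, symMap_genLin, symMap_genLin, A.sym.sym.toQ_of_mem_decSub (A.sym.sym.mul_mem_decSub
      (A.sym.genLin_mem_augIdeal s) (A.sym.genLin_mem_augIdeal t)), zero_sub, neg_add_eq_sub] at h
  rw [← Submodule.neg_mem_iff, neg_sub]
  exact ⟨_, h⟩

theorem chain_mul_mem_boundaries_right {s t : A.sym.carrier} (hs : s ∈ A.sym.augIdeal)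
    (ht : t ∈ A.sym.augIdeal) (h : A.counit.toAlgHom t = 0) :
    A.chain (s * t) ∈ LinearMap.range A.dTwo := by
  have := A.chain_mul_sub_mem_boundaries hs ht
  rwa [h, map_zero, mul_zero, map_zero, sub_zero] at this

theorem chain_mul_mem_boundaries_left {s t : A.sym.carrier} (hs : s ∈ A.sym.augIdeal)
    (ht : t ∈ A.sym.augIdeal) (h : A.counit.toAlgHom s = 0) :
    A.chain (s * t) ∈ LinearMap.range A.dTwo := by
  have := A.chain_mul_sub_mem_boundaries hs ht
  rwa [h, map_zero, zero_mul, map_zero, sub_zero] at this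

/-- Exactness of the complex at `Q(S(A))`: an indecomposable `[a]` whose image `a` is decomposable in
`A` is the boundary of a sum of elements `[[x] * [y]]`, up to sign. -/
theorem range_dOne : LinearMap.range A.dOne = LinearMap.ker A.counit.mapIndec := by
  apply le_antisymm
  · rintro _ ⟨c, rfl⟩
    obtain ⟨s, -, rfl⟩ := A.sym.exists_toQ_genLin c
    rw [LinearMap.mem_ker]
    refine (congrArg _ (A.dOne_chain s)).trans ?_
    rw [map_sub, mapIndec_toQ, mapIndec_toQ, toQ_counit_genLin, sub_self]
  · intro z hz
    obtain ⟨b, hb, rfl⟩ := A.exists_toQ_genLin z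
    rw [LinearMap.mem_ker, mapIndec_toQ, toQ_counit_genLin, A.toQ_eq_zero_iff hb] at hz
    clear hb
    induction hz using Submodule.span_induction with
    | mem b hb =>
      obtain ⟨x, hx, y, hy, rfl⟩ := hb
      rw [← Submodule.neg_mem_iff]
      refine ⟨_, (A.dOne_chain (A.genLin x * A.genLin y)).trans ?_⟩
      rw [map_mul A.counit.toAlgHom, A.counit_genLin hx, A.counit_genLin hy, A.sym.toQ_of_mem_decSub
        (A.sym.mul_mem_decSub (A.genLin_mem_augIdeal x) (A.genLin_mem_augIdeal y)), zero_sub]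
    | zero => rw [map_zero, map_zero]; exact zero_mem _
    | add x y _ _ h1 h2 => rw [map_add, map_add]; exact add_mem h1 h2
    | smul c x _ h => rw [map_smul, map_smul]; exact Submodule.smul_mem _ c h

/-- The isomorphism `H_0 = QA` induced by the counit `S(A) → A`. -/
theorem exists_aqZeroEquiv : ∃ e : A.AQ 0 ≃ₗ[ZMod p] A.Indec,
    (∀ z : A.aqCycles 0, e ((A.aqBoundaries 0).mkQ z) = A.counit.mapIndec z.1) ∧
    (∀ n x, x ∈ (A.aqOps 0).deg n ↔ e x ∈ A.indecOps.deg n) ∧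
    (∀ i x, e ((A.aqOps 0).P i x) = A.indecOps.P i (e x)) ∧
    (∀ x, e ((A.aqOps 0).β x) = A.indecOps.β (e x)) := by
  let f : A.aqCycles 0 →ₗ[ZMod p] A.Indec := A.counit.mapIndec ∘ₗ (A.aqCycles 0).subtype
  have hker : A.aqBoundaries 0 = LinearMap.ker f := by
    exact congrArg (Submodule.comap (A.aqCycles 0).subtype) A.range_dOne
  have hlift : ∀ b ∈ A.augIdeal, ∃ z : A.aqCycles 0, z.1 = A.sym.toQ (A.genLin b) ∧
      f z = A.toQ b := fun b hb => by
    refine ⟨⟨A.sym.toQ (A.genLin b), trivial⟩, rfl, (mapIndec_toQ A.counit _).trans ?_⟩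
    rw [toQ_counit_genLin]
  have hsurj : Function.Surjective f := fun v => by
    obtain ⟨b, hb, rfl⟩ := A.exists_toQ v
    obtain ⟨z, -, hz⟩ := hlift b hb
    exact ⟨z, hz⟩
  let e : A.AQ 0 ≃ₗ[ZMod p] A.Indec :=
    (Submodule.quotEquivOfEq _ _ hker).trans (f.quotKerEquivOfSurjective hsurj)
  have he : ∀ z : A.aqCycles 0, e ((A.aqBoundaries 0).mkQ z) = A.counit.mapIndec z.1 :=
    fun z => rfl
  refine ⟨e, he, fun n x => ⟨?_, fun hx => ?_⟩, fun i x => ?_, fun x => ?_⟩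
  · rintro ⟨z, hz, rfl⟩
    rw [he]
    exact mapIndec_mem_deg A.counit hz
  · obtain ⟨b, hb, hb', h⟩ := A.exists_toQ_of_deg hx
    obtain ⟨z, hz, hz'⟩ := hlift b hb'
    have : x = (A.aqBoundaries 0).mkQ z := e.injective (by rw [← h, ← hz']; rfl)
    rw [this]
    refine ⟨z, ?_, rfl⟩
    change z.1 ∈ A.sym.indecOps.deg n
    rw [hz]
    exact A.sym.toQ_mem_deg (A.genLin_mem_deg hb)
  · obtain ⟨z, rfl⟩ := (A.aqBoundaries 0).mkQ_surjective x
    exact A.counit.mapIndec_P i z.1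
  · obtain ⟨z, rfl⟩ := (A.aqBoundaries 0).mkQ_surjective x
    exact A.counit.mapIndec_β z.1

/-- The elements of `S(A)` whose class is a `1`-cycle. -/
noncomputable def cycleSub : Submodule (ZMod p) A.sym.carrier := LinearMap.ker (A.dOne ∘ₗ A.chain)

variable {A} in
theorem mem_cycleSub {s : A.sym.carrier} : s ∈ A.cycleSub ↔
    A.sym.toQ s = A.sym.toQ (A.genLin (A.counit.toAlgHom s)) := by
  rw [cycleSub, LinearMap.mem_ker, LinearMap.comp_apply, dOne_chain, sub_eq_zero]

theorem mem_cycleSub_of {s : A.sym.carrier} (h1 : s ∈ A.sym.decSub)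
    (h2 : A.counit.toAlgHom s = 0) : s ∈ A.cycleSub := by
  rw [mem_cycleSub, h2, map_zero, map_zero, A.sym.toQ_of_mem_decSub h1]

/-- The class in `H_1` of an element of `S(A)` whose associated chain is a cycle. -/
noncomputable def cls : A.cycleSub →ₗ[ZMod p] A.AQ 1 :=
  (A.aqBoundaries 1).mkQ ∘ₗ
    (show A.cycleSub →ₗ[ZMod p] A.aqCycles 1 from
      { toFun := fun s => ⟨A.chain s, s.2⟩
        map_add' := fun s t => Subtype.ext (map_add A.chain s.1 t.1)
        map_smul' := fun c s => Subtype.ext (map_smul A.chain c s.1) })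

theorem cls_eq_zero_iff (s : A.cycleSub) : A.cls s = 0 ↔ A.chain s ∈ LinearMap.range A.dTwo :=
  Submodule.Quotient.mk_eq_zero _

theorem cls_mem_deg {n : ℕ} {s : A.cycleSub} (hs : (s : A.sym.carrier) ∈ A.sym.ops.deg n) :
    A.cls s ∈ (A.aqOps 1).deg n :=
  ⟨_, A.chain_mem_deg hs, rfl⟩

theorem cycleSub_P (i : ℕ) {s : A.sym.carrier} (hs : s ∈ A.cycleSub) :
    A.sym.ops.P i s ∈ A.cycleSub := by
  rw [mem_cycleSub] at hs ⊢
  rw [toQ_P, A.counit.map_P, genLin_P, toQ_P, hs]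

theorem cycleSub_β {s : A.sym.carrier} (hs : s ∈ A.cycleSub) :
    A.sym.ops.β s ∈ A.cycleSub := by
  rw [mem_cycleSub] at hs ⊢
  rw [toQ_β, A.counit.map_β, genLin_β, toQ_β, hs]

theorem cls_P (i : ℕ) (s : A.cycleSub) :
    (A.aqOps 1).P i (A.cls s) = A.cls ⟨_, A.cycleSub_P i s.2⟩ :=
  congrArg (A.aqBoundaries 1).mkQ (Subtype.ext (A.chain_P i s.1).symm)

theorem cls_β (s : A.cycleSub) :
    (A.aqOps 1).β (A.cls s) = A.cls ⟨_, A.cycleSub_β s.2⟩ :=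
  congrArg (A.aqBoundaries 1).mkQ (Subtype.ext (A.chain_β s.1).symm)

theorem cycleSub_homogeneous : IsHomogeneousSub A.sym.isInternal A.cycleSub := by
  intro n s hs
  rw [mem_cycleSub] at hs ⊢
  have h1 : A.counit.toAlgHom (degProj A.sym.isInternal n s) =
      degProj A.isInternal n (A.counit.toAlgHom s) :=
    (degProj_map A.sym.isInternal A.isInternal A.counit.toAlgHom.toLinearMap id
      Function.injective_id (fun _ _ hx => A.counit.map_deg hx) n s).symm
  have h2 : A.genLin (degProj A.isInternal n (A.counit.toAlgHom s)) =
      degProj A.sym.isInternal n (A.genLin (A.counit.toAlgHom s)) :=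
    (degProj_map A.isInternal A.sym.isInternal A.genLin id
      Function.injective_id (fun _ _ hx => A.genLin_mem_deg hx) n _).symm
  rw [h1, h2, ← degProj_toQ, ← degProj_toQ, hs]

theorem exists_cls (z : A.AQ 1) : ∃ s : A.cycleSub, A.cls s = z := by
  obtain ⟨⟨c, hc⟩, rfl⟩ := (A.aqBoundaries 1).mkQ_surjective z
  obtain ⟨s, -, rfl⟩ := A.sym.exists_toQ_genLin c
  exact ⟨⟨s, hc⟩, rfl⟩

/-- Two cycles whose difference has a bounding chain have the same class. -/
theorem cls_eq_of_sub {s t : A.cycleSub}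
    (h : A.chain (s.1 - t.1) ∈ LinearMap.range A.dTwo) : A.cls s = A.cls t := by
  rw [← sub_eq_zero, ← map_sub, cls_eq_zero_iff]
  exact h

/-- Every class in `H_1` comes from a decomposable element of `S(A)` in the kernel of the
counit. -/
theorem exists_cls_decSub (z : A.AQ 1) : ∃ s : A.cycleSub, (s : A.sym.carrier) ∈ A.sym.decSub ∧
    A.counit.toAlgHom (s : A.sym.carrier) = 0 ∧ A.cls s = z := by
  obtain ⟨⟨s, hs⟩, rfl⟩ := A.exists_cls z
  have h0 : A.chain s = A.chain (s - degProj A.sym.isInternal 0 s) := by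
    rw [map_sub, chain, LinearMap.comp_apply, LinearMap.comp_apply,
      A.sym.genLin_of_deg_zero (degProj_mem _ 0 s), map_zero, sub_zero]
  set t := s - degProj A.sym.isInternal 0 s with ht
  have htc : t ∈ A.cycleSub := A.cycleSub.sub_mem hs (A.cycleSub_homogeneous 0 s hs)
  have hta : t ∈ A.sym.augIdeal := by
    rw [mem_augIdeal_iff, ht, map_sub, degProj_of_mem _ (degProj_mem _ 0 s), sub_self]
  have hea : A.counit.toAlgHom t ∈ A.augIdeal := A.counit.map_augIdeal t hta
  have hg : A.genLin (A.counit.toAlgHom t) ∈ A.cycleSub := by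
    rw [mem_cycleSub, A.counit_genLin hea]
  have h1 : t - A.genLin (A.counit.toAlgHom t) ∈ A.cycleSub := A.cycleSub.sub_mem htc hg
  refine ⟨⟨_, h1⟩, ?_, ?_, A.cls_eq_of_sub ?_⟩
  · rw [← A.sym.toQ_eq_zero_iff (A.sym.augIdeal.sub_mem hta (A.genLin_mem_augIdeal _)), map_sub,
      sub_eq_zero]
    exact mem_cycleSub.1 htc
  · exact (map_sub A.counit.toAlgHom _ _).trans (by rw [A.counit_genLin hea, sub_self])
  · rw [map_sub, map_sub, ← h0, sub_right_comm, sub_self, zero_sub]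
    exact Submodule.neg_mem _ (A.chain_genLin_mem_boundaries _)

theorem tensorPowClass_eq (x : A.Gen) (m : ℕ) (hm : 1 < m) (hx : x.val ^ m = 0) :
    ∃ h : A.genLin x.val ^ m ∈ A.cycleSub,
      tensorPowClass x m hm hx = A.cls ⟨A.genLin x.val ^ m, h⟩ := by
  have h1 := tensorPow_mem_cycles x m hm hx
  have h2 := A.chain_val (x.tensorPow m (Nat.zero_lt_of_lt hm))
  have h4 : A.genLin x.val ^ m = (x.tensorPow m (Nat.zero_lt_of_lt hm)).val := by
    rw [A.genLin_val]; rfl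
  rw [← h4] at h2
  have h3 : A.genLin x.val ^ m ∈ A.cycleSub := (congrArg A.dOne h2).trans h1
  exact ⟨h3, congrArg (A.aqBoundaries 1).mkQ (Subtype.ext h2.symm)⟩

end LowDegrees

end SteenrodCAlg

/-! ### Coordinates with respect to a Borel decomposition -/

attribute [instance] SteenrodCAlg.BorelSystem.linearOrder

namespace SteenrodCAlg

namespace BorelSystem

variable {p : ℕ} [hp : Fact p.Prime] {A : SteenrodCAlg.{u} p} (b : A.BorelSystem)

/-- The exponents of the monomials that form a basis: those below the heights. -/
def Good (e : b.idx →₀ ℕ) : Prop := ∀ i, (e i : ℕ∞) < b.height i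

theorem mono_eq_zero {e : b.idx →₀ ℕ} (he : ¬ b.Good e) : mono b.g e = 0 := by
  simp only [Good, not_forall, not_lt] at he
  obtain ⟨i, hi⟩ := he
  obtain ⟨m, hm⟩ := ENat.ne_top_iff_exists.1 (ne_top_of_le_ne_top (ENat.natCast_ne_top _) hi)
  refine mono_eq_zero_of_pow b.g (m := m) (i := i) ?_ (b.pow_eq_zero i m hm.symm)
  rw [← hm] at hi
  exact_mod_cast hi

/-- The basis of monomials. -/
noncomputable def basis : Module.Basis {e // b.Good e} (ZMod p) A.carrier :=
  Module.Basis.mk b.linearIndependent b.span_eq_top.ge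

theorem basis_apply (e : {e // b.Good e}) : b.basis e = mono b.g e.1 :=
  Module.Basis.mk_apply _ _ e

/-- The coordinates of an element with respect to the basis of monomials, indexed by all exponents
(and zero at the exponents that are not below the heights). -/
noncomputable def coef : A.carrier →ₗ[ZMod p] (b.idx →₀ ℕ) →₀ ZMod p :=
  Finsupp.lmapDomain (ZMod p) (ZMod p) Subtype.val ∘ₗ b.basis.repr.toLinearMap

theorem coef_mono {e : b.idx →₀ ℕ} (he : b.Good e) : b.coef (mono b.g e) = Finsupp.single e 1 := by
  have h := b.basis.repr_self ⟨e, he⟩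
  rw [b.basis_apply] at h
  rw [coef, LinearMap.comp_apply, LinearEquiv.coe_coe, h, Finsupp.lmapDomain_apply,
    Finsupp.mapDomain_single]

theorem coef_mono_apply (e f : b.idx →₀ ℕ) [Decidable (e = f ∧ b.Good e)] :
    b.coef (mono b.g e) f = if e = f ∧ b.Good e then 1 else 0 := by
  classical
  by_cases he : b.Good e
  · rw [b.coef_mono he, Finsupp.single_apply]
    simp only [he, and_true]
  · rw [b.mono_eq_zero he, map_zero, if_neg fun h => he h.2]
    rfl

theorem coef_mono_of_ne {e f : b.idx →₀ ℕ} (h : e ≠ f) : b.coef (mono b.g e) f = 0 := by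
  classical
  rw [coef_mono_apply, if_neg fun h' => h h'.1]

/-- Linear maps that agree on the monomials of the basis are equal. -/
theorem hom_ext {V : Type*} [AddCommGroup V] [Module (ZMod p) V] {f g : A.carrier →ₗ[ZMod p] V}
    (h : ∀ e, b.Good e → f (mono b.g e) = g (mono b.g e)) : f = g :=
  b.basis.ext fun e => by rw [b.basis_apply]; exact h e.1 e.2

theorem good_of_coef_ne_zero {x : A.carrier} {e : b.idx →₀ ℕ} (h : b.coef x e ≠ 0) : b.Good e := by
  by_contra he
  apply h
  rw [coef, LinearMap.comp_apply, Finsupp.lmapDomain_apply, Finsupp.mapDomain_of_notMem_range]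
  rintro ⟨f, rfl⟩
  exact he f.2

/-- An element is the sum of its monomials. -/
theorem sum_coef (x : A.carrier) : (b.coef x).sum (fun e c => c • mono b.g e) = x := by
  have h : (Finsupp.lsum (ZMod p) fun e : b.idx →₀ ℕ =>
      (LinearMap.id : ZMod p →ₗ[ZMod p] ZMod p).smulRight (mono b.g e)) ∘ₗ b.coef =
      LinearMap.id := by
    refine b.hom_ext fun e he => ?_
    rw [LinearMap.comp_apply, b.coef_mono he, Finsupp.lsum_single]
    simp
  exact LinearMap.congr_fun h x

theorem coef_degProj (n : ℕ) (x : A.carrier) (e : b.idx →₀ ℕ) :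
    b.coef (degProj A.isInternal n x) e = if monoDeg b.g e = n then b.coef x e else 0 := by
  have h : Finsupp.lapply e ∘ₗ b.coef ∘ₗ degProj A.isInternal n =
      (if monoDeg b.g e = n then (1 : ZMod p) else 0) • (Finsupp.lapply e ∘ₗ b.coef) := by
    refine b.hom_ext fun f hf => ?_
    simp only [LinearMap.comp_apply, LinearMap.smul_apply, Finsupp.lapply_apply]
    rw [degProj_of_mem_ite _ (mono_mem b.g f)]
    by_cases hfe : f = e
    · subst hfe
      split_ifs <;> simp
    · rw [b.coef_mono_of_ne hfe, smul_zero]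
      split_ifs
      · exact b.coef_mono_of_ne hfe
      · simp
  have := LinearMap.congr_fun h x
  simp only [LinearMap.comp_apply, LinearMap.smul_apply, Finsupp.lapply_apply] at this
  rw [this]
  split_ifs <;> simp

theorem monoDeg_of_coef_ne_zero {n : ℕ} {x : A.carrier} (hx : x ∈ A.ops.deg n) {e : b.idx →₀ ℕ}
    (h : b.coef x e ≠ 0) : monoDeg b.g e = n := by
  by_contra hne
  apply h
  rw [← degProj_of_mem A.isInternal hx, coef_degProj, if_neg hne]

theorem coef_zero_of_mem_augIdeal {x : A.carrier} (hx : x ∈ A.augIdeal) : b.coef x 0 = 0 := by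
  have h := b.coef_degProj 0 x 0
  rw [A.mem_augIdeal_iff.1 hx, if_pos (monoDeg_zero b.g), map_zero b.coef] at h
  exact h.symm

theorem mem_span_mono {x : A.carrier} {P : (b.idx →₀ ℕ) → Prop}
    (h : ∀ e, b.coef x e ≠ 0 → P e) :
    x ∈ Submodule.span (ZMod p) {y | ∃ e, P e ∧ b.Good e ∧ mono b.g e = y} := by
  rw [← b.sum_coef x]
  refine Submodule.sum_mem _ fun e he => Submodule.smul_mem _ _ (Submodule.subset_span ?_)
  have he := Finsupp.mem_support_iff.1 he
  exact ⟨e, h e he, b.good_of_coef_ne_zero he, rfl⟩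

theorem mem_span_of_mem_augIdeal {x : A.carrier} (hx : x ∈ A.augIdeal) :
    x ∈ Submodule.span (ZMod p) {y | ∃ e, e ≠ 0 ∧ b.Good e ∧ mono b.g e = y} :=
  b.mem_span_mono fun e he => by
    rintro rfl
    exact he (b.coef_zero_of_mem_augIdeal hx)

/-- The linear coordinates of a decomposable element vanish. -/
theorem coef_single_of_mem_decSub {x : A.carrier} (hx : x ∈ A.decSub) (i : b.idx) :
    b.coef x (Finsupp.single i 1) = 0 := by
  induction hx using Submodule.span_induction with
  | mem x hx =>
    obtain ⟨x, hx, y, hy, rfl⟩ := hx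
    replace hx := b.mem_span_of_mem_augIdeal hx
    replace hy := b.mem_span_of_mem_augIdeal hy
    induction hx using Submodule.span_induction with
    | mem x hx =>
      obtain ⟨e, he, -, rfl⟩ := hx
      induction hy using Submodule.span_induction with
      | mem y hy =>
        obtain ⟨f, hf, -, rfl⟩ := hy
        obtain ⟨c, hc, h⟩ := mono_add b.g e f
        have h2 : b.coef (mono b.g (e + f)) (Finsupp.single i 1) = 0 := by
          refine b.coef_mono_of_ne fun h => ?_
          have h3 := congrArg Finsupp.degree h
          rw [map_add, Finsupp.degree_single] at h3
          have h4 : Finsupp.degree e ≠ 0 := by rwa [ne_eq, Finsupp.degree_eq_zero_iff]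
          have h5 : Finsupp.degree f ≠ 0 := by rwa [ne_eq, Finsupp.degree_eq_zero_iff]
          omega
        rw [h, map_smul, Finsupp.smul_apply, smul_eq_mul] at h2
        exact (mul_eq_zero.1 h2).resolve_left hc
      | zero => simp
      | add x y _ _ h1 h2 => rw [mul_add, map_add, Finsupp.add_apply, h1, h2, add_zero]
      | smul c x _ h => rw [mul_smul_comm, map_smul, Finsupp.smul_apply, h, smul_zero]
    | zero => simp
    | add x y _ _ h1 h2 => rw [add_mul, map_add, Finsupp.add_apply, h1, h2, add_zero]
    | smul c x _ h => rw [smul_mul_assoc, map_smul, Finsupp.smul_apply, h, smul_zero]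
  | zero => simp
  | add x y _ _ h1 h2 => rw [map_add, Finsupp.add_apply, h1, h2, add_zero]
  | smul c x _ h => rw [map_smul, Finsupp.smul_apply, h, smul_zero]

/-- Decomposable elements are sums of monomials with at least two factors. -/
theorem two_le_degree_of_coef_ne_zero {x : A.carrier} (hx : x ∈ A.decSub) {e : b.idx →₀ ℕ}
    (he : b.coef x e ≠ 0) : 2 ≤ Finsupp.degree e := by
  by_contra h
  have h : Finsupp.degree e = 0 ∨ Finsupp.degree e = 1 := by omega
  rcases h with h | h
  · rw [Finsupp.degree_eq_zero_iff] at h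
    exact he (h ▸ b.coef_zero_of_mem_augIdeal (A.decSub_le_augIdeal hx))
  · obtain ⟨i, hi⟩ : ∃ i, e i ≠ 0 := by
      by_contra! h0
      rw [(Finsupp.ext h0 : e = 0)] at h
      simp at h
    have h1 : Finsupp.single i 1 ≤ e := Finsupp.single_le_iff.2 (Nat.one_le_iff_ne_zero.2 hi)
    obtain ⟨f, rfl⟩ := exists_add_of_le h1
    rw [map_add, Finsupp.degree_single] at h
    have h2 : f = 0 := (Finsupp.degree_eq_zero_iff f).1 (by omega)
    exact he (by rw [h2, add_zero]; exact b.coef_single_of_mem_decSub hx i)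

/-- Coordinates of a power with exponent `p ^ k`. -/
theorem exists_coef_pow {n : ℕ} (hn : IsEvenDeg p n) {x : A.carrier} (hx : x ∈ A.ops.deg n) (k : ℕ)
    {e : b.idx →₀ ℕ} (he : b.Good (p ^ k • e)) :
    ∃ c ≠ 0, b.coef x e = c * b.coef (x ^ p ^ k) (p ^ k • e) := by
  obtain ⟨c, hc, h⟩ := mono_nsmul b.g (p ^ k) e
  refine ⟨c, hc, ?_⟩
  have hq : p ^ k ≠ 0 := pow_ne_zero _ hp.out.ne_zero
  conv_rhs => rw [← b.sum_coef x, Finsupp.sum]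
  rw [sum_pow_prime_pow]
  · rw [map_sum, Finsupp.finsetSum_apply, Finset.mul_sum, Finset.sum_eq_single e]
    · rw [smul_pow_prime_pow, map_smul b.coef, Finsupp.smul_apply, smul_eq_mul, mul_left_comm]
      have h2 := congrArg (fun z => b.coef z (p ^ k • e)) h
      simp only [b.coef_mono he, Finsupp.single_eq_same, map_smul, Finsupp.smul_apply,
        smul_eq_mul] at h2
      rw [← h2, mul_one]
    · intro f hf hfe
      obtain ⟨c', hc', h'⟩ := mono_nsmul b.g (p ^ k) f
      have h2 := congrArg (fun z => b.coef z (p ^ k • e)) h'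
      have h3 : p ^ k • f ≠ p ^ k • e := fun h => hfe (by
        ext i
        have := DFunLike.congr_fun h i
        simpa [hq, hp.out.ne_zero] using this)
      simp only [b.coef_mono_of_ne h3, map_smul, Finsupp.smul_apply, smul_eq_mul] at h2
      rw [smul_pow_prime_pow, map_smul b.coef, Finsupp.smul_apply,
        (mul_eq_zero.1 h2.symm).resolve_left hc', smul_zero, mul_zero]
    · intro he'
      rw [Finsupp.notMem_support_iff.1 he', zero_smul, zero_pow hq, map_zero, Finsupp.zero_apply,
        mul_zero]
  · intro f hf f' hf'
    have hdeg : ∀ f ∈ (b.coef x).support, b.coef x f • mono b.g f ∈ A.ops.deg n := fun f hf => by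
      rw [← b.monoDeg_of_coef_ne_zero hx (Finsupp.mem_support_iff.1 hf)]
      exact Submodule.smul_mem _ _ (mono_mem b.g f)
    exact A.commute_of_isEvenDeg hn (hdeg f hf) _

/-- If `x ^ (p ^ k) = 0`, then all monomials `m` of `x` satisfy `m ^ (p ^ k) = 0`. -/
theorem not_good_of_pow_eq_zero {n : ℕ} (hn : IsEvenDeg p n) {x : A.carrier}
    (hx : x ∈ A.ops.deg n) {k : ℕ} (h : x ^ p ^ k = 0) {e : b.idx →₀ ℕ} (he : b.coef x e ≠ 0) :
    ¬ b.Good (p ^ k • e) := fun hg => by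
  obtain ⟨c, -, hc⟩ := b.exists_coef_pow hn hx k hg
  rw [h, map_zero, Finsupp.zero_apply, mul_zero] at hc
  exact he hc

theorem one_lt_height (i : b.idx) : 1 < b.height i := by
  have h2 : (1 : ℕ∞) < 2 := by norm_num
  by_cases h : p = 2 ∨ Even (b.g i).d
  · rcases b.height_even i h with h | ⟨k, hk, h⟩
    · rw [h]; exact ENat.natCast_lt_top 1
    · rw [h]
      exact_mod_cast Nat.one_lt_pow hk.ne' hp.out.one_lt
  · push Not at h
    rw [b.height_odd i h.1 (Nat.not_even_iff_odd.1 h.2)]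
    exact h2

theorem good_single (i : b.idx) : b.Good (Finsupp.single i 1) := fun j => by
  classical
  rw [Finsupp.single_apply]
  split_ifs with h
  · subst h; exact b.one_lt_height i
  · exact lt_trans (by norm_num) (b.one_lt_height j)

theorem isEvenDeg_of_truncated {k : ℕ} {i : b.idx} (hi : i ∈ b.truncated k) :
    IsEvenDeg p (b.g i).d := by
  by_contra h
  obtain ⟨h1, h2⟩ := not_or.1 h
  have h3 := b.height_odd i h1 (Nat.not_even_iff_odd.1 h2)
  rw [hi.2] at h3
  have h4 : p ^ k = 2 := by exact_mod_cast h3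
  exact h1 ((Nat.prime_dvd_prime_iff_eq hp.out Nat.prime_two).1 (h4 ▸ dvd_pow_self p hi.1.ne'))

end BorelSystem

end SteenrodCAlg

/-! ### Classes of tensor powers in `H_1` -/

namespace SteenrodCAlg

section PowClasses

variable {p : ℕ}

theorem pow_mem_decSub {B : SteenrodCAlg.{u} p} {x : B.carrier} (hx : x ∈ B.augIdeal) {m : ℕ}
    (hm : 1 < m) : x ^ m ∈ B.decSub := by
  obtain ⟨l, rfl⟩ := Nat.exists_eq_add_of_le' hm
  have : ∀ j, x ^ (j + 1) ∈ B.augIdeal := fun j => by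
    rw [pow_succ']; exact B.mul_mem_augIdeal _ hx
  rw [pow_add _ l 2, pow_two, ← mul_assoc, ← pow_succ]
  exact B.mul_mem_decSub (this l) hx

variable (A : SteenrodCAlg.{u} p)

/-- Homogeneous elements of positive degree (even if `p` is odd) whose `p ^ k`-th power vanishes. -/
structure NilAt (k n : ℕ) (x : A.carrier) : Prop where
  pos : 0 < n
  even : IsEvenDeg p n
  mem : x ∈ A.ops.deg n
  pow_eq_zero : x ^ p ^ k = 0

namespace NilAt

variable {A} {k n : ℕ} {x y : A.carrier}

theorem mem_augIdeal (hx : A.NilAt k n x) : x ∈ A.augIdeal :=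
  A.mem_augIdeal_of_deg hx.pos hx.mem

variable [hp : Fact p.Prime]

theorem add (hx : A.NilAt k n x) (hy : A.NilAt k n y) : A.NilAt k n (x + y) where
  pos := hx.pos
  even := hx.even
  mem := add_mem hx.mem hy.mem
  pow_eq_zero := by
    rw [add_pow_prime_pow_of_commute (A.commute_of_isEvenDeg hx.even hx.mem y), hx.pow_eq_zero,
      hy.pow_eq_zero, add_zero]

theorem smul (c : ZMod p) (hx : A.NilAt k n x) : A.NilAt k n (c • x) where
  pos := hx.pos
  even := hx.even
  mem := Submodule.smul_mem _ c hx.mem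
  pow_eq_zero := by rw [smul_pow_prime_pow, hx.pow_eq_zero, smul_zero]

theorem zero (k : ℕ) (h : 0 < n) (hn : IsEvenDeg p n) : A.NilAt k n 0 where
  pos := h
  even := hn
  mem := zero_mem _
  pow_eq_zero := zero_pow (pow_ne_zero k hp.out.ne_zero)

theorem mono {l : ℕ} (hx : A.NilAt k n x) (h : k ≤ l) : A.NilAt l n x where
  pos := hx.pos
  even := hx.even
  mem := hx.mem
  pow_eq_zero := by
    obtain ⟨m, rfl⟩ := Nat.exists_eq_add_of_le h
    rw [pow_add, pow_mul, hx.pow_eq_zero, zero_pow (pow_ne_zero m hp.out.ne_zero)]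

theorem P (hx : A.NilAt k n x) (i : ℕ) : A.NilAt k (n + degP p i) (A.ops.P i x) where
  pos := Nat.add_pos_left hx.pos _
  even := hx.even.add_degP i
  mem := A.P_mem i hx.mem
  pow_eq_zero := by
    have h := A.P_pow_prime_pow hx.even hx.mem k (p ^ k * i)
    rw [hx.pow_eq_zero, map_zero, if_pos (Nat.dvd_mul_right _ _),
      Nat.mul_div_cancel_left _ (pow_pos hp.out.pos k)] at h
    exact h.symm

end NilAt

variable [hp : Fact p.Prime]

open Classical in
/-- The class in `H_1` of an element of `S(A)`, with the value zero if the element does not give a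
cycle. -/
noncomputable def clsOf (s : A.sym.carrier) : A.AQ 1 :=
  if h : s ∈ A.cycleSub then A.cls ⟨s, h⟩ else 0

theorem clsOf_of_mem {s : A.sym.carrier} (h : s ∈ A.cycleSub) : A.clsOf s = A.cls ⟨s, h⟩ :=
  dif_pos h

theorem clsOf_add {s t : A.sym.carrier} (hs : s ∈ A.cycleSub) (ht : t ∈ A.cycleSub) :
    A.clsOf (s + t) = A.clsOf s + A.clsOf t := by
  rw [A.clsOf_of_mem hs, A.clsOf_of_mem ht, A.clsOf_of_mem (add_mem hs ht), ← map_add]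
  rfl

theorem clsOf_smul (c : ZMod p) {s : A.sym.carrier} (hs : s ∈ A.cycleSub) :
    A.clsOf (c • s) = c • A.clsOf s := by
  rw [A.clsOf_of_mem hs, A.clsOf_of_mem (Submodule.smul_mem _ c hs), ← map_smul]
  rfl

theorem clsOf_eq_zero {s : A.sym.carrier} (h : A.chain s ∈ LinearMap.range A.dTwo) :
    A.clsOf s = 0 := by
  unfold clsOf
  split_ifs with hs
  · exact (A.cls_eq_zero_iff ⟨s, hs⟩).2 h
  · rfl

theorem clsOf_P (i : ℕ) {s : A.sym.carrier} (hs : s ∈ A.cycleSub) :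
    (A.aqOps 1).P i (A.clsOf s) = A.clsOf (A.sym.ops.P i s) := by
  rw [A.clsOf_of_mem hs, A.clsOf_of_mem (A.cycleSub_P i hs), cls_P]

theorem clsOf_β {s : A.sym.carrier} (hs : s ∈ A.cycleSub) :
    (A.aqOps 1).β (A.clsOf s) = A.clsOf (A.sym.ops.β s) := by
  rw [A.clsOf_of_mem hs, A.clsOf_of_mem (A.cycleSub_β hs), cls_β]

/-- The class in `H_1` of the tensor power `x^{⊗ p ^ k}`. -/
noncomputable def powCls (k : ℕ) (x : A.carrier) : A.AQ 1 := A.clsOf (A.genLin x ^ p ^ k)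

variable {A} {k n : ℕ} {x y : A.carrier}

namespace NilAt

theorem pow_mem_cycleSub (hx : A.NilAt k n x) (hk : 0 < k) : A.genLin x ^ p ^ k ∈ A.cycleSub := by
  refine A.mem_cycleSub_of
    (pow_mem_decSub (A.genLin_mem_augIdeal x) (Nat.one_lt_pow hk.ne' hp.out.one_lt)) ?_
  refine (map_pow A.counit.toAlgHom _ _).trans ?_
  rw [A.counit_genLin hx.mem_augIdeal, hx.pow_eq_zero]

theorem powCls_mem (hx : A.NilAt k n x) (hk : 0 < k) :
    A.powCls k x ∈ (A.aqOps 1).deg (p ^ k * n) := by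
  rw [powCls, A.clsOf_of_mem (hx.pow_mem_cycleSub hk)]
  exact A.cls_mem_deg (A.sym.pow_mem_deg (A.genLin_mem_deg hx.mem) _)

theorem powCls_add (hx : A.NilAt k n x) (hy : A.NilAt k n y) (hk : 0 < k) :
    A.powCls k (x + y) = A.powCls k x + A.powCls k y := by
  rw [powCls, map_add, add_pow_prime_pow_of_commute
    (A.sym.commute_of_isEvenDeg hx.even (A.genLin_mem_deg hx.mem) _),
    A.clsOf_add (hx.pow_mem_cycleSub hk) (hy.pow_mem_cycleSub hk)]
  rfl

theorem powCls_smul (c : ZMod p) (hx : A.NilAt k n x) (hk : 0 < k) :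
    A.powCls k (c • x) = c • A.powCls k x := by
  rw [powCls, map_smul, smul_pow_prime_pow, A.clsOf_smul c (hx.pow_mem_cycleSub hk)]
  rfl

theorem P_powCls (hx : A.NilAt k n x) (hk : 0 < k) (j : ℕ) : (A.aqOps 1).P j (A.powCls k x) =
    if p ^ k ∣ j then A.powCls k (A.ops.P (j / p ^ k) x) else 0 := by
  rw [powCls, A.clsOf_P j (hx.pow_mem_cycleSub hk),
    A.sym.P_pow_prime_pow hx.even (A.genLin_mem_deg hx.mem)]
  split_ifs with h
  · rw [powCls, genLin_P]
  · exact A.clsOf_eq_zero (by rw [map_zero]; exact zero_mem _)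

theorem β_powCls (hx : A.NilAt k n x) (hk : 0 < k) : (A.aqOps 1).β (A.powCls k x) = 0 := by
  rw [powCls, A.clsOf_β (hx.pow_mem_cycleSub hk),
    A.sym.β_pow_prime_pow hx.even (A.genLin_mem_deg hx.mem) hk]
  exact A.clsOf_eq_zero (by rw [map_zero]; exact zero_mem _)

end NilAt

theorem powCls_zero (k : ℕ) : A.powCls k 0 = 0 := by
  rw [powCls, map_zero, zero_pow (pow_ne_zero k hp.out.ne_zero)]
  exact A.clsOf_eq_zero (by rw [map_zero]; exact zero_mem _)

end PowClasses

/-! ### The tensor powers of the truncated generators span `H_1` -/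

namespace BorelSystem

variable {p : ℕ} {A : SteenrodCAlg.{u} p} (b : A.BorelSystem)

/-- The generators `[g i]` of `S(A)`. -/
noncomputable def unitGen (i : b.idx) : A.sym.Gen := (b.g i).unit

theorem counit_mono (e : b.idx →₀ ℕ) : A.counit.toAlgHom (mono b.unitGen e) = mono b.g e := by
  rw [mono, mono, map_list_prod, List.map_map]
  congr 1
  refine List.map_congr_left fun i _ => (map_pow A.counit.toAlgHom _ _).trans ?_
  congr 1
  exact counit_ι (b.g i)

theorem unitGen_val (i : b.idx) : (b.unitGen i).val = A.genLin (b.g i).val :=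
  (A.genLin_val (b.g i)).symm

variable [hp : Fact p.Prime]

theorem nilAt {k : ℕ} {i : b.idx} (hi : i ∈ b.truncated k) : A.NilAt k (b.g i).d (b.g i).val where
  pos := (b.g i).pos
  even := b.isEvenDeg_of_truncated hi
  mem := (b.g i).mem
  pow_eq_zero := b.pow_eq_zero i _ hi.2

theorem powClass_eq {k : ℕ} {i : b.idx} (hi : i ∈ b.truncated k) :
    b.powClass hi = A.powCls k (b.g i).val := by
  obtain ⟨h, h'⟩ := tensorPowClass_eq A (b.g i) (p ^ k)
    (Nat.one_lt_pow hi.1.ne' hp.out.one_lt) (b.pow_eq_zero i (p ^ k) hi.2)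
  rw [powClass, h', powCls, A.clsOf_of_mem h]

/-- The linear section of the counit that sends basis monomials in the `g i` to the same monomials
in the `[g i]`. -/
noncomputable def monoSection : A.carrier →ₗ[ZMod p] A.sym.carrier :=
  b.basis.constr (ZMod p) fun e => mono b.unitGen e.1

theorem section_mono {e : b.idx →₀ ℕ} (he : b.Good e) :
    b.monoSection (mono b.g e) = mono b.unitGen e := by
  have := b.basis.constr_basis (ZMod p) (fun e => mono b.unitGen e.1) ⟨e, he⟩
  rwa [b.basis_apply] at this

theorem counit_section (x : A.carrier) : A.counit.toAlgHom (b.monoSection x) = x := by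
  have h : A.counit.toAlgHom.toLinearMap ∘ₗ b.monoSection = LinearMap.id :=
    b.hom_ext fun e he => by
      rw [LinearMap.comp_apply, b.section_mono he]
      exact b.counit_mono e
  exact LinearMap.congr_fun h x

variable (A) in
/-- The span of the products of two elements of positive degree of `S(A)` one of which is in the
kernel of the counit. -/
noncomputable def kerProducts : Submodule (ZMod p) A.sym.carrier :=
  Submodule.span (ZMod p) {s | ∃ u ∈ A.sym.augIdeal, ∃ v ∈ A.sym.augIdeal,
    (A.counit.toAlgHom u = 0 ∨ A.counit.toAlgHom v = 0) ∧ u * v = s}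

theorem kerProducts_le : kerProducts A ≤ A.cycleSub := by
  refine Submodule.span_le.2 ?_
  rintro _ ⟨u, hu, v, hv, h, rfl⟩
  refine A.mem_cycleSub_of (A.sym.mul_mem_decSub hu hv) ((map_mul A.counit.toAlgHom u v).trans ?_)
  rcases h with h | h
  · rw [h, zero_mul]
  · rw [h, mul_zero]

theorem clsOf_kerProducts {s : A.sym.carrier} (hs : s ∈ kerProducts A) : A.clsOf s = 0 := by
  refine A.clsOf_eq_zero ?_
  induction hs using Submodule.span_induction with
  | mem s hs =>
    obtain ⟨u, hu, v, hv, h, rfl⟩ := hs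
    rcases h with h | h
    · exact A.chain_mul_mem_boundaries_left hu hv h
    · exact A.chain_mul_mem_boundaries_right hu hv h
  | zero => rw [map_zero]; exact zero_mem _
  | add x y _ _ h1 h2 => rw [map_add]; exact add_mem h1 h2
  | smul c x _ h => rw [map_smul]; exact Submodule.smul_mem _ c h

/-- The span of the products with a factor in the kernel of the counit and of the tensor powers of
the truncated generators. -/
noncomputable def kerSpan : Submodule (ZMod p) A.sym.carrier :=
  kerProducts A ⊔ Submodule.span (ZMod p)
    {s | ∃ k i, i ∈ b.truncated k ∧ A.genLin (b.g i).val ^ p ^ k = s}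

theorem mono_unitGen_mem_augIdeal {e : b.idx →₀ ℕ} (he : e ≠ 0) :
    mono b.unitGen e ∈ A.sym.augIdeal :=
  A.sym.mem_augIdeal_of_deg (Nat.pos_of_ne_zero fun h => he ((monoDeg_eq_zero_iff _).1 h))
    (mono_mem b.unitGen e)

theorem section_mem_augIdeal {x : A.carrier} (hx : x ∈ A.augIdeal) :
    b.monoSection x ∈ A.sym.augIdeal := by
  have hx := b.mem_span_of_mem_augIdeal hx
  refine Submodule.span_induction (p := fun x _ => b.monoSection x ∈ A.sym.augIdeal)
    ?_ ?_ ?_ ?_ hx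
  · rintro _ ⟨e, he, hg, rfl⟩
    rw [b.section_mono hg]
    exact b.mono_unitGen_mem_augIdeal he
  · rw [map_zero]; exact zero_mem _
  · intro x y _ _ h1 h2
    rw [map_add]; exact add_mem h1 h2
  · intro c x _ h
    rw [map_smul]; exact Submodule.smul_mem _ c h

/-- A monomial in the `[g i]` whose image in `A` vanishes is a power of a truncated generator or a
product with a factor that vanishes in `A`. -/
theorem mono_unitGen_of_not_good {e : b.idx →₀ ℕ} (he : ¬ b.Good e) :
    mono b.unitGen e ∈ kerProducts A ∨
      ∃ k i, i ∈ b.truncated k ∧ e = Finsupp.single i (p ^ k) := by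
  simp only [Good, not_forall, not_lt] at he
  obtain ⟨i, hi⟩ := he
  obtain ⟨m, hm⟩ := ENat.ne_top_iff_exists.1 (ne_top_of_le_ne_top (ENat.natCast_ne_top _) hi)
  have hm1 : 1 < m := by
    have := b.one_lt_height i
    rw [← hm] at this
    exact_mod_cast this
  rw [← hm] at hi
  have hle : Finsupp.single i m ≤ e := by
    rw [Finsupp.single_le_iff]
    exact_mod_cast hi
  obtain ⟨f, rfl⟩ := exists_add_of_le hle
  by_cases hf : f = 0
  · rw [hf, add_zero]
    by_cases hev : IsEvenDeg p (b.g i).d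
    · rcases b.height_even i hev with h | ⟨k, hk, h⟩
      · rw [h] at hm
        exact absurd hm (ENat.natCast_ne_top m)
      · have hmk : m = p ^ k := by
          rw [h] at hm
          exact_mod_cast hm
        exact Or.inr ⟨k, i, ⟨hk, h⟩, by rw [hmk]⟩
    · obtain ⟨h1, h2⟩ := not_or.1 hev
      have h2 := Nat.not_even_iff_odd.1 h2
      have h3 := b.height_odd i h1 h2
      have hm2 : m = 2 := by
        rw [h3] at hm
        exact_mod_cast hm
      left
      rw [mono_single, hm2, A.sym.sq_eq_zero_of_odd h1 h2 (b.unitGen i).mem]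
      exact zero_mem _
  · obtain ⟨c, -, hc⟩ := mono_add b.unitGen (Finsupp.single i m) f
    left
    rw [hc, mono_single]
    refine Submodule.smul_mem _ c (Submodule.subset_span
      ⟨_, ?_, _, b.mono_unitGen_mem_augIdeal hf, Or.inl ?_, rfl⟩)
    · exact A.sym.decSub_le_augIdeal (pow_mem_decSub (b.unitGen i).mem_augIdeal hm1)
    · refine (map_pow A.counit.toAlgHom _ _).trans ?_
      rw [show A.counit.toAlgHom (b.unitGen i).val = (b.g i).val from counit_ι _]
      exact b.pow_eq_zero i m hm.symm

theorem mono_unitGen_mem_kerSpan {e : b.idx →₀ ℕ} (he : ¬ b.Good e) :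
    mono b.unitGen e ∈ b.kerSpan := by
  rcases b.mono_unitGen_of_not_good he with h | ⟨k, i, hi, rfl⟩
  · exact Submodule.mem_sup_left h
  · refine Submodule.mem_sup_right (Submodule.subset_span ⟨k, i, hi, ?_⟩)
    rw [mono_single, unitGen_val]

theorem section_mul_sub_mem {x y : A.carrier} (hx : x ∈ A.augIdeal) (hy : y ∈ A.augIdeal) :
    b.monoSection x * b.monoSection y - b.monoSection (x * y) ∈ b.kerSpan := by
  have hx := b.mem_span_of_mem_augIdeal hx
  have hy := b.mem_span_of_mem_augIdeal hy
  refine Submodule.span_induction (p := fun x _ =>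
    b.monoSection x * b.monoSection y - b.monoSection (x * y) ∈ b.kerSpan) ?_ ?_ ?_ ?_ hx
  · rintro _ ⟨e, he, hge, rfl⟩
    refine Submodule.span_induction (p := fun y _ => b.monoSection (mono b.g e) * b.monoSection y -
      b.monoSection (mono b.g e * y) ∈ b.kerSpan) ?_ ?_ ?_ ?_ hy
    · rintro _ ⟨f, hf, hgf, rfl⟩
      rw [b.section_mono hge, b.section_mono hgf]
      obtain ⟨c, hc, h⟩ := mono_add b.unitGen e f
      have h1 : mono b.unitGen e * mono b.unitGen f = c⁻¹ • mono b.unitGen (e + f) := by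
        rw [h, smul_smul, inv_mul_cancel₀ hc, one_smul]
      have h2 : mono b.g e * mono b.g f = c⁻¹ • mono b.g (e + f) := by
        have := congrArg A.counit.toAlgHom h1
        rw [map_mul A.counit.toAlgHom, map_smul, b.counit_mono, b.counit_mono,
          b.counit_mono] at this
        exact this
      rw [h1, h2, map_smul]
      by_cases hg : b.Good (e + f)
      · rw [b.section_mono hg, sub_self]; exact zero_mem _
      · rw [b.mono_eq_zero hg, map_zero, smul_zero, sub_zero]
        exact Submodule.smul_mem _ _ (b.mono_unitGen_mem_kerSpan hg)
    · rw [map_zero, mul_zero, mul_zero, map_zero, sub_zero]; exact zero_mem _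
    · intro x y _ _ h1 h2
      rw [map_add, mul_add, mul_add, map_add, add_sub_add_comm]; exact add_mem h1 h2
    · intro c x _ h
      rw [map_smul, mul_smul_comm, mul_smul_comm, map_smul, ← smul_sub]
      exact Submodule.smul_mem _ c h
  · rw [map_zero, zero_mul, zero_mul, map_zero, sub_zero]; exact zero_mem _
  · intro x y _ _ h1 h2
    rw [map_add, add_mul, add_mul, map_add, add_sub_add_comm]; exact add_mem h1 h2
  · intro c x _ h
    rw [map_smul, smul_mul_assoc, smul_mul_assoc, map_smul, ← smul_sub]
    exact Submodule.smul_mem _ c h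

/-- Decomposable elements of `S(A)` are determined by their image in `A`, modulo products with a
factor in the kernel of the counit and tensor powers of truncated generators. -/
theorem sub_section_mem {s : A.sym.carrier} (hs : s ∈ A.sym.decSub) :
    s - b.monoSection (A.counit.toAlgHom s) ∈ b.kerSpan := by
  refine Submodule.span_induction (p := fun s _ =>
    s - b.monoSection (A.counit.toAlgHom s) ∈ b.kerSpan) ?_ ?_ ?_ ?_ hs
  · rintro _ ⟨u, hu, v, hv, rfl⟩
    have hu' : A.counit.toAlgHom u ∈ A.augIdeal := A.counit.map_augIdeal u hu
    have hv' : A.counit.toAlgHom v ∈ A.augIdeal := A.counit.map_augIdeal v hv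
    have h0 : ∀ u, A.counit.toAlgHom (u - b.monoSection (A.counit.toAlgHom u)) = 0 := fun u =>
      (map_sub A.counit.toAlgHom _ _).trans (by rw [b.counit_section, sub_self])
    have h1 : (u - b.monoSection (A.counit.toAlgHom u)) * v ∈ b.kerSpan :=
      Submodule.mem_sup_left (Submodule.subset_span
        ⟨_, sub_mem hu (b.section_mem_augIdeal hu'), v, hv, Or.inl (h0 u), rfl⟩)
    have h2 : b.monoSection (A.counit.toAlgHom u) * (v - b.monoSection (A.counit.toAlgHom v)) ∈
        b.kerSpan :=
      Submodule.mem_sup_left (Submodule.subset_span ⟨_, b.section_mem_augIdeal hu', _,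
        sub_mem hv (b.section_mem_augIdeal hv'), Or.inr (h0 v), rfl⟩)
    have h3 := b.section_mul_sub_mem hu' hv'
    have h4 := add_mem (add_mem h1 h2) h3
    rw [map_mul A.counit.toAlgHom]
    rw [sub_mul, mul_sub, sub_add_sub_cancel, sub_add_sub_cancel] at h4
    exact h4
  · rw [map_zero, map_zero, sub_zero]; exact zero_mem _
  · intro x y _ _ h1 h2
    rw [map_add, map_add, add_sub_add_comm]; exact add_mem h1 h2
  · intro c x _ h
    rw [map_smul, map_smul, ← smul_sub]
    exact Submodule.smul_mem _ c h

/-- The classes of the tensor powers of the truncated generators span `H_1`. -/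
theorem span_powCls : Submodule.span (ZMod p)
    {z | ∃ k i, i ∈ b.truncated k ∧ A.powCls k (b.g i).val = z} = ⊤ := by
  rw [eq_top_iff]
  rintro z -
  obtain ⟨⟨s, hs⟩, h1, h2, rfl⟩ := A.exists_cls_decSub z
  have h := b.sub_section_mem h1
  simp only at h2
  rw [h2, map_zero, sub_zero] at h
  rw [← A.clsOf_of_mem hs]
  obtain ⟨u, hu, v, hv, rfl⟩ := Submodule.mem_sup.1 h
  have h4 : v ∈ A.cycleSub ∧ A.clsOf v ∈ Submodule.span (ZMod p)
      {z | ∃ k i, i ∈ b.truncated k ∧ A.powCls k (b.g i).val = z} := by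
    refine Submodule.span_induction (p := fun v _ => v ∈ A.cycleSub ∧ A.clsOf v ∈ _)
      ?_ ?_ ?_ ?_ hv
    · rintro _ ⟨k, i, hi, rfl⟩
      exact ⟨(b.nilAt hi).pow_mem_cycleSub hi.1, Submodule.subset_span ⟨k, i, hi, rfl⟩⟩
    · refine ⟨zero_mem _, ?_⟩
      rw [A.clsOf_eq_zero (by rw [map_zero]; exact zero_mem _)]
      exact zero_mem _
    · intro x y _ _ h1 h2
      refine ⟨add_mem h1.1 h2.1, ?_⟩
      rw [A.clsOf_add h1.1 h2.1]
      exact add_mem h1.2 h2.2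
    · intro c x _ h
      refine ⟨Submodule.smul_mem _ c h.1, ?_⟩
      rw [A.clsOf_smul c h.1]
      exact Submodule.smul_mem _ c h.2
  rw [A.clsOf_add (kerProducts_le hu) h4.1, clsOf_kerProducts hu, zero_add]
  exact h4.2

end BorelSystem

end SteenrodCAlg

/-! ### `H_1` is an unstable module -/

section Binomials

variable {p : ℕ} [hp : Fact p.Prime]

/-- A case of Lucas' theorem: `p ^ k * M - 1` has the digits of `M - 1`, shifted by `k`, preceded by
digits `p - 1`. -/
theorem choose_prime_pow_mul_sub_one (k M K : ℕ) (hM : 0 < M) :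
    ((p ^ k * M - 1).choose (p ^ k * K) : ZMod p) = ((M - 1).choose K : ZMod p) := by
  induction k with
  | zero => simp
  | succ k ih =>
    rw [← ih, ZMod.natCast_eq_natCast_iff]
    refine Choose.choose_modEq_choose_mod_mul_choose_div_nat.trans ?_
    have hp0 := hp.out.pos
    have h0 : 0 < p ^ k * M := Nat.mul_pos (pow_pos hp0 k) hM
    obtain ⟨L, hL⟩ := Nat.exists_eq_add_of_lt h0
    have h1 : p ^ (k + 1) * M - 1 = (p - 1) + p * (p ^ k * M - 1) := by
      rw [pow_succ', mul_assoc, hL]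
      obtain ⟨r, rfl⟩ := Nat.exists_eq_add_of_lt hp0
      simp only [zero_add, Nat.add_sub_cancel]
      rw [mul_add, mul_one]
      omega
    have h2 : p ^ (k + 1) * K = p * (p ^ k * K) := by rw [pow_succ', mul_assoc]
    rw [h1, h2, Nat.mul_mod_right, Nat.mul_div_cancel_left _ hp0, Nat.add_mul_div_left _ _ hp0,
      Nat.div_eq_of_lt (by omega), Nat.choose_zero_right, one_mul, zero_add]

theorem choose_sub_one_eq_zero {M K : ℕ} (hM : 0 < M) (h : (M : ZMod p) = K)
    (hK : (K : ZMod p) ≠ 0) : ((M - 1).choose K : ZMod p) = 0 := by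
  have hp0 := hp.out.pos
  rw [← Nat.cast_zero, ZMod.natCast_eq_natCast_iff]
  refine Choose.choose_modEq_choose_mod_mul_choose_div_nat.trans ?_
  rw [ZMod.natCast_eq_natCast_iff'] at h
  have h1 : K % p ≠ 0 := fun h1 => hK ((ZMod.natCast_eq_zero_iff K p).2 (Nat.dvd_of_mod_eq_zero h1))
  have h2 : (M - 1) % p < K % p := by
    have h3 := Nat.div_add_mod M p
    have h4 := Nat.mod_lt M hp0
    have h5 : M - 1 = (M % p - 1) + p * (M / p) := by omega
    rw [h5, Nat.add_mul_mod_self_left, Nat.mod_eq_of_lt (by omega)]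
    omega
  rw [Nat.choose_eq_zero_of_lt h2, zero_mul]

theorem neg_one_pow_prime_pow_mul (k a : ℕ) : (-1 : ZMod p) ^ (p ^ k * a) = (-1) ^ a := by
  rw [pow_mul]
  congr 1
  rcases hp.out.eq_two_or_odd' with h | h
  · subst h
    rw [show (-1 : ZMod 2) = 1 from rfl, one_pow]
  · exact h.pow.neg_one_pow

/-- In the Adem relation for `P ^ a P ^ b` on the class of an `m`-th tensor power, `m = p ^ k`, the
coefficients with `m ∤ b` vanish. -/
theorem adem_coefficient_eq_zero {k a b j : ℕ} (hab : a < p * b) (hj : p * j ≤ a)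
    (hqj : p ^ k ∣ j) (hq : p ^ k ∣ a + b) (hb : ¬ p ^ k ∣ b) :
    (((p - 1) * (b - j) - 1).choose (a - p * j) : ZMod p) = 0 := by
  have hp0 := hp.out.pos
  have hb0 : b ≠ 0 := fun h => hb (h ▸ dvd_zero _)
  obtain ⟨v, b', hpb', rfl⟩ := Nat.exists_eq_pow_mul_and_not_dvd hb0 p hp.out.ne_one
  have hvk : v < k := by
    by_contra hvk
    exact hb (dvd_mul_of_dvd_left (pow_dvd_pow p (not_lt.1 hvk)) b')
  obtain ⟨l, rfl⟩ := Nat.exists_eq_add_of_lt hvk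
  obtain ⟨j', rfl⟩ := hqj
  obtain ⟨c, hc⟩ := hq
  have e1 : ∀ x, p ^ (v + l + 1) * x = p ^ v * (p * (p ^ l * x)) := fun x => by
    rw [pow_succ, pow_add]; ring
  obtain ⟨a', rfl⟩ : p ^ v ∣ a := by
    rw [← Nat.dvd_add_left (dvd_mul_right (p ^ v) b'), hc, e1]
    exact dvd_mul_right _ _
  have hpv := pow_pos hp0 v
  rw [e1] at hc hj ⊢
  rw [← mul_add] at hc
  replace hc := Nat.eq_of_mul_eq_mul_left hpv hc
  rw [mul_left_comm] at hab hj
  replace hab := lt_of_mul_lt_mul_left hab hpv.le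
  replace hj := le_of_mul_le_mul_left hj hpv
  have hlt : p * (p ^ l * j') < b' := lt_of_mul_lt_mul_left (hj.trans_lt hab) hp0.le
  have hM : 0 < (p - 1) * (b' - p * (p ^ l * j')) :=
    Nat.mul_pos (Nat.sub_pos_of_lt hp.out.one_lt) (Nat.sub_pos_of_lt hlt)
  rw [mul_left_comm p (p ^ v), ← Nat.mul_sub, ← Nat.mul_sub, mul_left_comm,
    choose_prime_pow_mul_sub_one v _ _ hM]
  have hpz : (p : ZMod p) = 0 := ZMod.natCast_self p
  have e2 : (a' : ZMod p) = -(b' : ZMod p) := by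
    have := congrArg (Nat.cast : ℕ → ZMod p) hc
    push_cast at this
    rw [hpz, zero_mul] at this
    exact eq_neg_of_add_eq_zero_left this
  refine choose_sub_one_eq_zero hM ?_ ?_
  · rw [Nat.cast_sub hj, Nat.cast_mul, Nat.cast_sub hlt.le, Nat.cast_sub hp.out.one_le]
    push_cast
    rw [hpz, e2]
    ring
  · rw [Nat.cast_sub hj, e2]
    push_cast
    rw [hpz, zero_mul, sub_zero, neg_ne_zero, ne_eq, ZMod.natCast_eq_zero_iff]
    exact hpb'

end Binomials

namespace SteenrodCAlg

section Degrees

variable {p : ℕ} (A : SteenrodCAlg.{u} p)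

theorem aqOne_isInternal : DirectSum.IsInternal (A.aqOps 1).deg := by
  have h1 : IsHomogeneousSub A.sym.sym.indec_isInternal (LinearMap.ker A.dOne) := by
    intro n c hc
    obtain ⟨s, -, rfl⟩ := A.sym.exists_toQ_genLin c
    change degProj _ n (A.chain s) ∈ _
    rw [degProj_chain]
    exact A.cycleSub_homogeneous n s hc
  have h2 : IsHomogeneousSub A.sym.sym.indec_isInternal (LinearMap.range A.dTwo) := by
    refine isHomogeneousSub_range A.sym.sym.sym.indec_isInternal A.sym.sym.indec_isInternal A.dTwo
      fun n c hc => ?_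
    rw [dTwo_eq]
    exact add_mem (sub_mem (mapIndec_mem_deg _ hc) (mapIndec_mem_deg _ hc)) (mapIndec_mem_deg _ hc)
  refine isInternal_quot (isInternal_sub A.sym.sym.indec_isInternal h1) (W := A.aqBoundaries 1) ?_
  intro n c hc
  change ((degProj (isInternal_sub A.sym.sym.indec_isInternal h1) n c : LinearMap.ker A.dOne) :
    A.sym.sym.Indec) ∈ LinearMap.range A.dTwo
  rw [degProj_sub A.sym.sym.indec_isInternal h1]
  exact h2 n _ hc

theorem exists_cls_of_deg {n : ℕ} {z : A.AQ 1} (hz : z ∈ (A.aqOps 1).deg n) :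
    ∃ s : A.cycleSub, (s : A.sym.carrier) ∈ A.sym.ops.deg n ∧ A.cls s = z := by
  obtain ⟨⟨c, hc⟩, hcn, rfl⟩ := hz
  obtain ⟨s, -, rfl⟩ := A.sym.exists_toQ_genLin c
  refine ⟨⟨degProj A.sym.isInternal n s, A.cycleSub_homogeneous n s hc⟩, degProj_mem _ n s, ?_⟩
  refine congrArg (A.aqBoundaries 1).mkQ (Subtype.ext ?_)
  refine (A.degProj_chain n s).symm.trans ?_
  exact degProj_of_mem A.sym.sym.indec_isInternal hcn

end Degrees

section Unstable

variable {p : ℕ} [hp : Fact p.Prime] {A : SteenrodCAlg.{u} p}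

theorem NilAt.powCls_sum {ι : Type*} {k n : ℕ} (hk : 0 < k) (s : Finset ι) (c : ι → ZMod p)
    (x : ι → A.carrier) (hn : 0 < n) (hev : IsEvenDeg p n) (hx : ∀ i ∈ s, A.NilAt k n (x i)) :
    A.NilAt k n (∑ i ∈ s, c i • x i) ∧
      A.powCls k (∑ i ∈ s, c i • x i) = ∑ i ∈ s, c i • A.powCls k (x i) := by
  classical
  induction s using Finset.induction_on with
  | empty =>
    rw [Finset.sum_empty, Finset.sum_empty, powCls_zero]
    exact ⟨NilAt.zero k hn hev, rfl⟩
  | insert i s hi ih =>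
    have h1 := ih fun j hj => hx j (Finset.mem_insert_of_mem hj)
    have h2 := hx i (Finset.mem_insert_self i s)
    rw [Finset.sum_insert hi, Finset.sum_insert hi, (h2.smul (c i)).powCls_add h1.1 hk,
      h2.powCls_smul _ hk, h1.2]
    exact ⟨(h2.smul (c i)).add h1.1, rfl⟩

/-- The Adem relations on the classes of tensor powers follow from those in `A`, because their
coefficients are compatible with multiplication of all indices by a power of `p`. -/
theorem NilAt.adem_powCls (hA : A.IsUnstable) {k n : ℕ} {x : A.carrier} (hx : A.NilAt k n x)
    (hk : 0 < k) {a b : ℕ} (hab : a < p * b) :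
    (A.aqOps 1).P a ((A.aqOps 1).P b (A.powCls k x)) =
      ∑ j ∈ Finset.range (a / p + 1),
        ((-1 : ZMod p) ^ (a + j) * (((p - 1) * (b - j) - 1).choose (a - p * j) : ℕ)) •
          (A.aqOps 1).P (a + b - j) ((A.aqOps 1).P j (A.powCls k x)) := by
  have hp0 := hp.out.pos
  have hq := pow_pos hp0 k
  have hPP : ∀ i j, (A.aqOps 1).P i ((A.aqOps 1).P j (A.powCls k x)) =
      if p ^ k ∣ i ∧ p ^ k ∣ j then A.powCls k (A.ops.P (i / p ^ k) (A.ops.P (j / p ^ k) x))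
      else 0 := by
    intro i j
    rw [hx.P_powCls hk]
    by_cases hj : p ^ k ∣ j
    · rw [if_pos hj, (hx.P _).P_powCls hk]
      simp only [hj, and_true]
    · rw [if_neg hj, if_neg fun h => hj h.2, map_zero]
  simp only [hPP]
  have hjle : ∀ j ∈ Finset.range (a / p + 1), p * j ≤ a := fun j hj => by
    rw [Finset.mem_range, Nat.lt_succ_iff, Nat.le_div_iff_mul_le hp0] at hj
    rwa [mul_comm]
  have hjb : ∀ j, p * j ≤ a → j < b := fun j hj =>
    lt_of_mul_lt_mul_left (hj.trans_lt hab) hp0.le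
  by_cases hqb : p ^ k ∣ b
  · by_cases hqa : p ^ k ∣ a
    · obtain ⟨b, rfl⟩ := hqb
      obtain ⟨a, rfl⟩ := hqa
      have hab' : a < p * b := by
        rw [mul_left_comm] at hab
        exact lt_of_mul_lt_mul_left hab hq.le
      rw [if_pos ⟨dvd_mul_right _ _, dvd_mul_right _ _⟩, Nat.mul_div_cancel_left _ hq,
        Nat.mul_div_cancel_left _ hq, hA.isUnstable.adem a b hab' x]
      have hle' : ∀ j ∈ Finset.range (a / p + 1), p * j ≤ a := fun j hj => by
        rw [Finset.mem_range, Nat.lt_succ_iff, Nat.le_div_iff_mul_le hp0] at hj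
        rwa [mul_comm]
      have hjb' : ∀ j, p * j ≤ a → j < b := fun j hj =>
        lt_of_mul_lt_mul_left (hj.trans_lt hab') hp0.le
      have hN : ∀ j ∈ Finset.range (a / p + 1),
          A.NilAt k (n + degP p (a + b)) (A.ops.P (a + b - j) (A.ops.P j x)) := fun j hj => by
        have h := (hx.P j).P (a + b - j)
        rwa [add_assoc, ← degP_add, Nat.add_sub_of_le] at h
        have := hjb' j (hle' j hj)
        omega
      rw [(NilAt.powCls_sum hk _ _ _ (Nat.add_pos_left hx.pos _) (hx.even.add_degP _) hN).2]
      symm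
      -- only the indices divisible by `p ^ k` contribute
      refine Finset.sum_of_injOn (fun j => p ^ k * j) ?_ ?_ ?_ ?_ |>.symm
      · intro i _ j _ h
        exact Nat.eq_of_mul_eq_mul_left hq h
      · intro j hj
        have := hle' j hj
        simp only [Finset.coe_range, Set.mem_Iio, Nat.lt_succ_iff, Nat.le_div_iff_mul_le hp0]
        calc p ^ k * j * p = p ^ k * (p * j) := by ring
          _ ≤ p ^ k * a := Nat.mul_le_mul_left _ this
      · intro j hj hj'
        rw [if_neg, smul_zero]
        rintro ⟨-, j, rfl⟩
        refine hj' ⟨j, ?_, rfl⟩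
        have := hjle _ hj
        rw [mul_left_comm] at this
        simp only [Finset.coe_range, Set.mem_Iio, Nat.lt_succ_iff, Nat.le_div_iff_mul_le hp0]
        rw [mul_comm]
        exact le_of_mul_le_mul_left this hq
      · intro j hj
        have h1 := hle' j hj
        have h2 := hjb' j h1
        have hM : 0 < (p - 1) * (b - j) :=
          Nat.mul_pos (Nat.sub_pos_of_lt hp.out.one_lt) (Nat.sub_pos_of_lt h2)
        rw [← mul_add, ← Nat.mul_sub, ← mul_add, ← Nat.mul_sub, mul_left_comm p,
          ← Nat.mul_sub, mul_left_comm (p - 1), choose_prime_pow_mul_sub_one k _ _ hM,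
          neg_one_pow_prime_pow_mul, if_pos ⟨dvd_mul_right _ _, dvd_mul_right _ _⟩,
          Nat.mul_div_cancel_left _ hq, Nat.mul_div_cancel_left _ hq]
    · rw [if_neg fun h => hqa h.1]
      refine (Finset.sum_eq_zero fun j hj => ?_).symm
      rw [if_neg, smul_zero]
      rintro ⟨h1, h2⟩
      have h3 := hjb j (hjle j hj)
      have h4 : p ^ k ∣ a + b := by
        have := dvd_add h1 h2
        rwa [Nat.sub_add_cancel (by omega)] at this
      exact hqa ((Nat.dvd_add_left hqb).1 h4)
  · rw [if_neg fun h => hqb h.2]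
    refine (Finset.sum_eq_zero fun j hj => ?_).symm
    split_ifs with h
    · have h3 := hjb j (hjle j hj)
      have h4 : p ^ k ∣ a + b := by
        have := dvd_add h.1 h.2
        rwa [Nat.sub_add_cancel (by omega)] at this
      rw [adem_coefficient_eq_zero hab (hjle j hj) h.2 h4 hqb, mul_zero, zero_smul]
    · rw [smul_zero]

/-- `H_1` is an unstable module. -/
theorem BorelSystem.aqOne_isUnstable (b : A.BorelSystem) (hA : A.IsUnstable) :
    (A.aqOps 1).IsUnstable := by
  have hext : ∀ f g : A.AQ 1 →ₗ[ZMod p] A.AQ 1,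
      (∀ k n x, 0 < k → A.NilAt k n x → f (A.powCls k x) = g (A.powCls k x)) → f = g := by
    intro f g h
    refine LinearMap.ext_on b.span_powCls ?_
    rintro _ ⟨k, i, hi, rfl⟩
    exact h k _ _ hi.1 (b.nilAt hi)
  have hβP : ∀ i z, (A.aqOps 1).β ((A.aqOps 1).P i z) = 0 := by
    intro i z
    have : (A.aqOps 1).β ∘ₗ (A.aqOps 1).P i = 0 := by
      refine hext _ _ fun k n x hk hx => ?_
      rw [LinearMap.comp_apply, hx.P_powCls hk]
      split_ifs
      · exact (hx.P _).β_powCls hk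
      · rw [map_zero]; rfl
    exact LinearMap.congr_fun this z
  have hP0 : ∀ z, (A.aqOps 1).P 0 z = z := by
    intro z
    have : (A.aqOps 1).P 0 = LinearMap.id := by
      refine hext _ _ fun k n x hk hx => ?_
      rw [hx.P_powCls hk, if_pos (dvd_zero _), Nat.zero_div, A.P_zero]
      rfl
    exact LinearMap.congr_fun this z
  have hβ : ∀ z, (A.aqOps 1).β z = 0 := fun z => by rw [← hP0 z]; exact hβP 0 z
  have hinst : ∀ m i,
      (∀ k n x, A.NilAt k n x → p ^ k ∣ i → p ^ k * n = m → A.ops.P (i / p ^ k) x = 0) →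
      ∀ z ∈ (A.aqOps 1).deg m, (A.aqOps 1).P i z = 0 := by
    intro m i h z hz
    have h1 := mem_span_of_mem_deg A.aqOne_isInternal
      (s := {z | ∃ k i, i ∈ b.truncated k ∧ A.powCls k (b.g i).val = z}) (by
        rintro _ ⟨k, j, hj, rfl⟩
        exact ⟨_, (b.nilAt hj).powCls_mem hj.1⟩) (x := z) (by rw [b.span_powCls]; trivial) hz
    clear hz
    induction h1 using Submodule.span_induction with
    | mem z hz =>
      obtain ⟨⟨k, j, hj, rfl⟩, hz⟩ := hz
      have hx := b.nilAt hj
      by_cases hm : p ^ k * (b.g j).d = m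
      · rw [hx.P_powCls hj.1]
        split_ifs with hi
        · rw [h k _ _ hx hi hm, powCls_zero]
        · rfl
      · have h2 := degProj_of_mem A.aqOne_isInternal hz
        rw [degProj_of_mem_ne A.aqOne_isInternal hm (hx.powCls_mem hj.1)] at h2
        rw [← h2, map_zero]
    | zero => exact map_zero _
    | add x y _ _ h1 h2 => rw [map_add, h1, h2, add_zero]
    | smul c x _ h => rw [map_smul, h, smul_zero]
  refine
    { isInternal := A.aqOne_isInternal
      P_mem := ?_
      β_mem := ?_
      P_zero := hP0
      β_two := ?_
      β_β := fun z => hβ _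
      adem := ?_
      adem_β := ?_
      unstable_two := ?_
      unstable_odd := ?_
      unstable_odd_β := fun _ _ _ _ _ _ => hβ _ }
  · intro i n z hz
    obtain ⟨s, hs, rfl⟩ := A.exists_cls_of_deg hz
    rw [cls_P]
    exact A.cls_mem_deg (A.sym.P_mem i hs)
  · intro n z hz
    rw [hβ]; exact zero_mem _
  · intro h2 z
    have : (A.aqOps 1).P 1 = 0 := by
      refine hext _ _ fun k n x hk hx => ?_
      rw [hx.P_powCls hk, if_neg]
      · rfl
      · rw [Nat.dvd_one]
        exact (Nat.one_lt_pow hk.ne' hp.out.one_lt).ne'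
    rw [hβ, this]; rfl
  · intro a c hac z
    have : (A.aqOps 1).P a ∘ₗ (A.aqOps 1).P c = ∑ j ∈ Finset.range (a / p + 1),
        ((-1 : ZMod p) ^ (a + j) * (((p - 1) * (c - j) - 1).choose (a - p * j) : ℕ)) •
          ((A.aqOps 1).P (a + c - j) ∘ₗ (A.aqOps 1).P j) := by
      refine hext _ _ fun k n x hk hx => ?_
      rw [LinearMap.comp_apply, LinearMap.sum_apply, hx.adem_powCls hA hk hac]
      rfl
    have h := LinearMap.congr_fun this z
    rw [LinearMap.sum_apply] at h
    exact h
  · intro _ a c _ _ z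
    simp only [hβ, map_zero, smul_zero, Finset.sum_const_zero, add_zero]
  · intro h2 n i z hz hni
    refine hinst n i (fun k m x hx hi hm => ?_) z hz
    obtain ⟨i, rfl⟩ := hi
    rw [Nat.mul_div_cancel_left _ (pow_pos hp.out.pos k)]
    refine hA.isUnstable.unstable_two h2 m i x hx.mem ?_
    rw [← hm] at hni
    exact lt_of_mul_lt_mul_left hni (Nat.zero_le _)
  · intro h2 n i z hz hni
    refine hinst n i (fun k m x hx hi hm => ?_) z hz
    obtain ⟨i, rfl⟩ := hi
    rw [Nat.mul_div_cancel_left _ (pow_pos hp.out.pos k)]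
    refine hA.isUnstable.unstable_odd h2 m i x hx.mem ?_
    rw [← hm, mul_left_comm] at hni
    exact lt_of_mul_lt_mul_left hni (Nat.zero_le _)

end Unstable

end SteenrodCAlg

/-! ### Finitely many truncated generators suffice -/

namespace SteenrodData

variable {p : ℕ} [hp : Fact p.Prime] {V : Type u} [AddCommGroup V] [Module (ZMod p) V]
  {D : SteenrodData p V}

theorem IsUnstable.opsAndProj_mem (h : D.IsUnstable) {W : Submodule (ZMod p) V}
    (hP : ∀ i, ∀ x ∈ W, D.P i x ∈ W) (hW : IsHomogeneousSub h.isInternal W) :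
    ∀ i, ∀ x ∈ W, D.opsAndProj h.isInternal i x ∈ W := by
  rintro (i | n) x hx
  · exact hP i x hx
  · exact hW n x hx

/-- Over the operations `P i`, a homogeneous set generates the same submodule as a finite subset. -/
theorem IsUnstable.exists_finset_spanP_eq (h : D.IsUnstable) (hfg : D.FG) {s : Set V}
    (hs : ∀ x ∈ s, ∃ n, x ∈ D.deg n) : ∃ t : Finset V, ↑t ⊆ s ∧ s ⊆ D.spanP (t : Set V) := by
  have := h.isNoetherian hfg
  obtain ⟨t, ht, hst⟩ := (Submodule.fg_span_iff_fg_span_finset_subset (R := FreeAlgebra (ZMod p)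
    (ℕ ⊕ ℕ)) (OpMod.mk (D.opsAndProj h.isInternal) '' s)).1 (IsNoetherian.noetherian _)
  let t' : Set V := {x | OpMod.mk (D.opsAndProj h.isInternal) x ∈ t}
  have ht' : t' ⊆ s := fun x hx => by
    obtain ⟨y, hy, rfl⟩ := ht hx
    exact hy
  refine ⟨t, ht', fun x hx => ?_⟩
  have h1 : OpMod.mk (D.opsAndProj h.isInternal) x ∈ Submodule.span (FreeAlgebra (ZMod p)
      (ℕ ⊕ ℕ)) (t : Set (OpMod (D.opsAndProj h.isInternal))) := by
    rw [← hst]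
    exact Submodule.subset_span ⟨x, hx, rfl⟩
  have h2 : Submodule.span (FreeAlgebra (ZMod p) (ℕ ⊕ ℕ))
      (t : Set (OpMod (D.opsAndProj h.isInternal))) ≤ OpMod.ofStable (D.spanP t')
      (h.opsAndProj_mem (D.spanP_stable _) (isHomogeneousSub_spanP h.isInternal h.P_mem
        fun x hx => hs x (ht' hx))) :=
    Submodule.span_le.2 fun y hy => D.subset_spanP t' hy
  exact h2 h1

/-- Ascending chains of homogeneous subspaces that are stable under the `P i` become stationary. -/
theorem IsUnstable.exists_stationary (h : D.IsUnstable) (hfg : D.FG)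
    {N : ℕ → Submodule (ZMod p) V} (hmono : Monotone N)
    (hP : ∀ k, ∀ i, ∀ x ∈ N k, D.P i x ∈ N k)
    (hN : ∀ k, IsHomogeneousSub h.isInternal (N k)) : ∃ K, ∀ k, K ≤ k → N k = N K := by
  have := h.isNoetherian hfg
  let f : ℕ →o Submodule (FreeAlgebra (ZMod p) (ℕ ⊕ ℕ)) (OpMod (D.opsAndProj h.isInternal)) :=
    ⟨fun k => OpMod.ofStable (N k) (h.opsAndProj_mem (hP k) (hN k)), fun _ _ hkl _ hx =>
      hmono hkl hx⟩
  obtain ⟨K, hK⟩ := monotone_stabilizes_iff_noetherian.2 this f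
  refine ⟨K, fun k hk => ?_⟩
  ext x
  have h1 := hK k hk
  have h2 : OpMod.mk (D.opsAndProj h.isInternal) x ∈ f K ↔ OpMod.mk _ x ∈ f k := by rw [h1]
  exact h2.symm

end SteenrodData

namespace SteenrodCAlg

namespace BorelSystem

variable {p : ℕ} [hp : Fact p.Prime] {A : SteenrodCAlg.{u} p} (b : A.BorelSystem)

variable (A) in
/-- The span in `QA` of the classes of the elements with vanishing `p ^ k`-th power. -/
noncomputable def nilClasses (k : ℕ) : Submodule (ZMod p) A.Indec :=
  Submodule.span (ZMod p) (A.toQ '' {x | ∃ n, A.NilAt k n x})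

/-- The heights of the truncated generators are bounded. -/
theorem exists_bound (hA : A.IsUnstable) (hfg : A.FG) :
    ∃ K, ∀ k, K < k → ∀ i, i ∉ b.truncated k := by
  obtain ⟨K, hK⟩ := hA.indec.exists_stationary hfg.indec (N := nilClasses A)
    (fun k l hkl => Submodule.span_mono (Set.image_mono fun x ⟨n, hx⟩ => ⟨n, hx.mono hkl⟩))
    (fun k i v hv => by
      induction hv using Submodule.span_induction with
      | mem v hv =>
        obtain ⟨x, ⟨n, hx⟩, rfl⟩ := hv
        rw [← toQ_P]
        exact Submodule.subset_span ⟨_, ⟨_, hx.P i⟩, rfl⟩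
      | zero => rw [map_zero]; exact zero_mem _
      | add x y _ _ h1 h2 => rw [map_add]; exact add_mem h1 h2
      | smul c x _ h => rw [map_smul]; exact Submodule.smul_mem _ c h)
    (fun k => isHomogeneousSub_span _ (by
      rintro _ ⟨x, ⟨n, hx⟩, rfl⟩
      exact ⟨n, A.toQ_mem_deg hx.mem⟩))
  refine ⟨K, fun k hk i hi => ?_⟩
  have h1 : A.toQ (b.g i).val ∈ nilClasses A k :=
    Submodule.subset_span ⟨_, ⟨_, b.nilAt hi⟩, rfl⟩
  rw [hK k hk.le, nilClasses, Submodule.span_image] at h1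
  obtain ⟨y, hy, hyi⟩ := h1
  have hya : y ∈ A.augIdeal :=
    (Submodule.span_le (p := A.augIdeal)).2 (fun _ (hx : ∃ n, A.NilAt K n _) =>
      hx.elim fun _ h => h.mem_augIdeal) hy
  have h2 : y - (b.g i).val ∈ A.decSub := by
    rw [← A.toQ_eq_zero_iff (sub_mem hya (b.g i).mem_augIdeal), map_sub, hyi, sub_self]
  have h3 := b.coef_single_of_mem_decSub h2 i
  have h4 : b.coef (b.g i).val (Finsupp.single i 1) = 1 := by
    have := b.coef_mono (b.good_single i)
    rw [mono_single, pow_one] at this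
    rw [this, Finsupp.single_eq_same]
  have h5 : b.coef y (Finsupp.single i 1) = 0 := by
    clear hyi hya h2 h3
    induction hy using Submodule.span_induction with
    | mem x hx =>
      obtain ⟨n, hx⟩ := hx
      by_contra hne
      refine b.not_good_of_pow_eq_zero hx.even hx.mem hx.pow_eq_zero hne fun j => ?_
      classical
      rw [Finsupp.smul_single, smul_eq_mul, mul_one, Finsupp.single_apply]
      split_ifs with hij
      · subst hij
        rw [hi.2]
        exact_mod_cast Nat.pow_lt_pow_right hp.out.one_lt hk
      · exact lt_trans (by norm_num) (b.one_lt_height j)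
    | zero => simp
    | add x y _ _ h1 h2 => rw [map_add, Finsupp.add_apply, h1, h2, add_zero]
    | smul c x _ h => rw [map_smul, Finsupp.smul_apply, h, smul_zero]
  rw [map_sub, Finsupp.sub_apply, h4, h5, zero_sub, neg_eq_zero] at h3
  exact one_ne_zero h3

/-- Elements of `S(A)` with the same image in `A` have powers with the same class. -/
theorem clsOf_pow_eq {n k : ℕ} (hk : 0 < k) (hn : 0 < n) (hev : IsEvenDeg p n)
    {s t : A.sym.carrier} (hs : s ∈ A.sym.ops.deg n) (ht : t ∈ A.sym.ops.deg n)
    (hst : A.counit.toAlgHom s = A.counit.toAlgHom t) (h0 : A.counit.toAlgHom s ^ p ^ k = 0) :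
    A.clsOf (s ^ p ^ k) = A.clsOf (t ^ p ^ k) := by
  have hq : 1 < p ^ k := Nat.one_lt_pow hk.ne' hp.out.one_lt
  have hcyc : ∀ u ∈ A.sym.ops.deg n, A.counit.toAlgHom u ^ p ^ k = 0 → u ^ p ^ k ∈ A.cycleSub :=
    fun u hu hu0 => A.mem_cycleSub_of (pow_mem_decSub (A.sym.mem_augIdeal_of_deg hn hu) hq)
      ((map_pow A.counit.toAlgHom u _).trans hu0)
  have h1 : s ^ p ^ k - t ^ p ^ k ∈ kerProducts A := by
    rw [← sub_pow_prime_pow_of_commute (A.sym.commute_of_isEvenDeg hev hs t)]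
    obtain ⟨m, hm⟩ := Nat.exists_eq_add_of_lt hq
    have hsub : s - t ∈ A.sym.augIdeal := A.sym.mem_augIdeal_of_deg hn (sub_mem hs ht)
    rw [hm, add_comm 1 m, pow_succ']
    refine Submodule.subset_span ⟨_, hsub, (s - t) ^ (m + 1), ?_, Or.inl ?_, rfl⟩
    · rw [pow_succ']
      exact A.sym.mul_mem_augIdeal _ hsub
    · exact (map_sub A.counit.toAlgHom s t).trans (sub_eq_zero.2 hst)
  have ht0 : t ^ p ^ k ∈ A.cycleSub := hcyc t ht (hst ▸ h0)
  have h2 := A.clsOf_add (kerProducts_le h1) ht0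
  rw [sub_add_cancel, clsOf_kerProducts h1, zero_add] at h2
  exact h2

/-- The class of the tensor power of a decomposable monomial is zero or, up to a scalar, the class
of the tensor power of a truncated generator of smaller degree. -/
theorem powCls_mono {n k : ℕ} (hk : 0 < k) (hev : IsEvenDeg p n) {e : b.idx →₀ ℕ}
    (he : monoDeg b.g e = n) (hdeg : 2 ≤ Finsupp.degree e) (hg : ¬ b.Good (p ^ k • e)) :
    A.powCls k (mono b.g e) = 0 ∨ ∃ l j, j ∈ b.truncated l ∧ (b.g j).d < n ∧
      ∃ c : ZMod p, A.powCls k (mono b.g e) = c • A.powCls l (b.g j).val := by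
  have hn : 0 < n := by
    rw [← he]
    refine Nat.pos_of_ne_zero fun h => ?_
    rw [(monoDeg_eq_zero_iff b.g).1 h, map_zero] at hdeg
    omega
  have hmem : mono b.g e ∈ A.ops.deg n := he ▸ mono_mem b.g e
  have hmem' : mono b.unitGen e ∈ A.sym.ops.deg n := he ▸ mono_mem b.unitGen e
  have h0 : mono b.g e ^ p ^ k = 0 := by
    obtain ⟨c, hc, h⟩ := mono_nsmul b.g (p ^ k) e
    rw [b.mono_eq_zero hg] at h
    exact (smul_eq_zero.1 h.symm).resolve_left hc
  have haug : mono b.g e ∈ A.augIdeal := A.mem_augIdeal_of_deg hn hmem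
  obtain ⟨c, hc, h⟩ := mono_nsmul b.unitGen (p ^ k) e
  have h1 : A.powCls k (mono b.g e) = A.clsOf (c⁻¹ • mono b.unitGen (p ^ k • e)) := by
    rw [powCls, h, smul_smul, inv_mul_cancel₀ hc, one_smul]
    refine clsOf_pow_eq hk hn hev (A.genLin_mem_deg hmem) hmem' ?_ ?_
    · rw [A.counit_genLin haug, b.counit_mono]
    · rw [A.counit_genLin haug, h0]
  rw [h1]
  rcases b.mono_unitGen_of_not_good hg with h2 | ⟨l, j, hj, h2⟩
  · exact Or.inl (clsOf_kerProducts (Submodule.smul_mem _ _ h2))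
  · refine Or.inr ⟨l, j, hj, ?_, c⁻¹, ?_⟩
    · have hq := pow_pos hp.out.pos k
      have h3 : e = Finsupp.single j (e j) := by
        classical
        ext i
        have := DFunLike.congr_fun h2 i
        rw [Finsupp.smul_apply, smul_eq_mul, Finsupp.single_apply] at this
        rw [Finsupp.single_apply]
        split_ifs at this ⊢ with hij
        · rw [hij]
        · exact (Nat.mul_eq_zero.1 this).resolve_left hq.ne'
      rw [h3, Finsupp.degree_single] at hdeg
      rw [← he, h3, monoDeg_single]
      have := (b.g j).pos
      nlinarith
    · rw [h2, mono_single, unitGen_val, A.clsOf_smul _ ((b.nilAt hj).pow_mem_cycleSub hj.1)]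
      rfl

/-- If, for each `k`, the generators in `J` of height `p ^ k` generate the same submodule of `QA` as
all generators of height `p ^ k`, then the tensor powers of the generators in `J` generate `H_1`. -/
theorem span_powCls_eq_top {J : Set b.idx}
    (hJ : ∀ k, (fun i => (b.g i).toIndec) '' b.truncated k ⊆
      (A.indecOps.spanP ((fun i => (b.g i).toIndec) '' (J ∩ b.truncated k)) : Set A.Indec)) :
    (A.aqOps 1).span
      {z | ∃ i ∈ J, ∃ k, ∃ _ : i ∈ b.truncated k, z = A.powCls k (b.g i).val} = ⊤ := by
  set Z := {z | ∃ i ∈ J, ∃ k, ∃ _ : i ∈ b.truncated k, z = A.powCls k (b.g i).val} with hZ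
  set W := (A.aqOps 1).span Z with hW
  have hst := (A.aqOps 1).span_stable Z
  -- by induction on the degree of a truncated generator, the class of its tensor power lies in `W`
  have key : ∀ n k i, i ∈ b.truncated k → (b.g i).d = n → A.powCls k (b.g i).val ∈ W := by
    intro n
    induction n using Nat.strong_induction_on with
    | _ n ih =>
      intro k i hi hin
      have hk := hi.1
      have hx := b.nilAt hi
      rw [hin] at hx
      -- the classes in `QA` of the elements whose tensor power has its class in `W`
      set U := Submodule.span (ZMod p)
        (A.toQ '' {x | ∃ m, A.NilAt k m x ∧ A.powCls k x ∈ W}) with hU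
      have h1 : A.indecOps.spanP ((fun i => (b.g i).toIndec) '' (J ∩ b.truncated k)) ≤ U := by
        refine A.indecOps.spanP_le (fun j v hv => ?_) ?_
        · induction hv using Submodule.span_induction with
          | mem v hv =>
            obtain ⟨x, ⟨m, hx, hxW⟩, rfl⟩ := hv
            rw [← toQ_P]
            refine Submodule.subset_span ⟨_, ⟨_, hx.P j, ?_⟩, rfl⟩
            have h2 := hst.1 (p ^ k * j) _ hxW
            rwa [hx.P_powCls hk, if_pos (dvd_mul_right _ _),
              Nat.mul_div_cancel_left _ (pow_pos hp.out.pos k)] at h2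
          | zero => rw [map_zero]; exact zero_mem _
          | add x y _ _ h1 h2 => rw [map_add]; exact add_mem h1 h2
          | smul c x _ h => rw [map_smul]; exact Submodule.smul_mem _ c h
        · rintro _ ⟨j, ⟨hjJ, hj⟩, rfl⟩
          refine Submodule.subset_span ⟨(b.g j).val, ⟨_, b.nilAt hj, ?_⟩, A.toQ_val _⟩
          exact (A.aqOps 1).subset_span Z ⟨j, hjJ, k, hj, rfl⟩
      have h2 : A.toQ (b.g i).val ∈ U := by
        rw [A.toQ_val]
        exact h1 (hJ k ⟨i, hi, rfl⟩)
      have h3 := mem_span_of_mem_deg A.indec_isInternal (s := A.toQ '' _) (by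
        rintro _ ⟨x, ⟨m, hx, -⟩, rfl⟩
        exact ⟨m, A.toQ_mem_deg hx.mem⟩) h2 (A.toQ_mem_deg hx.mem)
      have h4 : ∃ x, A.NilAt k n x ∧ A.powCls k x ∈ W ∧ A.toQ x = A.toQ (b.g i).val := by
        refine Submodule.span_induction (p := fun v _ => ∃ x, A.NilAt k n x ∧ A.powCls k x ∈ W ∧
          A.toQ x = v) ?_ ?_ ?_ ?_ h3
        · rintro _ ⟨⟨x, ⟨m, hm, hmW⟩, rfl⟩, hxn⟩
          by_cases hmn : m = n
          · subst hmn
            exact ⟨x, hm, hmW, rfl⟩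
          · refine ⟨0, NilAt.zero k hx.pos hx.even, ?_, ?_⟩
            · rw [powCls_zero]; exact zero_mem _
            · rw [map_zero, ← degProj_of_mem A.indec_isInternal hxn, degProj_of_mem_ne
                A.indec_isInternal hmn (A.toQ_mem_deg hm.mem)]
        · exact ⟨0, NilAt.zero k hx.pos hx.even, by rw [powCls_zero]; exact zero_mem _, map_zero _⟩
        · rintro _ _ _ _ ⟨x, hx1, hx2, rfl⟩ ⟨y, hy1, hy2, rfl⟩
          exact ⟨x + y, hx1.add hy1, by rw [hx1.powCls_add hy1 hk]; exact add_mem hx2 hy2,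
            map_add _ _ _⟩
        · rintro c _ _ ⟨x, hx1, hx2, rfl⟩
          exact ⟨c • x, hx1.smul c, by rw [hx1.powCls_smul c hk]; exact Submodule.smul_mem _ c hx2,
            map_smul _ _ _⟩
      obtain ⟨x, hx1, hxW, hxi⟩ := h4
      -- the generator is `x` plus a decomposable element, whose monomials fall under `powCls_mono`
      set d := (b.g i).val + (-1 : ZMod p) • x with hd
      have hdn : A.NilAt k n d := hx.add (hx1.smul _)
      have hdd : d ∈ A.decSub := by
        rw [← A.toQ_eq_zero_iff hdn.mem_augIdeal, hd, map_add, map_smul, hxi, neg_one_smul,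
          add_neg_cancel]
      have hdW : A.powCls k d ∈ W := by
        have hsum := b.sum_coef d
        rw [Finsupp.sum] at hsum
        have he : ∀ e ∈ (b.coef d).support, monoDeg b.g e = n ∧ 2 ≤ Finsupp.degree e ∧
            ¬ b.Good (p ^ k • e) := fun e he => by
          have he := Finsupp.mem_support_iff.1 he
          exact ⟨b.monoDeg_of_coef_ne_zero hdn.mem he, b.two_le_degree_of_coef_ne_zero hdd he,
            b.not_good_of_pow_eq_zero hdn.even hdn.mem hdn.pow_eq_zero he⟩
        have h5 := (NilAt.powCls_sum hk (b.coef d).support (b.coef d) (mono b.g) hx.pos hx.even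
          fun e he' => ⟨hx.pos, hx.even, (he e he').1 ▸ mono_mem b.g e, by
            obtain ⟨c, hc, h⟩ := mono_nsmul b.g (p ^ k) e
            rw [b.mono_eq_zero (he e he').2.2] at h
            exact (smul_eq_zero.1 h.symm).resolve_left hc⟩).2
        rw [hsum] at h5
        rw [h5]
        refine Submodule.sum_mem _ fun e he' => Submodule.smul_mem _ _ ?_
        obtain ⟨h6, h7, h8⟩ := he e he'
        rcases b.powCls_mono hk hx.even h6 h7 h8 with h | ⟨l, j, hj, hjn, c, h⟩
        · rw [h]; exact zero_mem _
        · rw [h]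
          exact Submodule.smul_mem _ c (ih _ hjn l j hj rfl)
      have h9 : (b.g i).val = d + x := by rw [hd, neg_one_smul, neg_add_cancel_right]
      rw [h9, hdn.powCls_add hx1 hk]
      exact add_mem hdW hxW
  rw [eq_top_iff, ← b.span_powCls, Submodule.span_le]
  rintro _ ⟨k, i, hi, rfl⟩
  exact key _ k i hi rfl

/-- Finitely many truncated generators suffice in `QA` for each height, by Noetherianity, and in
all, because the heights are bounded. -/
theorem exists_finite_generators (hA : A.IsUnstable) (hfg : A.FG) : ∃ J : Set b.idx, J.Finite ∧
    (∀ i ∈ J, ∃ k, i ∈ b.truncated k) ∧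
    (∀ k, A.indecOps.spanP ((fun i => (b.g i).toIndec) '' (J ∩ b.truncated k)) =
      A.indecOps.spanP ((fun i => (b.g i).toIndec) '' b.truncated k)) ∧
    {z | ∃ i ∈ J, ∃ k, ∃ hi : i ∈ b.truncated k, z = b.powClass hi}.Finite ∧
    (A.aqOps 1).span {z | ∃ i ∈ J, ∃ k, ∃ hi : i ∈ b.truncated k, z = b.powClass hi} = ⊤ := by
  classical
  obtain ⟨K, hK⟩ := b.exists_bound hA hfg
  have h1 : ∀ k, ∃ t : Finset b.idx, ↑t ⊆ b.truncated k ∧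
      (fun i => (b.g i).toIndec) '' b.truncated k ⊆
        (A.indecOps.spanP ((fun i => (b.g i).toIndec) '' (t : Set b.idx)) : Set A.Indec) := by
    intro k
    obtain ⟨t, ht, h⟩ := hA.indec.exists_finset_spanP_eq hfg.indec
      (s := (fun i => (b.g i).toIndec) '' b.truncated k) (by
        rintro _ ⟨i, -, rfl⟩
        exact ⟨_, (A.toQ_val (b.g i)) ▸ A.toQ_mem_deg (b.g i).mem⟩)
    obtain ⟨t', ht', rfl⟩ := Finset.subset_set_image_iff.1 ht
    refine ⟨t', ht', ?_⟩
    rwa [Finset.coe_image] at h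
  choose t ht hspan using h1
  set J : Set b.idx := ⋃ k ∈ Set.Iic K, (t k : Set b.idx) with hJ
  have hJfin : J.Finite := (Set.finite_Iic K).biUnion fun k _ => (t k).finite_toSet
  have hJk : ∀ k, (fun i => (b.g i).toIndec) '' b.truncated k ⊆
      (A.indecOps.spanP ((fun i => (b.g i).toIndec) '' (J ∩ b.truncated k)) : Set A.Indec) := by
    intro k
    by_cases hk : K < k
    · rintro _ ⟨i, hi, rfl⟩
      exact absurd hi (hK k hk i)
    · refine (hspan k).trans (A.indecOps.spanP_le (A.indecOps.spanP_stable _) ?_)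
      refine Set.Subset.trans (Set.image_mono ?_) (A.indecOps.subset_spanP _)
      exact Set.subset_inter (Set.subset_biUnion_of_mem (u := fun k => (t k : Set b.idx))
        (not_lt.1 hk)) (ht k)
  refine ⟨J, hJfin, fun i hi => ?_, fun k => le_antisymm ?_ ?_, ?_, ?_⟩
  · obtain ⟨k, -, hi⟩ := Set.mem_iUnion₂.1 hi
    exact ⟨k, ht k hi⟩
  · exact A.indecOps.spanP_le (A.indecOps.spanP_stable _) ((Set.image_mono
      Set.inter_subset_right).trans (A.indecOps.subset_spanP _))
  · exact A.indecOps.spanP_le (A.indecOps.spanP_stable _) (hJk k)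
  · refine ((hJfin.prod (Set.finite_Iic K)).image
      fun ik : b.idx × ℕ => A.powCls ik.2 (b.g ik.1).val).subset ?_
    rintro _ ⟨i, hi, k, hik, rfl⟩
    refine ⟨(i, k), ⟨hi, ?_⟩, (b.powClass_eq hik).symm⟩
    by_contra hk
    exact hK k (not_le.1 hk) i hik
  · simp only [powClass_eq]
    exact b.span_powCls_eq_top hJk

end BorelSystem

end SteenrodCAlg

/-! ### Derivations of a Hopf algebra given by functionals on its indecomposables -/

namespace SteenrodCAlg

section Hopf

variable {p : ℕ} (A : SteenrodCAlg.{u} p)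

/-- The Koszul sign rule, with the sign in `ZMod p`. -/
theorem tmul_mul_tmul {i j : ℕ} (a b' : A.carrier) {b a' : A.carrier} (hb : b ∈ A.ops.deg j)
    (ha : a' ∈ A.ops.deg i) :
    (a ᵍ⊗ₜ[ZMod p] b * a' ᵍ⊗ₜ[ZMod p] b' : A.ops.deg ᵍ⊗[ZMod p] A.ops.deg) =
      (-1 : ZMod p) ^ (j * i) • ((a * a') ᵍ⊗ₜ[ZMod p] (b * b')) := by
  refine (GradedTensorProduct.tmul_coe_mul_coe_tmul A.ops.deg A.ops.deg a ⟨b, hb⟩ ⟨a', ha⟩ b').trans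
    ?_
  rw [show ((-1 : ℤˣ) ^ (j * i) : ℤˣ) = ((-1 : ℤˣ) ^ (j * i : ℕ)) from by
    simp]
  rcases Nat.even_or_odd (j * i) with h | h
  · rw [h.neg_one_pow, h.neg_one_pow, one_smul, one_smul]
  · rw [h.neg_one_pow, h.neg_one_pow, Units.neg_smul, one_smul, neg_smul, one_smul]

theorem smul_tmul_smul (c d : ZMod p) (a b : A.carrier) :
    ((c • a) ᵍ⊗ₜ[ZMod p] (d • b) : A.ops.deg ᵍ⊗[ZMod p] A.ops.deg) =
      (c * d) • (a ᵍ⊗ₜ[ZMod p] b) := by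
  rw [GradedTensorProduct.tmul, TensorProduct.smul_tmul_smul, map_smul]

theorem tmul_induction {P : (A.ops.deg ᵍ⊗[ZMod p] A.ops.deg) → Prop} (h0 : P 0)
    (hadd : ∀ u v, P u → P v → P (u + v))
    (hmem : ∀ i j, ∀ a ∈ A.ops.deg i, ∀ b ∈ A.ops.deg j, P (a ᵍ⊗ₜ[ZMod p] b))
    (u : A.ops.deg ᵍ⊗[ZMod p] A.ops.deg) : P u := by
  obtain ⟨v, rfl⟩ := (GradedTensorProduct.of (ZMod p) A.ops.deg A.ops.deg).surjective u
  induction v using TensorProduct.induction_on with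
  | zero => rwa [map_zero]
  | add u v h1 h2 => rw [map_add]; exact hadd _ _ h1 h2
  | tmul a b =>
    induction a using homogeneous_induction A.isInternal with
    | zero => rwa [TensorProduct.zero_tmul, map_zero]
    | add a a' h1 h2 => rw [TensorProduct.add_tmul, map_add]; exact hadd _ _ h1 h2
    | mem i a ha =>
      induction b using homogeneous_induction A.isInternal with
      | zero => rwa [TensorProduct.tmul_zero, map_zero]
      | add b b' h1 h2 => rw [TensorProduct.tmul_add, map_add]; exact hadd _ _ h1 h2
      | mem j b hb => exact hmem i j a ha b hb

/-- The slant product with a functional `F`, that is, the map `a ⊗ b ↦ F(b) a`. -/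
noncomputable def slant (F : A.carrier →ₗ[ZMod p] ZMod p) :
    (A.ops.deg ᵍ⊗[ZMod p] A.ops.deg) →ₗ[ZMod p] A.carrier :=
  (TensorProduct.rid (ZMod p) A.carrier).toLinearMap ∘ₗ LinearMap.lTensor A.carrier F ∘ₗ
    (GradedTensorProduct.of (ZMod p) A.ops.deg A.ops.deg).symm.toLinearMap

theorem slant_tmul (F : A.carrier →ₗ[ZMod p] ZMod p) (a b : A.carrier) :
    A.slant F (a ᵍ⊗ₜ[ZMod p] b) = F b • a := by
  simp [slant]

/-- Multiplication by `(-1) ^ (d n)` in degree `n`. -/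
noncomputable def sgn (d : ℕ) : A.carrier →ₗ[ZMod p] A.carrier :=
  degLift A.isInternal fun n => (-1 : ZMod p) ^ (d * n) • (A.ops.deg n).subtype

theorem sgn_of_mem (d : ℕ) {n : ℕ} {x : A.carrier} (hx : x ∈ A.ops.deg n) :
    A.sgn d x = (-1 : ZMod p) ^ (d * n) • x := by
  rw [sgn, degLift_of_mem _ _ hx]
  rfl

variable {A}

/-- Linear functionals that vanish outside degree `d`. -/
def SupportedIn (d : ℕ) (f : A.carrier →ₗ[ZMod p] ZMod p) : Prop :=
  ∀ n, n ≠ d → ∀ x ∈ A.ops.deg n, f x = 0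

variable (A) in
theorem exists_augmentation [Fact p.Prime] : ∃ ε : A.carrier →ₗ[ZMod p] ZMod p,
    SupportedIn 0 ε ∧ ε 1 = 1 ∧ ∀ x ∈ A.ops.deg 0, x = ε x • 1 := by
  obtain ⟨φ, hφ⟩ : ∃ φ : Module.Dual (ZMod p) A.carrier, φ 1 ≠ 0 := by
    by_contra! h
    exact A.nontrivial_one ((Module.forall_dual_apply_eq_zero_iff (ZMod p) _).1 h)
  have h1 : ((φ 1)⁻¹ • φ ∘ₗ degProj A.isInternal 0) 1 = 1 := by
    rw [LinearMap.smul_apply, LinearMap.comp_apply, degProj_of_mem _ A.one_mem_deg, smul_eq_mul,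
      inv_mul_cancel₀ hφ]
  refine ⟨(φ 1)⁻¹ • φ ∘ₗ degProj A.isInternal 0, fun n hn x hx => ?_, h1, fun x hx => ?_⟩
  · rw [LinearMap.smul_apply, LinearMap.comp_apply, degProj_of_mem_ne _ hn hx, map_zero, smul_zero]
  · rw [A.connected] at hx
    obtain ⟨c, rfl⟩ := Submodule.mem_span_singleton.1 hx
    rw [map_smul, h1, smul_eq_mul, mul_one]

/-- Slanting with a functional that vanishes on decomposable elements is a derivation relative to
slanting with the augmentation `ε`. -/
theorem slant_mul {ε f : A.carrier →ₗ[ZMod p] ZMod p} (hε : SupportedIn 0 ε)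
    (hε1 : ∀ x ∈ A.ops.deg 0, x = ε x • 1) {d : ℕ} (hd : 0 < d) (hf : SupportedIn d f)
    (hf0 : ∀ x ∈ A.decSub, f x = 0) (u v : A.ops.deg ᵍ⊗[ZMod p] A.ops.deg) :
    A.slant f (u * v) = A.slant ε u * A.slant f v + A.slant f u * A.sgn d (A.slant ε v) := by
  induction u using A.tmul_induction with
  | h0 => simp only [zero_mul, map_zero, add_zero]
  | hadd u u' h1 h2 =>
    rw [add_mul, map_add, map_add, map_add, h1, h2, add_mul, add_mul]
    abel
  | hmem i j a ha b hb =>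
    induction v using A.tmul_induction with
    | h0 => simp only [mul_zero, map_zero, add_zero]
    | hadd v v' h1 h2 =>
      rw [mul_add, map_add, map_add, map_add, map_add, h1, h2, mul_add, mul_add]
      abel
    | hmem i' j' a' ha' b' hb' =>
      rw [A.tmul_mul_tmul a b' hb ha', map_smul]
      simp only [slant_tmul, map_smul]
      rw [A.sgn_of_mem d ha']
      rcases Nat.eq_zero_or_pos j with rfl | hj
      · have h1 := hε1 b hb
        have e : f (b * b') = ε b * f b' := by
          conv_lhs => rw [h1, smul_mul_assoc, one_mul, map_smul, smul_eq_mul]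
        rw [hf 0 hd.ne b hb, e, zero_mul, pow_zero, one_smul, zero_smul, zero_mul, add_zero,
          smul_mul_smul_comm]
      · rcases Nat.eq_zero_or_pos j' with rfl | hj'
        · have h1 := hε1 b' hb'
          have e : f (b * b') = ε b' * f b := by
            conv_lhs => rw [h1, mul_smul_comm, mul_one, map_smul, smul_eq_mul]
          rw [e, hε j hj.ne' b hb, zero_smul, zero_mul, zero_add]
          by_cases hjd : j = d
          · subst hjd
            simp only [smul_mul_assoc, mul_smul_comm, smul_smul]
            congr 1
            ring
          · rw [hf j hjd b hb, mul_zero, zero_smul, smul_zero, zero_smul, zero_mul]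
        · rw [hf0 _ (A.mul_mem_decSub (A.mem_augIdeal_of_deg hj hb)
            (A.mem_augIdeal_of_deg hj' hb')), hε j hj.ne' b hb, hε j' hj'.ne' b' hb']
          simp

variable (A) in
/-- The part of total degree `n` of `A ⊗ A`. -/
noncomputable def totDeg (n : ℕ) : Submodule (ZMod p) (A.ops.deg ᵍ⊗[ZMod p] A.ops.deg) :=
  Submodule.span (ZMod p) {z | ∃ i j : ℕ, i + j = n ∧
    ∃ a ∈ A.ops.deg i, ∃ b ∈ A.ops.deg j, z = a ᵍ⊗ₜ[ZMod p] b}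

/-- Graded commutativity of `A ⊗ A`, in an even total degree. -/
theorem commute_of_mem_totDeg {n : ℕ} (hn : IsEvenDeg p n)
    {u v : A.ops.deg ᵍ⊗[ZMod p] A.ops.deg} (hu : u ∈ A.totDeg n) (hv : v ∈ A.totDeg n) :
    Commute u v := by
  induction hu using Submodule.span_induction with
  | mem u hu =>
    obtain ⟨i, j, hij, a, ha, b, hb, rfl⟩ := hu
    induction hv using Submodule.span_induction with
    | mem v hv =>
      obtain ⟨i', j', hij', a', ha', b', hb', rfl⟩ := hv
      change _ * _ = _ * _
      rw [A.tmul_mul_tmul a b' hb ha', A.tmul_mul_tmul a' b hb' ha, A.graded_comm ha ha',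
        A.graded_comm hb hb', A.smul_tmul_smul, smul_smul]
      congr 1
      have h1 : (-1 : ZMod p) ^ (j * i') * ((-1) ^ (i * i') * (-1) ^ (j * j')) * (-1) ^ (j' * i) =
          1 := by
        have h3 : j * i' + (i * i' + j * j') + j' * i = n * n := by
          calc _ = (i + j) * (i' + j') := by ring
            _ = n * n := by rw [hij, hij']
        rw [← pow_add, ← pow_add, ← pow_add, h3]
        exact (hn.mul_right n).neg_one_pow
      have h2 : (-1 : ZMod p) ^ (j' * i) * (-1) ^ (j' * i) = 1 := by
        rw [← pow_add, Even.neg_one_pow ⟨_, rfl⟩]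
      calc _ = (-1 : ZMod p) ^ (j * i') * ((-1) ^ (i * i') * (-1) ^ (j * j')) *
          ((-1 : ZMod p) ^ (j' * i) * (-1) ^ (j' * i)) := by rw [h2, mul_one]
        _ = _ := by rw [← mul_assoc, h1, one_mul]
    | zero => exact Commute.zero_right _
    | add x y _ _ h1 h2 => exact h1.add_right h2
    | smul c x _ h => exact h.smul_right c
  | zero => exact Commute.zero_left _
  | add x y _ _ h1 h2 => exact h1.add_left h2
  | smul c x _ h => exact h.smul_left c

theorem tmul_pow {i j : ℕ} (hj : IsEvenDeg p j) {a b : A.carrier} (ha : a ∈ A.ops.deg i)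
    (hb : b ∈ A.ops.deg j) (m : ℕ) :
    (a ᵍ⊗ₜ[ZMod p] b : A.ops.deg ᵍ⊗[ZMod p] A.ops.deg) ^ m = (a ^ m) ᵍ⊗ₜ[ZMod p] (b ^ m) := by
  induction m with
  | zero => rw [pow_zero, pow_zero, pow_zero]; rfl
  | succ m ih =>
    rw [pow_succ', ih, A.tmul_mul_tmul a (b ^ m) hb (A.pow_mem_deg ha m),
      (hj.mul_right _).neg_one_pow, one_smul, pow_succ', pow_succ']

variable [hp : Fact p.Prime]

theorem commute_slant {f : A.carrier →ₗ[ZMod p] ZMod p} {d n : ℕ} (hf : SupportedIn d f)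
    (hd : IsEvenDeg p d) (hn : IsEvenDeg p n) {u : A.ops.deg ᵍ⊗[ZMod p] A.ops.deg}
    (hu : u ∈ A.totDeg n) (y : A.carrier) : Commute (A.slant f u) y := by
  induction hu using Submodule.span_induction with
  | mem u hu =>
    obtain ⟨i, j, hij, a, ha, b, hb, rfl⟩ := hu
    rw [slant_tmul]
    by_cases hjd : j = d
    · subst hjd
      have hi : IsEvenDeg p i := by
        rcases hn with h | h
        · exact Or.inl h
        rcases hd with h' | h'
        · exact Or.inl h'
        · rw [← hij] at h
          exact Or.inr ((Nat.even_add.1 h).2 h')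
      exact (A.commute_of_isEvenDeg hi ha y).smul_left _
    · rw [hf j hjd b hb, zero_smul]
      exact Commute.zero_left _
  | zero => rw [map_zero]; exact Commute.zero_left _
  | add x y _ _ h1 h2 => rw [map_add]; exact h1.add_left h2
  | smul c x _ h => rw [map_smul]; exact h.smul_left c

/-- If `F(b ^ q) = f(b)`, then taking `q`-th powers is compatible with `a ⊗ b ↦ f(b) a` and
`a ⊗ b ↦ F(b) a`. -/
theorem slant_pow {f F : A.carrier →ₗ[ZMod p] ZMod p} {d n s : ℕ} (hf : SupportedIn d f)
    (hd : IsEvenDeg p d) (hn : IsEvenDeg p n) (hs : 0 < s)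
    (hF : ∀ j, IsEvenDeg p j → ∀ b ∈ A.ops.deg j, F (b ^ p ^ s) = f b)
    {u : A.ops.deg ᵍ⊗[ZMod p] A.ops.deg} (hu : u ∈ A.totDeg n) :
    A.slant F (u ^ p ^ s) = A.slant f u ^ p ^ s := by
  have hq : p ^ s ≠ 0 := pow_ne_zero _ hp.out.ne_zero
  induction hu using Submodule.span_induction with
  | mem u hu =>
    obtain ⟨i, j, hij, a, ha, b, hb, rfl⟩ := hu
    rw [slant_tmul]
    by_cases hj : IsEvenDeg p j
    · rw [tmul_pow hj ha hb, slant_tmul, hF j hj b hb, smul_pow_prime_pow]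
    · have hjd : j ≠ d := fun h => hj (h ▸ hd)
      obtain ⟨hp2, hjo⟩ := not_or.1 hj
      have h2 : (a ᵍ⊗ₜ[ZMod p] b : A.ops.deg ᵍ⊗[ZMod p] A.ops.deg) ^ 2 = 0 := by
        rw [pow_two, A.tmul_mul_tmul a b hb ha, ← pow_two b,
          A.sq_eq_zero_of_odd hp2 (Nat.not_even_iff_odd.1 hjo) hb, GradedTensorProduct.tmul,
          TensorProduct.tmul_zero, map_zero, smul_zero]
      have h3 : 2 ≤ p ^ s := Nat.one_lt_pow hs.ne' hp.out.one_lt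
      rw [hf j hjd b hb, zero_smul, zero_pow hq, pow_eq_zero_of_le h3 h2, map_zero]
  | zero => rw [zero_pow hq, map_zero, map_zero, zero_pow hq]
  | add x y hx hy h1 h2 =>
    rw [add_pow_prime_pow_of_commute (commute_of_mem_totDeg hn hx hy), map_add, map_add, h1, h2,
      add_pow_prime_pow_of_commute (commute_slant hf hd hn hx _)]
  | smul c x _ h => rw [smul_pow_prime_pow, map_smul, map_smul, smul_pow_prime_pow, h]

/-- A functional `f` of degree `d` that vanishes on the elements with vanishing `p ^ s`-th power
factors through the `p ^ s`-th power map. -/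
theorem exists_frobenius_functional {f : A.carrier →ₗ[ZMod p] ZMod p} {d : ℕ}
    (hf : SupportedIn d f) (hd : IsEvenDeg p d) (s : ℕ)
    (h0 : ∀ b ∈ A.ops.deg d, b ^ p ^ s = 0 → f b = 0) :
    ∃ F : A.carrier →ₗ[ZMod p] ZMod p,
      ∀ j, IsEvenDeg p j → ∀ b ∈ A.ops.deg j, F (b ^ p ^ s) = f b := by
  have hq : 0 < p ^ s := pow_pos hp.out.pos s
  let φ : A.ops.deg d →ₗ[ZMod p] A.carrier :=
    { toFun := fun b => b.1 ^ p ^ s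
      map_add' := fun b c =>
        add_pow_prime_pow_of_commute (A.commute_of_isEvenDeg hd b.2 c.1) s
      map_smul' := fun c b => smul_pow_prime_pow c b.1 s }
  have hker : LinearMap.ker φ ≤ LinearMap.ker (f ∘ₗ (A.ops.deg d).subtype) :=
    fun b hb => h0 b.1 b.2 hb
  obtain ⟨G, hG⟩ := ((LinearMap.ker φ).liftQ _ hker ∘ₗ
    φ.quotKerEquivRange.symm.toLinearMap).exists_extend
  have hGφ : ∀ b, G (φ b) = f b.1 := fun b => by
    have := LinearMap.congr_fun hG ⟨φ b, b, rfl⟩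
    rw [LinearMap.comp_apply, LinearMap.comp_apply] at this
    have e : φ.quotKerEquivRange.symm.toLinearMap ⟨φ b, b, rfl⟩ = (LinearMap.ker φ).mkQ b := by
      rw [LinearEquiv.coe_coe, LinearEquiv.symm_apply_eq]
      rfl
    rw [e] at this
    exact this
  refine ⟨G ∘ₗ degProj A.isInternal (p ^ s * d), fun j hj b hb => ?_⟩
  rw [LinearMap.comp_apply]
  by_cases hjd : j = d
  · subst hjd
    rw [degProj_of_mem _ (A.pow_mem_deg hb _)]
    exact hGφ ⟨b, hb⟩
  · rw [degProj_of_mem_ne _ (fun h => hjd (Nat.eq_of_mul_eq_mul_left hq h)) (A.pow_mem_deg hb _),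
      map_zero, hf j hjd b hb]

namespace HopfStructure

variable (h : A.HopfStructure)

theorem Δ_mem_totDeg {n : ℕ} (hn : 0 < n) {x : A.carrier} (hx : x ∈ A.ops.deg n) :
    h.Δ x ∈ A.totDeg n := by
  have h1 := h.Δ_mem n x hn hx
  have h2 : x ᵍ⊗ₜ[ZMod p] (1 : A.carrier) ∈ A.totDeg n :=
    Submodule.subset_span ⟨n, 0, rfl, x, hx, 1, A.one_mem_deg, rfl⟩
  have h3 : (1 : A.carrier) ᵍ⊗ₜ[ZMod p] x ∈ A.totDeg n :=
    Submodule.subset_span ⟨0, n, zero_add n, 1, A.one_mem_deg, x, hx, rfl⟩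
  have h4 : Submodule.span (ZMod p) {z | ∃ i j : ℕ, 0 < i ∧ 0 < j ∧ i + j = n ∧
      ∃ a ∈ A.ops.deg i, ∃ b ∈ A.ops.deg j, z = a ᵍ⊗ₜ[ZMod p] b} ≤ A.totDeg n :=
    Submodule.span_mono fun z ⟨i, j, _, _, hij, hz⟩ => ⟨i, j, hij, hz⟩
  have h5 := add_mem (add_mem (h4 h1) h3) h2
  rwa [sub_add_cancel, sub_add_cancel] at h5

/-- If `F` vanishes in the degrees strictly between `0` and `n`, then only the primitive part of the
coproduct of an element of degree `n` contributes. -/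
theorem slant_Δ_of_lt (F : A.carrier →ₗ[ZMod p] ZMod p) {n : ℕ} (hn : 0 < n) {x : A.carrier}
    (hx : x ∈ A.ops.deg n) (hF : ∀ j, 0 < j → j < n → ∀ b ∈ A.ops.deg j, F b = 0) :
    A.slant F (h.Δ x) = F 1 • x + F x • 1 := by
  have h1 : A.slant F (h.Δ x - x ᵍ⊗ₜ[ZMod p] (1 : A.carrier) -
      (1 : A.carrier) ᵍ⊗ₜ[ZMod p] x) = 0 := by
    refine Submodule.span_induction (p := fun z _ => A.slant F z = 0) ?_ (map_zero _) ?_ ?_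
      (h.Δ_mem n x hn hx)
    · rintro _ ⟨i, j, hi, hj, hij, a, ha, b, hb, rfl⟩
      rw [slant_tmul, hF j hj (by omega) b hb, zero_smul]
    · intro x y _ _ h1 h2
      rw [map_add, h1, h2, add_zero]
    · intro c x _ h
      rw [map_smul, h, smul_zero]
  rw [map_sub, map_sub, slant_tmul, slant_tmul, sub_sub, sub_eq_zero] at h1
  exact h1

theorem slant_augmentation {ε : A.carrier →ₗ[ZMod p] ZMod p} (hε : SupportedIn 0 ε)
    (hε1 : ε 1 = 1) (x : A.carrier) : A.slant ε (h.Δ x) = x := by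
  induction x using homogeneous_induction A.isInternal with
  | zero => rw [map_zero, map_zero]
  | add x y h1 h2 => rw [map_add, map_add, h1, h2]
  | mem n x hx =>
    rcases Nat.eq_zero_or_pos n with rfl | hn
    · rw [A.connected] at hx
      obtain ⟨c, rfl⟩ := Submodule.mem_span_singleton.1 hx
      rw [map_smul, map_smul, map_one]
      congr 1
      refine (A.slant_tmul ε 1 1).trans ?_
      rw [hε1, one_smul]
    · rw [h.slant_Δ_of_lt ε hn hx fun j hj _ b hb => hε j hj.ne' b hb, hε1, hε n hn.ne' x hx,
        one_smul, zero_smul, add_zero]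

/-- The map `(1 ⊗ f) ∘ Δ`. It is a derivation if `f` is homogeneous and vanishes on decomposable
elements. -/
noncomputable def deriv (f : A.carrier →ₗ[ZMod p] ZMod p) : A.carrier →ₗ[ZMod p] A.carrier :=
  A.slant f ∘ₗ h.Δ.toLinearMap

theorem deriv_mul {f : A.carrier →ₗ[ZMod p] ZMod p} {d : ℕ} (hd : 0 < d) (hf : SupportedIn d f)
    (hf0 : ∀ x ∈ A.decSub, f x = 0) (x : A.carrier) {n : ℕ} {y : A.carrier}
    (hy : y ∈ A.ops.deg n) :
    h.deriv f (x * y) = x * h.deriv f y + (-1 : ZMod p) ^ (d * n) • (h.deriv f x * y) := by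
  obtain ⟨ε, hε, hε1, hε2⟩ := A.exists_augmentation
  refine (congrArg (A.slant f) (map_mul h.Δ x y)).trans ?_
  rw [slant_mul hε hε2 hd hf hf0, h.slant_augmentation hε hε1, h.slant_augmentation hε hε1,
    A.sgn_of_mem d hy, mul_smul_comm]
  rfl

/-- On elements whose degree is at most that of the functional, the derivation is the functional. -/
theorem deriv_of_le {f : A.carrier →ₗ[ZMod p] ZMod p} {d n : ℕ} (hf : SupportedIn d f)
    (hn : 0 < n) (hnd : n ≤ d) {x : A.carrier} (hx : x ∈ A.ops.deg n) : h.deriv f x = f x • 1 := by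
  refine (h.slant_Δ_of_lt f hn hx fun j _ hjn b hb => hf j (by omega) b hb).trans ?_
  rw [hf 0 (by omega) 1 A.one_mem_deg, zero_smul, zero_add]

/-- The `p ^ s`-th power of the derivative of `z` depends only on `z ^ p ^ s`, if `f` factors through
the `p ^ s`-th power map: it is obtained by slanting `Δ (z ^ p ^ s)` with the factor. -/
theorem deriv_pow_eq_zero {f : A.carrier →ₗ[ZMod p] ZMod p} {d n s : ℕ} (hf : SupportedIn d f)
    (hd : IsEvenDeg p d) (hn : IsEvenDeg p n) (hn0 : 0 < n) (hs : 0 < s)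
    (h0 : ∀ b ∈ A.ops.deg d, b ^ p ^ s = 0 → f b = 0) {z : A.carrier} (hz : z ∈ A.ops.deg n)
    (hz0 : z ^ p ^ s = 0) : h.deriv f z ^ p ^ s = 0 := by
  obtain ⟨F, hF⟩ := exists_frobenius_functional hf hd s h0
  have h1 := slant_pow hf hd hn hs hF (h.Δ_mem_totDeg hn0 hz)
  rw [← map_pow, hz0, map_zero, map_zero] at h1
  exact h1.symm

end HopfStructure

end Hopf

end SteenrodCAlg

/-! ### Minimal generators of a Hopf algebra -/

namespace SteenrodCAlg

variable {p : ℕ} [hp : Fact p.Prime] {A : SteenrodCAlg.{u} p}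

namespace HopfStructure

variable (h : A.HopfStructure) {f : A.carrier →ₗ[ZMod p] ZMod p} {d : ℕ}

theorem deriv_one (hd : 0 < d) (hf : SupportedIn d f) (hf0 : ∀ x ∈ A.decSub, f x = 0) :
    h.deriv f 1 = 0 := by
  have := h.deriv_mul hd hf hf0 1 A.one_mem_deg
  rw [one_mul, mul_zero, pow_zero, one_smul, mul_one, one_mul] at this
  exact left_eq_add.1 this

theorem deriv_pow (hd : 0 < d) (hf : SupportedIn d f) (hf0 : ∀ x ∈ A.decSub, f x = 0) {n : ℕ}
    (hn : IsEvenDeg p n) {y : A.carrier} (hy : y ∈ A.ops.deg n) (m : ℕ) :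
    h.deriv f (y ^ (m + 1)) = ((m + 1 : ℕ) : ZMod p) • (y ^ m * h.deriv f y) := by
  induction m with
  | zero => simp
  | succ m ih =>
    rw [pow_succ, h.deriv_mul hd hf hf0 _ hy, (hn.mul_left d).neg_one_pow, one_smul, ih,
      smul_mul_assoc, mul_assoc, ← (A.commute_of_isEvenDeg hn hy (h.deriv f y)).eq, ← mul_assoc,
      ← pow_succ, Nat.cast_succ (m + 1), add_smul, one_smul, add_comm]

/-- A power of an element of even degree with exponent divisible by `p` has derivative zero. -/
theorem deriv_pow_of_dvd (hd : 0 < d) (hf : SupportedIn d f) (hf0 : ∀ x ∈ A.decSub, f x = 0) {n : ℕ}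
    (hn : IsEvenDeg p n) {y : A.carrier} (hy : y ∈ A.ops.deg n) {m : ℕ} (hm : p ∣ m) :
    h.deriv f (y ^ m) = 0 := by
  rcases m with _ | m
  · rw [pow_zero, h.deriv_one hd hf hf0]
  · rw [h.deriv_pow hd hf hf0 hn hy, (ZMod.natCast_eq_zero_iff (m + 1) p).2 hm, zero_smul]

theorem deriv_pow_of_deriv_eq_zero (hd : 0 < d) (hf : SupportedIn d f)
    (hf0 : ∀ x ∈ A.decSub, f x = 0) {n : ℕ} {y : A.carrier} (hy : y ∈ A.ops.deg n)
    (h0 : h.deriv f y = 0) (m : ℕ) : h.deriv f (y ^ m) = 0 := by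
  induction m with
  | zero => rw [pow_zero, h.deriv_one hd hf hf0]
  | succ m ih => rw [pow_succ, h.deriv_mul hd hf hf0 _ hy, h0, ih, mul_zero, zero_mul, smul_zero,
      add_zero]

theorem deriv_mono_eq_zero (hd : 0 < d) (hf : SupportedIn d f) (hf0 : ∀ x ∈ A.decSub, f x = 0)
    {I : Type*} [LinearOrder I] (g : I → A.Gen) (e : I →₀ ℕ)
    (he : ∀ i, h.deriv f ((g i).val ^ e i) = 0) : h.deriv f (mono g e) = 0 := by
  induction e using Finsupp.induction with
  | zero => rw [mono_zero, h.deriv_one hd hf hf0]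
  | single_add i n e hi hn ih =>
    obtain ⟨c, -, hc⟩ := mono_add g (Finsupp.single i n) e
    have h1 : h.deriv f (mono g e) = 0 := ih fun j => by
      by_cases hij : j = i
      · rw [hij, Finsupp.notMem_support_iff.1 hi, pow_zero, h.deriv_one hd hf hf0]
      · have := he j
        rwa [Finsupp.add_apply, Finsupp.single_eq_of_ne hij, zero_add] at this
    have h2 := he i
    rw [Finsupp.add_apply, Finsupp.single_eq_same, Finsupp.notMem_support_iff.1 hi, add_zero] at h2
    rw [hc, map_smul, h.deriv_mul hd hf hf0 _ (mono_mem g e), h1, mono_single, h2, mul_zero,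
      zero_mul, smul_zero, add_zero, smul_zero]

end HopfStructure

variable (A) in
/-- Homogeneous representatives of a basis of the indecomposables `QA`, together with heights, such
that an element of positive even degree whose `p ^ k`-th power is zero is, modulo decomposable
elements, a linear combination of representatives of height at most `p ^ k`. -/
structure MinimalGenerators where
  idx : Type u
  [linearOrder : LinearOrder idx]
  g : idx → A.Gen
  height : idx → ℕ∞
  height_even : ∀ i, IsEvenDeg p (g i).d →
    height i = ⊤ ∨ ∃ k : ℕ, 0 < k ∧ height i = ((p ^ k : ℕ) : ℕ∞)
  height_odd : ∀ i, p ≠ 2 → Odd (g i).d → height i = 2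
  pow_eq_zero : ∀ i (m : ℕ), height i = m → (g i).val ^ m = 0
  /-- The coordinates of the class of an element in `QA`. -/
  coord : idx → A.carrier →ₗ[ZMod p] ZMod p
  coord_self : ∀ i, coord i (g i).val = 1
  coord_of_ne : ∀ i j, j ≠ i → coord i (g j).val = 0
  coord_decSub : ∀ i, ∀ x ∈ A.decSub, coord i x = 0
  coord_supported : ∀ i, SupportedIn (g i).d (coord i)
  coord_nilAt : ∀ i {k n x}, A.NilAt k n x → ((p ^ k : ℕ) : ℕ∞) < height i → coord i x = 0
  span_toQ : ∀ x, A.toQ x ∈ Submodule.span (ZMod p) (Set.range fun i => A.toQ (g i).val)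

attribute [instance] MinimalGenerators.linearOrder

namespace MinimalGenerators

variable (b : A.MinimalGenerators)

/-- The exponents of the monomials that form a basis: those below the heights. -/
def Good (e : b.idx →₀ ℕ) : Prop := ∀ i, (e i : ℕ∞) < b.height i

theorem mono_mem_span (e : b.idx →₀ ℕ) :
    mono b.g e ∈ Submodule.span (ZMod p) (mono b.g '' {e | b.Good e}) := by
  by_cases he : b.Good e
  · exact Submodule.subset_span ⟨e, he, rfl⟩
  · simp only [Good, not_forall, not_lt] at he
    obtain ⟨i, hi⟩ := he
    obtain ⟨m, hm⟩ := ENat.ne_top_iff_exists.1 (ne_top_of_le_ne_top (ENat.natCast_ne_top _) hi)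
    rw [← hm] at hi
    rw [mono_eq_zero_of_pow b.g (m := m) (i := i) (by exact_mod_cast hi)
      (b.pow_eq_zero i m hm.symm)]
    exact zero_mem _

theorem span_eq_top : Submodule.span (ZMod p) (mono b.g '' {e | b.Good e}) = ⊤ := by
  set W := Submodule.span (ZMod p) (mono b.g '' {e | b.Good e}) with hW
  have hmul : ∀ x ∈ W, ∀ y ∈ W, x * y ∈ W := by
    intro x hx y hy
    induction hx using Submodule.span_induction with
    | mem x hx =>
      obtain ⟨e, -, rfl⟩ := hx
      induction hy using Submodule.span_induction with
      | mem y hy =>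
        obtain ⟨f, -, rfl⟩ := hy
        obtain ⟨c, hc, h⟩ := mono_add b.g e f
        rw [← inv_smul_smul₀ hc (mono b.g e * mono b.g f), ← h]
        exact Submodule.smul_mem _ _ (b.mono_mem_span _)
      | zero => rw [mul_zero]; exact zero_mem _
      | add x y _ _ h1 h2 => rw [mul_add]; exact add_mem h1 h2
      | smul c x _ h => rw [mul_smul_comm]; exact Submodule.smul_mem _ c h
    | zero => rw [zero_mul]; exact zero_mem _
    | add x y _ _ h1 h2 => rw [add_mul]; exact add_mem h1 h2
    | smul c x _ h => rw [smul_mul_assoc]; exact Submodule.smul_mem _ c h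
  have hhom : IsHomogeneousSub A.isInternal W :=
    isHomogeneousSub_span _ (by rintro _ ⟨e, -, rfl⟩; exact ⟨_, mono_mem b.g e⟩)
  have hone : (1 : A.carrier) ∈ W := by
    have := b.mono_mem_span 0
    rwa [mono_zero] at this
  have hg : ∀ i, (b.g i).val ∈ W := fun i => by
    have := b.mono_mem_span (Finsupp.single i 1)
    rwa [mono_single, pow_one] at this
  have key : ∀ n, ∀ x ∈ A.ops.deg n, x ∈ W := by
    intro n
    induction n using Nat.strong_induction_on with
    | _ n ih =>
      intro x hx
      rcases Nat.eq_zero_or_pos n with rfl | hn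
      · rw [A.connected] at hx
        obtain ⟨c, rfl⟩ := Submodule.mem_span_singleton.1 hx
        exact Submodule.smul_mem _ c hone
      · obtain ⟨y, hy, hyx⟩ : ∃ y ∈ W, A.toQ y = A.toQ x := by
          have h1 : Submodule.span (ZMod p) (Set.range fun i => A.toQ (b.g i).val) ≤
              W.map A.toQ := by
            rw [Submodule.span_le]
            rintro _ ⟨i, rfl⟩
            exact ⟨_, hg i, rfl⟩
          exact h1 (b.span_toQ x)
        have h1 : degProj A.isInternal n y ∈ W := hhom n y hy
        have h2 := degProj_mem A.isInternal n y
        have h3 : x - degProj A.isInternal n y ∈ A.decSub := by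
          rw [← A.toQ_eq_zero_iff (A.mem_augIdeal_of_deg hn (sub_mem hx h2)), map_sub,
            ← A.degProj_toQ, hyx, degProj_of_mem _ (A.toQ_mem_deg hx), sub_self]
        have h4 : x - degProj A.isInternal n y ∈ W := by
          refine Submodule.span_le.2 ?_ (A.decSub_deg h3 (sub_mem hx h2))
          rintro _ ⟨i, j, hi, hj, hij, a, ha, c, hc, rfl⟩
          exact hmul _ (ih i (by omega) a ha) _ (ih j (by omega) c hc)
        have := add_mem h4 h1
        rwa [sub_add_cancel] at this
  rw [eq_top_iff]
  rintro x -
  exact mem_of_degProj_mem A.isInternal fun n => key n _ (degProj_mem _ n x)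

theorem isEvenDeg_of_lt {i : b.idx} {m : ℕ} (hm : (m : ℕ∞) < b.height i) (h0 : m ≠ 0)
    (h : p ∣ m) : IsEvenDeg p (b.g i).d := by
  by_contra hd
  rw [IsEvenDeg, not_or, Nat.not_even_iff_odd] at hd
  rw [b.height_odd i hd.1 hd.2] at hm
  have h1 : m < 2 := by exact_mod_cast hm
  have h2 := Nat.le_of_dvd (Nat.pos_of_ne_zero h0) h
  have := hp.out.two_le
  omega

theorem isEvenDeg_monoDeg {e : b.idx →₀ ℕ} (he : ∀ i, e i ≠ 0 → IsEvenDeg p (b.g i).d) :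
    IsEvenDeg p (monoDeg b.g e) := by
  by_cases hp2 : p = 2
  · exact Or.inl hp2
  · refine Or.inr (Finset.even_sum _ fun i hi => ?_)
    exact ((he i (Finsupp.mem_support_iff.1 hi)).resolve_left hp2).mul_left _

/-- The derivation that belongs to the coordinate of `g i` lowers the exponent of `g i` in a
monomial, if the other generators of larger degree appear in it with exponents divisible by `p`. -/
theorem deriv_mono (h : A.HopfStructure) {e : b.idx →₀ ℕ} (he : b.Good e) {i : b.idx}
    (hi : ∀ j, ¬ p ∣ e j → (b.g j).d ≤ (b.g i).d) :
    (p ∣ e i → h.deriv (b.coord i) (mono b.g e) = 0) ∧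
    (¬ p ∣ e i → ∃ c : ZMod p, c ≠ 0 ∧
      h.deriv (b.coord i) (mono b.g e) = c • mono b.g (e - Finsupp.single i 1)) := by
  have hd := (b.g i).pos
  have hf := b.coord_supported i
  have hf0 := b.coord_decSub i
  have hpow : ∀ j, j ≠ i ∨ p ∣ e j → h.deriv (b.coord i) ((b.g j).val ^ e j) = 0 := by
    intro j hj
    by_cases hpj : p ∣ e j
    · by_cases h0 : e j = 0
      · rw [h0, pow_zero, h.deriv_one hd hf hf0]
      · exact h.deriv_pow_of_dvd hd hf hf0 (b.isEvenDeg_of_lt (he j) h0 hpj) (b.g j).mem hpj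
    · refine h.deriv_pow_of_deriv_eq_zero hd hf hf0 (b.g j).mem ?_ _
      rw [h.deriv_of_le hf (b.g j).pos (hi j hpj) (b.g j).mem,
        b.coord_of_ne i j (hj.resolve_right hpj), zero_smul]
  refine ⟨fun hpi => h.deriv_mono_eq_zero hd hf hf0 b.g e fun j => hpow j ?_, fun hpi => ?_⟩
  · by_cases hj : j = i
    · exact Or.inr (hj ▸ hpi)
    · exact Or.inl hj
  obtain ⟨m, hm⟩ : ∃ m, e i = m + 1 :=
    Nat.exists_eq_succ_of_ne_zero fun h0 => hpi (h0 ▸ dvd_zero p)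
  have hDi : h.deriv (b.coord i) (b.g i).val = 1 := by
    rw [h.deriv_of_le hf hd le_rfl (b.g i).mem, b.coord_self, one_smul]
  obtain ⟨c2, hc2, h2⟩ : ∃ c : ZMod p, c ≠ 0 ∧
      h.deriv (b.coord i) ((b.g i).val ^ (m + 1)) = c • (b.g i).val ^ m := by
    by_cases hev : IsEvenDeg p (b.g i).d
    · refine ⟨((m + 1 : ℕ) : ZMod p), ?_, ?_⟩
      · rwa [Ne, ZMod.natCast_eq_zero_iff, ← hm]
      · rw [h.deriv_pow hd hf hf0 hev (b.g i).mem, hDi, mul_one]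
    · -- an exterior generator has exponent one
      rw [IsEvenDeg, not_or, Nat.not_even_iff_odd] at hev
      have h1 := he i
      rw [b.height_odd i hev.1 hev.2, hm] at h1
      have h1 : m + 1 < 2 := by exact_mod_cast h1
      obtain rfl : m = 0 := by omega
      exact ⟨1, one_ne_zero, by rw [zero_add, pow_one, hDi, pow_zero, one_smul]⟩
  have her : h.deriv (b.coord i) (mono b.g (e.erase i)) = 0 := by
    refine h.deriv_mono_eq_zero hd hf hf0 b.g _ fun j => ?_
    by_cases hj : j = i
    · rw [hj, Finsupp.erase_same, pow_zero, h.deriv_one hd hf hf0]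
    · rw [Finsupp.erase_ne hj]
      exact hpow j (Or.inl hj)
  have he1 : e = Finsupp.single i (m + 1) + e.erase i := by
    rw [← hm, Finsupp.single_add_erase]
  have he2 : e - Finsupp.single i 1 = Finsupp.single i m + e.erase i := by
    ext j
    rw [Finsupp.tsub_apply, Finsupp.add_apply]
    by_cases hj : j = i
    · subst hj
      simp [hm]
    · simp [Finsupp.single_eq_of_ne hj, Finsupp.erase_ne hj]
  obtain ⟨c1, hc1, h1⟩ := mono_add b.g (Finsupp.single i (m + 1)) (e.erase i)
  obtain ⟨c3, hc3, h3⟩ := mono_add b.g (Finsupp.single i m) (e.erase i)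
  refine ⟨c1 * ((-1) ^ ((b.g i).d * monoDeg b.g (e.erase i)) * c2) * c3⁻¹, ?_, ?_⟩
  · exact mul_ne_zero (mul_ne_zero hc1 (mul_ne_zero
      (pow_ne_zero _ (neg_ne_zero.2 one_ne_zero)) hc2)) (inv_ne_zero hc3)
  · rw [he2, h3, mul_smul, inv_smul_smul₀ hc3]
    conv_lhs => rw [he1, h1]
    rw [map_smul, h.deriv_mul hd hf hf0 _ (mono_mem b.g _), her, mul_zero, zero_add, mono_single,
      mono_single, h2, smul_mul_assoc, smul_smul, smul_smul, mul_assoc c1]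

theorem sum_smul_pow_prime_pow {ι : Type*} (v : Finset ι) (a : ι → ZMod p) (x : ι → A.carrier)
    {s : ℕ} (hx : 0 < s → ∀ e ∈ v, ∃ m, IsEvenDeg p m ∧ x e ∈ A.ops.deg m) :
    (∑ e ∈ v, a e • x e) ^ p ^ s = ∑ e ∈ v, a e • x e ^ p ^ s := by
  rcases Nat.eq_zero_or_pos s with rfl | hs
  · simp
  · rw [sum_pow_prime_pow]
    · exact Finset.sum_congr rfl fun e _ => smul_pow_prime_pow _ _ _
    · intro e he f _
      obtain ⟨m, hm, hxm⟩ := hx hs e he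
      exact A.commute_of_isEvenDeg hm (Submodule.smul_mem _ _ hxm) _

/-- The key step: a relation between monomials of degree `n` is the `p ^ s`-th power of an
element `z`, and the `p ^ s`-th power of a derivative of `z` is a relation in a lower degree. -/
theorem linearIndepOn_mono_deg (h : A.HopfStructure) (n : ℕ) :
    LinearIndepOn (ZMod p) (mono b.g) {e | b.Good e ∧ monoDeg b.g e = n} := by
  induction n using Nat.strong_induction_on with
  | _ n ih =>
  rw [linearIndepOn_iff']
  intro t₀ a ht₀ hsum₀
  by_contra! hne
  obtain ⟨e₀, he₀, hae₀⟩ := hne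
  classical
  set t := t₀.filter fun e => a e ≠ 0 with ht
  have hsum : ∑ e ∈ t, a e • mono b.g e = 0 := by
    rw [← hsum₀]
    refine Finset.sum_subset (Finset.filter_subset _ _) fun e he he' => ?_
    have : a e = 0 := by_contra fun h => he' (Finset.mem_filter.2 ⟨he, h⟩)
    rw [this, zero_smul]
  have hgood : ∀ e ∈ t, b.Good e := fun e he => (ht₀ (Finset.mem_filter.1 he).1).1
  have hdeg : ∀ e ∈ t, monoDeg b.g e = n := fun e he => (ht₀ (Finset.mem_filter.1 he).1).2
  have ha : ∀ e ∈ t, a e ≠ 0 := fun e he => (Finset.mem_filter.1 he).2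
  have het : e₀ ∈ t := Finset.mem_filter.2 ⟨he₀, hae₀⟩
  clear_value t
  rcases Nat.eq_zero_or_pos n with rfl | hn
  · have h0 : ∀ e ∈ t, e = 0 := fun e he => (monoDeg_eq_zero_iff b.g).1 (hdeg e he)
    have : t = {0} := by
      ext e
      rw [Finset.mem_singleton]
      exact ⟨h0 e, fun he => he ▸ h0 e₀ het ▸ het⟩
    rw [this, Finset.sum_singleton, mono_zero, smul_eq_zero] at hsum
    exact hsum.elim (ha 0 (this ▸ Finset.mem_singleton_self 0)) A.nontrivial_one
  -- the largest power of `p` that divides all exponents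
  obtain ⟨s, hs, i₁, e₁, he₁, hs'⟩ : ∃ s, (∀ e ∈ t, ∀ i, p ^ s ∣ e i) ∧
      ∃ i, ∃ e ∈ t, ¬ p ^ (s + 1) ∣ e i := by
    by_contra! hcon
    have hall : ∀ s, ∀ e ∈ t, ∀ i, p ^ s ∣ e i := by
      intro s
      induction s with
      | zero => intro e _ i; rw [pow_zero]; exact one_dvd _
      | succ s ihs => exact fun e he i => hcon s ihs i e he
    have h0 : e₀ = 0 := by
      ext i
      by_contra hi
      have h1 := Nat.le_of_dvd (Nat.pos_of_ne_zero hi) (hall (e₀ i) e₀ het i)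
      exact absurd h1 (not_le.2 (Nat.lt_pow_self hp.out.one_lt))
    have := hdeg e₀ het
    rw [h0, monoDeg_zero] at this
    omega
  set q := p ^ s with hq
  have hq0 : 0 < q := pow_pos hp.out.pos s
  -- division of exponents by `p ^ s`
  let r : (b.idx →₀ ℕ) → (b.idx →₀ ℕ) := fun e => e.mapRange (· / q) (Nat.zero_div q)
  have hr : ∀ e ∈ t, q • r e = e := fun e he => by
    ext i
    rw [Finsupp.smul_apply, Finsupp.mapRange_apply, smul_eq_mul, Nat.mul_div_cancel' (hs e he i)]
  have hri : ∀ e ∈ t, ∀ i, e i = q * r e i := fun e he i => by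
    conv_lhs => rw [← hr e he]
    rfl
  have hle : ∀ e ∈ t, ∀ i, r e i ≤ e i := fun e he i => by
    rw [hri e he i]
    exact Nat.le_mul_of_pos_left _ hq0
  have hrgood : ∀ e ∈ t, b.Good (r e) := fun e he i =>
    lt_of_le_of_lt (by exact_mod_cast hle e he i) (hgood e he i)
  have heven : 0 < s → ∀ e ∈ t, ∀ i, r e i ≠ 0 → IsEvenDeg p (b.g i).d := fun hs0 e he i hi => by
    refine b.isEvenDeg_of_lt (hgood e he i) ?_ ((dvd_pow_self p hs0.ne').trans (hs e he i))
    rw [hri e he i]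
    exact mul_ne_zero hq0.ne' hi
  choose c hc hce using fun e => mono_nsmul b.g q (r e)
  have hN : ∀ e ∈ t, q * monoDeg b.g (r e) = n := fun e he => by
    rw [← monoDeg_nsmul, hr e he, hdeg e he]
  set N := monoDeg b.g (r e₀) with hNdef
  have hNt : ∀ e ∈ t, monoDeg b.g (r e) = N := fun e he =>
    Nat.eq_of_mul_eq_mul_left hq0 ((hN e he).trans (hN e₀ het).symm)
  have hNn : q * N = n := hN e₀ het
  have hN0 : 0 < N := Nat.pos_of_ne_zero fun h0 => by rw [h0, mul_zero] at hNn; omega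
  have hNeven : 0 < s → IsEvenDeg p N := fun hs0 => b.isEvenDeg_monoDeg (heven hs0 e₀ het)
  set z := ∑ e ∈ t, (a e * c e) • mono b.g (r e) with hz
  have hzN : z ∈ A.ops.deg N := Submodule.sum_mem _ fun e he =>
    Submodule.smul_mem _ _ (hNt e he ▸ mono_mem b.g (r e))
  have hz0 : z ^ q = 0 := by
    rw [hz, hq, sum_smul_pow_prime_pow t _ _ fun hs0 e he =>
      ⟨N, hNeven hs0, hNt e he ▸ mono_mem b.g (r e)⟩, ← hsum]
    refine Finset.sum_congr rfl fun e he => ?_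
    conv_rhs => rw [← hr e he, hce e]
    rw [mul_smul, hr e he]
  -- a generator of maximal degree among those that appear with an exponent prime to `p`
  obtain ⟨i, ⟨e₂, he₂, hi₂⟩, hmax⟩ : ∃ i, (∃ e ∈ t, ¬ p ∣ r e i) ∧
      ∀ e ∈ t, ∀ j, ¬ p ∣ r e j → (b.g j).d ≤ (b.g i).d := by
    have hmem : ∀ j, j ∈ (t.biUnion fun e => (r e).support.filter fun j => ¬ p ∣ r e j) ↔
        ∃ e ∈ t, ¬ p ∣ r e j := fun j => by
      simp only [Finset.mem_biUnion, Finset.mem_filter, Finsupp.mem_support_iff]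
      refine exists_congr fun e => and_congr_right fun _ => and_iff_right_of_imp fun hj h0 => ?_
      exact hj (h0 ▸ dvd_zero p)
    obtain ⟨i, hi, hmax⟩ := Finset.exists_max_image _ (fun j => (b.g j).d)
      ⟨i₁, (hmem i₁).2 ⟨e₁, he₁, fun hd => hs' (by
        rw [hri e₁ he₁ i₁, pow_succ]
        exact mul_dvd_mul_left _ hd)⟩⟩
    exact ⟨i, (hmem i).1 hi, fun e he j hj => hmax j ((hmem j).2 ⟨e, he, hj⟩)⟩
  have hi0 : r e₂ i ≠ 0 := fun h0 => hi₂ (h0 ▸ dvd_zero p)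
  have hqi : ((q : ℕ) : ℕ∞) < b.height i := by
    refine lt_of_le_of_lt ?_ (hgood e₂ he₂ i)
    rw [hri e₂ he₂ i]
    exact_mod_cast Nat.le_mul_of_pos_right q (Nat.pos_of_ne_zero hi0)
  have hDz : h.deriv (b.coord i) z ^ q = 0 := by
    rcases Nat.eq_zero_or_pos s with hs0 | hs0
    · have hq1 : q = 1 := by rw [hq, hs0, pow_zero]
      rw [hq1, pow_one] at hz0 ⊢
      rw [hz0, map_zero]
    · have hd := heven hs0 e₂ he₂ i hi0
      exact h.deriv_pow_eq_zero (b.coord_supported i) hd (hNeven hs0) hN0 hs0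
        (fun x hx hx0 => b.coord_nilAt i ⟨(b.g i).pos, hd, hx, hx0⟩ hqi) hzN hz0
  set t' := t.filter fun e => ¬ p ∣ r e i with ht'
  have htt' : ∀ e ∈ t', e ∈ t := fun e he => (Finset.mem_filter.1 he).1
  have hpt' : ∀ e ∈ t', ¬ p ∣ r e i := fun e he => (Finset.mem_filter.1 he).2
  have hderiv : ∀ e, ∃ c' : ZMod p, e ∈ t' → c' ≠ 0 ∧
      h.deriv (b.coord i) (mono b.g (r e)) = c' • mono b.g (r e - Finsupp.single i 1) := by
    intro e
    by_cases he : e ∈ t'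
    · obtain ⟨c', h1⟩ := (b.deriv_mono h (hrgood e (htt' e he)) (hmax e (htt' e he))).2 (hpt' e he)
      exact ⟨c', fun _ => h1⟩
    · exact ⟨0, fun h => absurd h he⟩
  choose c' hc' using hderiv
  have hDz' : h.deriv (b.coord i) z =
      ∑ e ∈ t', (a e * c e * c' e) • mono b.g (r e - Finsupp.single i 1) := by
    rw [hz, map_sum, ht', Finset.sum_filter]
    refine Finset.sum_congr rfl fun e he => ?_
    rw [map_smul]
    split_ifs with hpe
    · rw [(b.deriv_mono h (hrgood e he) (hmax e he)).1 (not_not.1 (by simpa using hpe)), smul_zero]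
    · rw [(hc' e (Finset.mem_filter.2 ⟨he, hpe⟩)).2, smul_smul]
  have hadd : ∀ e ∈ t', r e - Finsupp.single i 1 + Finsupp.single i 1 = r e := fun e he =>
    tsub_add_cancel_of_le (Finsupp.single_le_iff.2
      (Nat.one_le_iff_ne_zero.2 fun h0 => hpt' e he (h0 ▸ dvd_zero p)))
  choose k hk hke using fun e => mono_nsmul b.g q (r e - Finsupp.single i 1)
  have hzero : ∑ e ∈ t', (a e * c e * c' e * (k e)⁻¹) •
      mono b.g (q • (r e - Finsupp.single i 1)) = 0 := by
    rw [← hDz, hDz', hq, sum_smul_pow_prime_pow t' _ _ fun hs0 e he =>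
      ⟨_, b.isEvenDeg_monoDeg fun j hj => heven hs0 e (htt' e he) j fun h0 => hj (by
        rw [Finsupp.tsub_apply, h0, Nat.zero_sub]), mono_mem b.g _⟩]
    refine Finset.sum_congr rfl fun e he => ?_
    rw [← hq, hke e, mul_smul, inv_smul_smul₀ (hk e)]
  have hinj : Set.InjOn (fun e => q • (r e - Finsupp.single i 1)) (t' : Set (b.idx →₀ ℕ)) := by
    intro e he f hf hef
    have h1 : r e - Finsupp.single i 1 = r f - Finsupp.single i 1 := by
      ext j
      have := DFunLike.congr_fun hef j
      simp only [Finsupp.smul_apply, smul_eq_mul] at this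
      exact Nat.eq_of_mul_eq_mul_left hq0 this
    rw [← hr e (htt' e he), ← hr f (htt' f hf), ← hadd e he, h1, hadd f hf]
  have hsub : (fun e => q • (r e - Finsupp.single i 1)) '' (t' : Set (b.idx →₀ ℕ)) ⊆
      {e | b.Good e ∧ monoDeg b.g e = n - q * (b.g i).d} := by
    rintro _ ⟨e, he, rfl⟩
    refine ⟨fun j => lt_of_le_of_lt ?_ (hgood e (htt' e he) j), ?_⟩
    · rw [hri e (htt' e he) j]
      simp only [Finsupp.smul_apply, smul_eq_mul, Finsupp.tsub_apply]
      exact_mod_cast Nat.mul_le_mul_left q (Nat.sub_le _ _)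
    · rw [← hN e (htt' e he), ← hadd e he, monoDeg_add, monoDeg_single, mul_add, one_mul,
        Nat.add_sub_cancel, ← monoDeg_nsmul]
  have hlt : n - q * (b.g i).d < n := Nat.sub_lt hn (Nat.mul_pos hq0 (b.g i).pos)
  have hind := ((ih _ hlt).mono hsub).comp_of_image hinj
  have he₂' : e₂ ∈ t' := Finset.mem_filter.2 ⟨he₂, hi₂⟩
  have := linearIndepOn_iff'.1 hind t' _ subset_rfl hzero e₂ he₂'
  exact mul_ne_zero (mul_ne_zero (mul_ne_zero (ha e₂ he₂) (hc e₂)) (hc' e₂ he₂').1)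
    (inv_ne_zero (hk e₂)) this

theorem linearIndepOn_mono (h : A.HopfStructure) :
    LinearIndepOn (ZMod p) (mono b.g) {e | b.Good e} := by
  classical
  rw [linearIndepOn_iff']
  intro t a ht hsum e he
  have h1 := congrArg (degProj A.isInternal (monoDeg b.g e)) hsum
  rw [map_sum, map_zero] at h1
  refine linearIndepOn_iff'.1 (b.linearIndepOn_mono_deg h (monoDeg b.g e))
    (t.filter fun f => monoDeg b.g f = monoDeg b.g e) a ?_ ?_ e (Finset.mem_filter.2 ⟨he, rfl⟩)
  · intro f hf
    have hf := Finset.mem_filter.1 hf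
    exact ⟨ht hf.1, hf.2⟩
  · rw [← h1, Finset.sum_filter]
    refine Finset.sum_congr rfl fun f _ => ?_
    rw [map_smul, degProj_of_mem_ite _ (mono_mem b.g f)]
    split_ifs with h2
    · rfl
    · rw [smul_zero]

/-- Minimal generators of a Hopf algebra give a Borel decomposition. -/
def borelSystem (h : A.HopfStructure) : A.BorelSystem where
  idx := b.idx
  g := b.g
  height := b.height
  height_even := b.height_even
  height_odd := b.height_odd
  pow_eq_zero := b.pow_eq_zero
  linearIndependent := b.linearIndepOn_mono h
  span_eq_top := by
    rw [← b.span_eq_top]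
    congr 1
    exact (Set.image_eq_range (mono b.g) {e | b.Good e}).symm

end MinimalGenerators

end SteenrodCAlg

/-! ### Existence of a Borel decomposition -/

section AdaptedBasis

variable {K V : Type*} [DivisionRing K] [AddCommGroup V] [Module K V]

/-- A vector space has a basis adapted to an increasing sequence of subsets: each of these is
spanned by the basis vectors that it contains. -/
theorem exists_adapted_basis {t : ℕ → Set V} (ht : Monotone t) {H : Set V} (htH : ∀ k, t k ⊆ H)
    (hH : Submodule.span K H = ⊤) : ∃ s ⊆ H, LinearIndepOn K id s ∧ Submodule.span K s = ⊤ ∧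
      ∀ k, t k ⊆ Submodule.span K (s ∩ t k) := by
  let T : ℕ → Type _ := fun k =>
    {s : Set V // s ⊆ t k ∧ LinearIndepOn K id s ∧ t k ⊆ Submodule.span K s}
  have hstep : ∀ k (s : T k), ∃ s' : T (k + 1), s.1 ⊆ s'.1 := by
    rintro k ⟨s, h1, h2, -⟩
    obtain ⟨s', h3, h4, h5, h6⟩ :=
      exists_linearIndepOn_id_extension h2 (h1.trans (ht (Nat.le_succ k)))
    exact ⟨⟨s', h3, h6, h5⟩, h4⟩
  obtain ⟨s₀⟩ : Nonempty (T 0) := by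
    obtain ⟨s, h1, -, h2, h3⟩ :=
      exists_linearIndepOn_id_extension (linearIndepOn_empty K id) (Set.empty_subset (t 0))
    exact ⟨⟨s, h1, h3, h2⟩⟩
  choose next hnext using hstep
  let S : ∀ k, T k := fun k => Nat.rec s₀ next k
  have hS : Monotone fun k => (S k).1 := monotone_nat_of_le_succ fun k => hnext k (S k)
  have hU : LinearIndepOn K id (⋃ k, (S k).1) :=
    linearIndepOn_iUnion_of_directed hS.directed_le fun k => (S k).2.2.1
  obtain ⟨s, hsH, hUs, hHs, hs⟩ :=
    exists_linearIndepOn_id_extension hU (Set.iUnion_subset fun k => (S k).2.1.trans (htH k))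
  refine ⟨s, hsH, hs, ?_, fun k => (S k).2.2.2.trans ?_⟩
  · rw [eq_top_iff, ← hH]
    exact Submodule.span_le.2 hHs
  · exact Submodule.span_mono
      (Set.subset_inter ((Set.subset_iUnion (fun k => (S k).1) k).trans hUs) (S k).2.1)

end AdaptedBasis

namespace SteenrodCAlg

variable {p : ℕ} [hp : Fact p.Prime] (A : SteenrodCAlg.{u} p)

/-- The classes in `QA` of the homogeneous elements of positive even degree whose `p ^ k`-th power
is zero. -/
def nilClasses (k : ℕ) : Set A.Indec := {v | ∃ n x, A.NilAt k n x ∧ A.toQ x = v}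

variable {A}

/-- A homogeneous class in `QA` has a representative of least possible height. -/
theorem exists_generator_of_class {v : A.Indec} (hv : v ≠ 0) {n : ℕ} (hn : v ∈ A.indecOps.deg n) :
    ∃ (g : A.Gen) (m : ℕ∞), A.toQ g.val = v ∧
      (IsEvenDeg p g.d → m = ⊤ ∨ ∃ k : ℕ, 0 < k ∧ m = ((p ^ k : ℕ) : ℕ∞)) ∧
      (p ≠ 2 → Odd g.d → m = 2) ∧ (∀ l : ℕ, m = l → g.val ^ l = 0) ∧
      ∀ k, v ∈ A.nilClasses k → m ≤ ((p ^ k : ℕ) : ℕ∞) := by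
  classical
  by_cases hk : ∃ k, v ∈ A.nilClasses k
  · obtain ⟨n, x, hx, hxv⟩ := Nat.find_spec hk
    set k := Nat.find hk with hkdef
    have hk0 : 0 < k := Nat.pos_of_ne_zero fun h0 => hv (by
      have := hx.pow_eq_zero
      rw [h0, pow_zero, pow_one] at this
      rw [← hxv, this, map_zero])
    refine ⟨⟨n, x, hx.pos, hx.mem⟩, ((p ^ k : ℕ) : ℕ∞), hxv, fun _ => Or.inr ⟨k, hk0, rfl⟩,
      fun hp2 hodd => ?_, fun l hl => ?_, fun l hl => ?_⟩
    · exact absurd (hx.even.resolve_left hp2) (Nat.not_even_iff_odd.2 hodd)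
    · obtain rfl : p ^ k = l := by exact_mod_cast hl
      exact hx.pow_eq_zero
    · exact_mod_cast Nat.pow_le_pow_right hp.out.pos (Nat.find_min' hk hl)
  · obtain ⟨x, hx, -, hxv⟩ := A.exists_toQ_of_deg hn
    have hn0 : 0 < n := Nat.pos_of_ne_zero fun h0 => hv (by
      rw [← hxv]
      exact A.toQ_of_deg_zero (h0 ▸ hx))
    have hmin : ∀ (m : ℕ∞) k, v ∈ A.nilClasses k → m ≤ ((p ^ k : ℕ) : ℕ∞) :=
      fun m k h => absurd ⟨k, h⟩ hk
    by_cases hev : IsEvenDeg p n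
    · refine ⟨⟨n, x, hn0, hx⟩, ⊤, hxv, fun _ => Or.inl rfl, fun hp2 hodd => ?_, fun l hl => ?_,
        hmin ⊤⟩
      · exact absurd (hev.resolve_left hp2) (Nat.not_even_iff_odd.2 hodd)
      · exact absurd hl.symm (ENat.natCast_ne_top l)
    · refine ⟨⟨n, x, hn0, hx⟩, 2, hxv, fun h => absurd h hev, fun _ _ => rfl, fun l hl => ?_,
        hmin 2⟩
      obtain rfl : 2 = l := by exact_mod_cast hl
      rw [IsEvenDeg, not_or, Nat.not_even_iff_odd] at hev
      exact sq_eq_zero_of_odd hev.1 hev.2 hx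

variable (A) in
theorem exists_minimalGenerators : Nonempty A.MinimalGenerators := by
  classical
  obtain ⟨s, hsH, hs, hspan, ht⟩ := exists_adapted_basis (K := ZMod p) (t := A.nilClasses)
    (H := {v | ∃ n, v ∈ A.indecOps.deg n})
    (by rintro k l hkl _ ⟨n, x, hx, rfl⟩; exact ⟨n, x, hx.mono hkl, rfl⟩)
    (by rintro k _ ⟨n, x, hx, rfl⟩; exact ⟨n, A.toQ_mem_deg hx.mem⟩)
    (by
      rw [eq_top_iff]
      rintro v -
      exact mem_of_degProj_mem A.indec_isInternal fun n =>
        Submodule.subset_span ⟨n, degProj_mem _ n v⟩)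
  have hs0 : ∀ v : s, (v : A.Indec) ≠ 0 := fun v => hs.ne_zero v.2
  choose d hd using fun v : s => hsH v.2
  choose g height hgv heven hodd hpow hmin using fun v : s =>
    exists_generator_of_class (hs0 v) (hd v)
  let b : Module.Basis s (ZMod p) A.Indec := Module.Basis.mk hs (by
    rw [← hspan]
    exact Submodule.span_mono (by rintro v hv; exact ⟨⟨v, hv⟩, rfl⟩))
  have hb : ∀ v, b v = v := fun v => Module.Basis.mk_apply _ _ v
  have hzero : ∀ (v : s) (r : Set A.Indec), r ⊆ s → (v : A.Indec) ∉ r →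
      ∀ w ∈ Submodule.span (ZMod p) r, b.coord v w = 0 := by
    intro v r hr hv w hw
    refine (Submodule.span_le (p := LinearMap.ker (b.coord v))).2 (fun w hw => ?_) hw
    have hne : (⟨w, hr hw⟩ : s) ≠ v := fun h => hv (h ▸ hw)
    change b.coord v w = 0
    have := b.repr_self_apply ⟨w, hr hw⟩ v
    rwa [hb, if_neg hne] at this
  have hsupp : ∀ v, SupportedIn (g v).d (b.coord v ∘ₗ A.toQ) := by
    intro v n hn x hx
    have h1 := mem_span_of_mem_deg A.indec_isInternal hsH
      (hspan ▸ Submodule.mem_top : A.toQ x ∈ Submodule.span (ZMod p) s) (A.toQ_mem_deg hx)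
    refine hzero v _ Set.inter_subset_left (fun hv => hs0 v ?_) _ h1
    rw [← degProj_of_mem A.indec_isInternal hv.2]
    refine degProj_of_mem_ne A.indec_isInternal hn.symm ?_
    rw [← hgv v]
    exact A.toQ_mem_deg (g v).mem
  exact ⟨{
    idx := s
    linearOrder := linearOrderOfSTO WellOrderingRel
    g := g
    height := height
    height_even := heven
    height_odd := hodd
    pow_eq_zero := hpow
    coord := fun v => b.coord v ∘ₗ A.toQ
    coord_self := fun v => by
      rw [LinearMap.comp_apply, hgv, ← hb, Module.Basis.coord_apply, b.repr_self,
        Finsupp.single_eq_same]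
    coord_of_ne := fun v w hwv => by
      rw [LinearMap.comp_apply, hgv, ← hb, Module.Basis.coord_apply, b.repr_self,
        Finsupp.single_eq_of_ne hwv.symm]
    coord_decSub := fun v x hx => by rw [LinearMap.comp_apply, A.toQ_of_mem_decSub hx, map_zero]
    coord_supported := hsupp
    coord_nilAt := fun v k n x hx hlt => by
      refine hzero v (s ∩ A.nilClasses k) Set.inter_subset_left (fun hv => ?_) _
        (ht k ⟨n, x, hx, rfl⟩)
      exact absurd (hmin v k hv.2) (not_le.2 hlt)
    span_toQ := fun x => by
      have : (Set.range fun v => A.toQ (g v).val) = s := by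
        simp only [hgv, Subtype.range_coe]
      rw [this, hspan]
      exact Submodule.mem_top }⟩

/-- **Borel's theorem** on the structure of Hopf algebras over `𝔽_p`; coassociativity is not
needed. -/
theorem exists_borelSystem (h : A.HopfStructure) : Nonempty A.BorelSystem :=
  A.exists_minimalGenerators.map fun b => b.borelSystem h

end SteenrodCAlg

/-- Finite generation of `H_0^Q(A) = QA` and of `H_1^Q(A)` for a Hopf algebra `A` that is a finitely
generated unstable algebra over the Steenrod algebra. -/
theorem proposition2p4 {p : ℕ} [Fact p.Prime] (A : SteenrodCAlg.{u} p)
    (hA : A.IsUnstable) (hopf : Nonempty A.HopfStructure) (hfg : A.FG) :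
    -- the counit `S(A) → A` induces an isomorphism `H_0^Q(A) = QA` of graded modules with operations
    (∃ e : A.AQ 0 ≃ₗ[ZMod p] A.Indec,
      (∀ z : A.aqCycles 0, e ((A.aqBoundaries 0).mkQ z) = A.counit.mapIndec z.1) ∧
      (∀ n x, x ∈ (A.aqOps 0).deg n ↔ e x ∈ A.indecOps.deg n) ∧
      (∀ i x, e ((A.aqOps 0).P i x) = A.indecOps.P i (e x)) ∧
      (∀ x, e ((A.aqOps 0).β x) = A.indecOps.β (e x))) ∧
    -- `QA` and `H_1^Q(A)` are finitely generated unstable modules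
    (A.indecOps.IsUnstable ∧ A.indecOps.FG) ∧
    ((A.aqOps 1).IsUnstable ∧ (A.aqOps 1).FG) ∧
    -- for every Borel decomposition of `A` there is a finite set of truncated generators such that,
    -- for each `k ≥ 1`, those of height `p ^ k` generate the same submodule of `QA` over the `P i`
    -- as all generators of height `p ^ k`, and whose tensor powers generate `H_1^Q(A)`
    ∀ b : A.BorelSystem, ∃ J : Set b.idx, J.Finite ∧
      (∀ i ∈ J, ∃ k, i ∈ b.truncated k) ∧
      (∀ k, A.indecOps.spanP ((fun i => (b.g i).toIndec) '' (J ∩ b.truncated k)) =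
        A.indecOps.spanP ((fun i => (b.g i).toIndec) '' b.truncated k)) ∧
      (A.aqOps 1).span {z | ∃ i ∈ J, ∃ k, ∃ hi : i ∈ b.truncated k, z = b.powClass hi} = ⊤ := by
  obtain ⟨b⟩ := hopf.elim fun h => SteenrodCAlg.exists_borelSystem h
  refine ⟨A.exists_aqZeroEquiv, ⟨hA.indec, hfg.indec⟩, ⟨b.aqOne_isUnstable hA, ?_⟩, fun b => ?_⟩
  · obtain ⟨J, -, -, -, h1, h2⟩ := b.exists_finite_generators hA hfg
    exact ⟨_, h1, h2⟩
  · obtain ⟨J, h1, h2, h3, -, h4⟩ := b.exists_finite_generators hA hfg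
    exact ⟨J, h1, h2, h3, h4⟩
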